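/- Let $\alpha>2$, $\theta>0$, $\lambda>0$. Base stations form a homogeneous Poisson point process $\{x_i\}$ of density $\lambda$ in $\mathbb{R}^2$; their power fading gains $g_i$ are i.i.d. and independent of $\{x_i\}$. For a user at the origin, the signal-to-interference ratio when served by the $i$-th base station is $$\mathrm{SIR}_i=\frac{g_i\|x_i\|^{-\alpha}}{\sum_{j\neq i} g_j\|x_j\|^{-\alpha}}.$$ The coverage probability for closest association, $\mathrm{P}^{(\mathrm C)}$, is $\Pr[\mathrm{SIR}_i>\theta]$ with $x_i$ the base station closest to the origin; for strongest association, $\mathrm{P}^{(\mathrm S)}$, it is $\Pr[\mathrm{SIR}_i>\theta]$ with $x_i$ the base station of highest SIR. Write $\mathrm{P}_{\mathrm{cov}}^{\mathrm{LOS},(\mathrm C)}(\theta,m)$ for $\mathrm{P}^{(\mathrm C)}$ when the gains have the Gamma distribution $\Gamma(m,\tfrac1m)$ of shape $m$ and scale $\tfrac1m$ (LOS Nakagami-$m$ fading, $m\ge 1$ an integer), and $\mathrm{P}_{\mathrm{cov}}^{\mathrm{NLOS},(\mathrm C)}(\theta)$, $\mathrm{P}_{\mathrm{cov}}^{\mathrm{NLOS},(\mathrm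 S)}(\theta)$ for $\mathrm{P}^{(\mathrm C)}$, $\mathrm{P}^{(\mathrm S)}$ when the gains are exponential of mean $1$ (Rayleigh fading). Then: (a) $\mathrm{P}_{\mathrm{cov}}^{\mathrm{LOS},(\mathrm C)}(\theta,m+1)>\mathrm{P}_{\mathrm{cov}}^{\mathrm{LOS},(\mathrm C)}(\theta,m)$ for all integers $m\ge1$; moreover $\mathrm{P}_{\mathrm{cov}}^{\mathrm{LOS},(\mathrm C)}(\theta,1)=\mathrm{P}_{\mathrm{cov}}^{\mathrm{NLOS},(\mathrm C)}(\theta)$ and $\mathrm{P}_{\mathrm{cov}}^{\mathrm{LOS},(\mathrm C)}(\theta,m)>\mathrm{P}_{\mathrm{cov}}^{\mathrm{NLOS},(\mathrm C)}(\theta)$ for all integers $m\ge2$. (b) $\lim_{m\to\infty}\mathrm{P}_{\mathrm{cov}}^{\mathrm{LOS},(\mathrm C)}(\theta,m)=\mathrm{P}_{\mathrm{cov}}^{\mathrm{NLOS},(\mathrm S)}(\theta)$, and if $\theta\ge1$ this limit has the closed form $$\mathrm{P}_{\mathrm{cov}}^{\mathrm{NLOS},(\mathrm S)}(\theta)=\frac{1}{2\,\zeta(1)\,\theta^{2/\alpha}},\qquad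 \zeta(m)=-\frac{\Gamma(m+\tfrac2\alpha)\,\Gamma(-\tfrac2\alpha)}{\alpha\,\Gamma(m)}.$$ -/

import Mathlib

open MeasureTheory ProbabilityTheory Filter Topology
open scoped ENNReal NNReal

noncomputable section

namespace CellularNetwork

/-- The Euclidean plane, in which the base stations are located; the typical user is at the
origin. -/
abbrev Plane : Type := EuclideanSpace ℝ (Fin 2)

/-- The number of points of the (enumerated) point process `X` that lie in `A`. -/
def count {Ω : Type*} (X : ℕ → Ω → Plane) (A : Set Plane) (ω : Ω) : ℕ∞ :=
  {i : ℕ | X i ω ∈ A}.encard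

/-- `X 0, X 1, …` is a (measurable) enumeration of the points of a homogeneous Poisson point
process of density `lam` on the plane: the number of points in a bounded Borel set `A` is Poisson
distributed with mean `lam * area A`, and the numbers of points in finitely many pairwise disjoint
bounded Borel sets are independent. -/
structure IsHomogeneousPPP {Ω : Type*} [MeasurableSpace Ω] (P : Measure Ω)
    (X : ℕ → Ω → Plane) (lam : ℝ≥0) : Prop where
  measurable_point : ∀ i, Measurable (X i)
  count_law : ∀ A : Set Plane, MeasurableSet A → Bornology.IsBounded A → ∀ k : ℕ,
    P {ω | count X A ω = k} = poissonMeasure (lam * (volume A).toNNReal) {k}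
  count_indep : ∀ (n : ℕ) (A : Fin n → Set Plane), (∀ j, MeasurableSet (A j)) →
    (∀ j, Bornology.IsBounded (A j)) → Pairwise (Function.onFun Disjoint A) →
    iIndepFun (fun j => count X (A j)) P

/-- A marked Poisson point process `{(X i, g i)}`: the points form a homogeneous Poisson point
process of density `lam`, and the marks `g i` (the channel power fading gains) are independent of
each other and of the points, with common law `F`. -/
structure IsNetwork {Ω : Type*} [MeasurableSpace Ω] (P : Measure Ω)
    (X : ℕ → Ω → Plane) (g : ℕ → Ω → ℝ) (lam : ℝ≥0) (F : Measure ℝ) : Prop where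
  isPPP : IsHomogeneousPPP P X lam
  measurable_mark : ∀ i, Measurable (g i)
  mark_law : ∀ i, P.map (g i) = F
  mark_iIndep : iIndepFun g P
  mark_indep_points : IndepFun (fun ω i => X i ω) (fun ω i => g i ω) P

/-- Law of the power gain under LOS (Nakagami-`m`) fading: the Gamma distribution with shape `m`
and scale `1 / m`, that is, with rate `m`. -/
def losFading (m : ℕ) : Measure ℝ := gammaMeasure m m

/-- Law of the power gain under NLOS (Rayleigh) fading: the exponential distribution of mean 1. -/
def nlosFading : Measure ℝ := expMeasure 1

/-- The power `g i * r ^ (-α)` received at the origin from the `i`-th base station, where `r` is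
its distance from the origin. -/
def rxPower {Ω : Type*} (α : ℝ) (X : ℕ → Ω → Plane) (g : ℕ → Ω → ℝ) (i : ℕ) (ω : Ω) : ℝ≥0∞ :=
  ENNReal.ofReal (g i ω) * ENNReal.ofReal ‖X i ω‖ ^ (-α)

/-- The aggregate interference when the user is served by the `i`-th base station. -/
def interference {Ω : Type*} (α : ℝ) (X : ℕ → Ω → Plane) (g : ℕ → Ω → ℝ) (i : ℕ) (ω : Ω) :
    ℝ≥0∞ :=
  ∑' j : {j : ℕ // j ≠ i}, rxPower α X g j ω

/-- The signal-to-interference ratio when the user is served by the `i`-th base station. -/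
def sir {Ω : Type*} (α : ℝ) (X : ℕ → Ω → Plane) (g : ℕ → Ω → ℝ) (i : ℕ) (ω : Ω) : ℝ≥0∞ :=
  rxPower α X g i ω / interference α X g i ω

/-- Coverage probability for closest association: the probability that the SIR from the closest
base station exceeds `θ`. -/
def coverageClosest {Ω : Type*} [MeasurableSpace Ω] (P : Measure Ω) (X : ℕ → Ω → Plane)
    (g : ℕ → Ω → ℝ) (α θ : ℝ) : ℝ :=
  P.real {ω | ∃ i, (∀ j, ‖X i ω‖ ≤ ‖X j ω‖) ∧ ENNReal.ofReal θ < sir α X g i ω}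

/-- Coverage probability for strongest association: the probability that the SIR from the base
station of highest SIR exceeds `θ`. -/
def coverageStrongest {Ω : Type*} [MeasurableSpace Ω] (P : Measure Ω) (X : ℕ → Ω → Plane)
    (g : ℕ → Ω → ℝ) (α θ : ℝ) : ℝ :=
  P.real {ω | ∃ i, (∀ j, sir α X g j ω ≤ sir α X g i ω) ∧ ENNReal.ofReal θ < sir α X g i ω}

/-- `ζ(m) = -Γ(m + 2/α) Γ(-2/α) / (α Γ(m))`. -/
def zetaCoeff (α m : ℝ) : ℝ :=
  -(Real.Gamma (m + 2 / α) * Real.Gamma (-(2 / α))) / (α * Real.Gamma m)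

end CellularNetwork

end

noncomputable section

namespace CellularNetwork

/-! Write `δ = 2/α`. Adding `θ` times the served power to both sides of `θ * interference < power`
shows that the SIR of a point exceeds `θ` exactly when its power exceeds the fraction `θ / (1 + θ)`
of the total power. Such a point is called covering. Coverage under strongest association means that
some point is covering; under closest association, that the closest point is covering.

The proof realizes all fading laws on one Rayleigh network. A fading law enters the intensity of the
received powers only through its moment of order `δ`, that is, through a scale factor that coverage
does not see. Given its power, a point has the gain law tilted by `y ^ δ`, which for Nakagami-`m`
fading is the gamma law of shape `m + δ` and rate `m`. Keeping the powers up to a common factor and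
transporting the tilted gains by the increasing quantile map therefore turns a Rayleigh network into
a Nakagami-`m` network (`lintegral_radialFactor`, `IsPoisson.isPoisson_shift`). In this coupling the
covering points do not depend on `m`. Only the order of the distances does, since the `α`-th power
of a distance is proportional to inverse power times gain.

Monotonicity comes from the star order. The log ratio of two gamma densities of different shapes is
strictly concave up to sign, so a quantile map `χ` towards larger shape has `χ u / u` strictly
decreasing (`transport_gammaMeasure_div_lt`). If a covering point is closer than a noncovering one,
whose power is smaller, then it stays closer when `m` grows (`mul_lt_mul_of_star`). The coverage
events thus increase with `m`. They increase strictly because, with positive probability, two points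
dominate the configuration and exchange their order between `m` and `m + 1`
(`shiftCovers_of_dominant`).

As `m → ∞` the tilted gamma laws concentrate at `1`, so the distances become ordered by power and
the closest point covers as soon as some point does (`eventually_shiftCovers`). For `θ ≥ 1` at most
one point covers. The limit is then the mean number of covering points, computed from the Mecke
formula and a Gaussian integral.

All facts about Poisson processes are derived from the Laplace functional. It extends to values in
`[0, ∞]` and determines the joint law of countably many sums over the process. -/

/-! ### The exponential on `[0, ∞]`. -/

/-- The exponential `e^{-x}` of an extended nonnegative number. -/
def ex (x : ℝ≥0∞) : ℝ≥0∞ := EReal.exp (-(x : EReal))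

@[simp] lemma ex_zero : ex 0 = 1 := by simp [ex]

@[simp] lemma ex_top : ex ⊤ = 0 := by simp [ex]

lemma ex_ofReal {x : ℝ} (hx : 0 ≤ x) : ex (ENNReal.ofReal x) = ENNReal.ofReal (Real.exp (-x)) := by
  rw [ex, EReal.coe_ennreal_ofReal, max_eq_left hx, ← EReal.coe_neg, EReal.exp_coe]

lemma ex_coe (x : ℝ≥0) : ex x = ENNReal.ofReal (Real.exp (-x)) := by
  rw [← ENNReal.ofReal_coe_nnreal, ex_ofReal x.coe_nonneg]

lemma ex_strictAnti : StrictAnti ex := fun x y h => by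
  rw [ex, ex, EReal.exp_lt_exp_iff, EReal.neg_lt_neg_iff]
  exact_mod_cast h

lemma ex_antitone : Antitone ex := ex_strictAnti.antitone

lemma ex_injective : Function.Injective ex := ex_strictAnti.injective

lemma ex_le_one (x : ℝ≥0∞) : ex x ≤ 1 := ex_zero ▸ ex_antitone (zero_le (a := x))

lemma ex_ne_top (x : ℝ≥0∞) : ex x ≠ ⊤ := ((ex_le_one x).trans_lt ENNReal.one_lt_top).ne

lemma ex_pos {x : ℝ≥0∞} (hx : x ≠ ⊤) : 0 < ex x := by
  rw [← ex_top]; exact ex_strictAnti hx.lt_top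

lemma continuous_ex : Continuous ex :=
  ENNReal.continuous_exp.comp (continuous_neg.comp continuous_coe_ennreal_ereal)

@[fun_prop] lemma measurable_ex : Measurable ex := continuous_ex.measurable

lemma ex_add (x y : ℝ≥0∞) : ex (x + y) = ex x * ex y := by
  induction x with
  | top => simp
  | coe x =>
    induction y with
    | top => simp
    | coe y =>
      rw [← ENNReal.coe_add, ex_coe, ex_coe, ex_coe, ← ENNReal.ofReal_mul (by positivity),
        ← Real.exp_add, NNReal.coe_add, neg_add]

lemma ex_sum {ι : Type*} (s : Finset ι) (f : ι → ℝ≥0∞) :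
    ex (∑ i ∈ s, f i) = ∏ i ∈ s, ex (f i) := by
  classical
  induction s using Finset.induction_on with
  | empty => simp
  | insert a s ha ih => rw [Finset.sum_insert ha, Finset.prod_insert ha, ex_add, ih]

lemma ex_nsmul (n : ℕ) (x : ℝ≥0∞) : ex (n • x) = ex x ^ n := by
  have := ex_sum (Finset.range n) (fun _ => x)
  simpa using this

lemma one_sub_ex_le (x : ℝ≥0∞) : 1 - ex x ≤ x := by
  induction x with
  | top => simp
  | coe x =>
    rw [ex_coe, ← ENNReal.ofReal_one, ← ENNReal.ofReal_sub _ (Real.exp_pos _).le,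
      ← ENNReal.ofReal_coe_nnreal]
    apply ENNReal.ofReal_le_ofReal
    have := Real.add_one_le_exp (-(x : ℝ))
    linarith

lemma one_sub_ex_mono : Monotone fun x => 1 - ex x := fun _ _ h =>
  tsub_le_tsub_left (ex_antitone h) 1

lemma continuous_one_sub_ex : Continuous fun x => 1 - ex x :=
  ENNReal.continuous_sub_left ENNReal.one_ne_top |>.comp continuous_ex

lemma ex_add_one_sub (x : ℝ≥0∞) : ex x + (1 - ex x) = 1 :=
  add_tsub_cancel_of_le (ex_le_one x)

/-- The inverse of `ex` on `[0, 1]`. -/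
def lg (y : ℝ≥0∞) : ℝ≥0∞ := (-(ENNReal.log y)).toENNReal

lemma ex_lg {y : ℝ≥0∞} (hy : y ≤ 1) : ex (lg y) = y := by
  have h : 0 ≤ -(ENNReal.log y) := by
    rw [EReal.le_neg]; simpa using hy
  rw [ex, lg, EReal.coe_toENNReal h, neg_neg, ENNReal.exp_log]

@[fun_prop] lemma measurable_lg : Measurable lg := by
  unfold lg
  fun_prop

lemma tendsto_ex_sum_range (f : ℕ → ℝ≥0∞) :
    Tendsto (fun n => ex (∑ i ∈ Finset.range n, f i)) atTop (𝓝 (ex (∑' i, f i))) :=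
  (continuous_ex.tendsto _).comp ENNReal.summable.hasSum.tendsto_sum_nat

lemma lintegral_ex_ne_top {Ω : Type*} [MeasurableSpace Ω] (P : Measure Ω) [IsFiniteMeasure P]
    (F : Ω → ℝ≥0∞) : ∫⁻ ω, ex (F ω) ∂P ≠ ⊤ := by
  refine ((lintegral_mono fun ω => ex_le_one (F ω)).trans_lt ?_).ne
  simp [measure_lt_top]

/-- Dominated convergence for the exponentials `e^{-F n}`. -/
lemma tendsto_lintegral_ex {Ω : Type*} [MeasurableSpace Ω] (P : Measure Ω) [IsFiniteMeasure P]
    {F : ℕ → Ω → ℝ≥0∞} {G : Ω → ℝ≥0∞} (hF : ∀ n, Measurable (F n))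
    (h : ∀ᵐ ω ∂P, Tendsto (fun n => F n ω) atTop (𝓝 (G ω))) :
    Tendsto (fun n => ∫⁻ ω, ex (F n ω) ∂P) atTop (𝓝 (∫⁻ ω, ex (G ω) ∂P)) := by
  refine tendsto_lintegral_of_dominated_convergence (fun _ => 1)
    (fun n => measurable_ex.comp (hF n)) (fun n => ae_of_all _ fun ω => ex_le_one _)
    (by simp) ?_
  filter_upwards [h] with ω hω
  exact (continuous_ex.tendsto _).comp hω

/-- Monotone convergence for `1 - e^{-f n}`. -/
lemma tendsto_lintegral_one_sub_ex {E : Type*} [MeasurableSpace E] (Λ : Measure E)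
    {f : ℕ → E → ℝ≥0∞} {g : E → ℝ≥0∞} (hf : ∀ n, Measurable (f n)) (hmono : Monotone f)
    (h : ∀ z, Tendsto (fun n => f n z) atTop (𝓝 (g z))) :
    Tendsto (fun n => ∫⁻ z, (1 - ex (f n z)) ∂Λ) atTop (𝓝 (∫⁻ z, (1 - ex (g z)) ∂Λ)) := by
  refine lintegral_tendsto_of_tendsto_of_monotone
    (fun n => (continuous_one_sub_ex.measurable.comp (hf n)).aemeasurable)
    (ae_of_all _ fun z m n hmn => one_sub_ex_mono (hmono hmn z)) (ae_of_all _ fun z => ?_)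
  exact (continuous_one_sub_ex.tendsto _).comp (h z)

/-- Monotone convergence for series. -/
lemma tendsto_tsum_of_monotone {u : ℕ → ℕ → ℝ≥0∞} {v : ℕ → ℝ≥0∞}
    (hu : Monotone u) (h : ∀ i, Tendsto (fun n => u n i) atTop (𝓝 (v i))) :
    Tendsto (fun n => ∑' i, u n i) atTop (𝓝 (∑' i, v i)) := by
  simp_rw [← lintegral_count]
  exact lintegral_tendsto_of_tendsto_of_monotone (fun n => (measurable_of_countable _).aemeasurable)
    (ae_of_all _ fun i m n hmn => hu hmn i) (ae_of_all _ h)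

/-! ### Laplace functionals of the points and of the marked points. -/

/-- The enumerated point process `Z 0, Z 1, …` has the Laplace functional of a Poisson process of
intensity `Λ`. -/
structure IsPoisson {Ω E : Type*} [MeasurableSpace Ω] [MeasurableSpace E] (P : Measure Ω)
    (Z : ℕ → Ω → E) (Λ : Measure E) : Prop where
  measurable : ∀ i, Measurable (Z i)
  laplace : ∀ f : E → ℝ≥0∞, Measurable f →
    ∫⁻ ω, ex (∑' i, f (Z i ω)) ∂P = ex (∫⁻ z, (1 - ex (f z)) ∂Λ)

lemma count_toENNReal {Ω : Type*} (X : ℕ → Ω → Plane) (A : Set Plane) (ω : Ω) :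
    ((count X A ω : ℕ∞) : ℝ≥0∞) = ∑' i, A.indicator (fun _ => (1 : ℝ≥0∞)) (X i ω) := by
  rw [count, ← ENNReal.tsum_set_one, tsum_subtype {i | X i ω ∈ A} (fun _ => (1 : ℝ≥0∞))]
  rfl

variable {Ω : Type*} [MeasurableSpace Ω] {P : Measure Ω}

lemma measurable_count {X : ℕ → Ω → Plane} (hX : ∀ i, Measurable (X i)) {A : Set Plane}
    (hA : MeasurableSet A) : Measurable (count X A) := by
  refine measurable_to_countable' fun k => ?_
  have h : count X A ⁻¹' {k} =
      (fun ω => ∑' i, A.indicator (fun _ => (1 : ℝ≥0∞)) (X i ω)) ⁻¹' {(k : ℝ≥0∞)} := by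
    ext ω
    simp only [Set.mem_preimage, Set.mem_singleton_iff, ← count_toENNReal]
    exact ENat.toENNReal_inj.symm
  rw [h]
  exact (Measurable.tsum fun i => (measurable_const.indicator hA).comp (hX i))
    (measurableSet_singleton _)

/-- The exponential series for the generating function `e^{-r(1 - x)}` at `x = e^{-c}`. The value `c
= ⊤` is included and gives the probability of no point. -/
lemma lintegral_ex_poissonMeasure (r : ℝ≥0) (c : ℝ≥0∞) :
    ∫⁻ k : ℕ, ex (c * k) ∂(poissonMeasure r) = ex (r * (1 - ex c)) := by
  rw [poissonMeasure, lintegral_sum_measure]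
  obtain ⟨x, hx⟩ : ∃ x : ℝ≥0, ex c = x := ⟨(ex c).toNNReal, (ENNReal.coe_toNNReal (ex_ne_top c)).symm⟩
  have hx1 : x ≤ 1 := by have := ex_le_one c; rw [hx] at this; exact_mod_cast this
  have h1 : ∀ k : ℕ, ∫⁻ a : ℕ, ex (c * a) ∂(ENNReal.ofReal
      (Real.exp (-r) * r ^ k / (k.factorial)) • Measure.dirac k) =
      ENNReal.ofReal (Real.exp (-r) * ((r * x : ℝ) ^ k / (k.factorial))) := fun k => by
    rw [lintegral_smul_measure, lintegral_dirac, mul_comm c, ← nsmul_eq_mul, ex_nsmul, hx,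
      ← ENNReal.coe_pow, ← ENNReal.ofReal_coe_nnreal, smul_eq_mul,
      ← ENNReal.ofReal_mul (by positivity)]
    congr 1
    push_cast
    ring
  have h2 := (NormedSpace.expSeries_div_hasSum_exp (r * x : ℝ)).mul_left (Real.exp (-r))
  simp_rw [h1]
  rw [← ENNReal.ofReal_tsum_of_nonneg (fun k => by positivity) h2.summable, h2.tsum_eq, hx,
    ← ENNReal.coe_one, ← ENNReal.coe_sub, ← ENNReal.coe_mul, ex_coe, ← Real.exp_eq_exp_ℝ,
    ← Real.exp_add]
  congr 2
  push_cast [hx1]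
  ring

/-- `count_law` gives the masses of finite counts only. The Poisson law is thus dominated by the law
of the count, and a domination between probability measures is an equality, so the count is almost
surely finite. -/
lemma IsHomogeneousPPP.map_count [IsProbabilityMeasure P] {X : ℕ → Ω → Plane} {lam : ℝ≥0}
    (h : IsHomogeneousPPP P X lam) {A : Set Plane} (hA : MeasurableSet A)
    (hb : Bornology.IsBounded A) :
    P.map (count X A) =
      (poissonMeasure (lam * (volume A).toNNReal)).map (Nat.cast : ℕ → ℕ∞) := by
  have hm := measurable_count h.measurable_point hA
  have := Measure.isProbabilityMeasure_map (μ := P) hm.aemeasurable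
  symm
  refine Measure.eq_of_le_of_isProbabilityMeasure (Measure.le_iff.2 fun s hs => ?_)
  rw [Measure.map_apply measurable_from_nat hs, ← Measure.tsum_indicator_apply_singleton _ _
    (measurable_from_nat hs), ← Measure.tsum_indicator_apply_singleton _ _ hs,
    ← tsum_subtype, ← tsum_subtype]
  have hinj : Function.Injective (fun k : ((Nat.cast : ℕ → ℕ∞) ⁻¹' s) => (⟨(k : ℕ), k.2⟩ : s)) := by
    rintro ⟨a, ha⟩ ⟨b, hb⟩ hab
    simpa using hab
  refine le_trans (le_of_eq ?_) (ENNReal.tsum_comp_le_tsum_of_injective hinj _)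
  refine tsum_congr fun k => ?_
  rw [Measure.map_apply hm (measurableSet_singleton _), ← h.count_law A hA hb k]
  rfl

lemma IsHomogeneousPPP.lintegral_ex_count [IsProbabilityMeasure P] {X : ℕ → Ω → Plane}
    {lam : ℝ≥0} (h : IsHomogeneousPPP P X lam) {A : Set Plane} (hA : MeasurableSet A)
    (hb : Bornology.IsBounded A) (c : ℝ≥0∞) :
    ∫⁻ ω, ex (c * (count X A ω : ℕ∞)) ∂P = ex ((lam • volume) A * (1 - ex c)) := by
  have hm := measurable_count h.measurable_point hA
  have h1 := lintegral_map (μ := P) (f := fun n : ℕ∞ => ex (c * n)) (measurable_of_countable _) hm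
  rw [← h1, h.map_count hA hb, lintegral_map (measurable_of_countable _) measurable_from_nat]
  simp only [ENat.toENNReal_coe]
  rw [lintegral_ex_poissonMeasure, ENNReal.coe_mul, ENNReal.coe_toNNReal hb.measure_lt_top.ne]
  rfl

/-- The level sets of `f` within `B` are disjoint and bounded, so the sum is a combination of
independent Poisson counts and the Laplace transform factorizes. -/
lemma IsHomogeneousPPP.laplace_simple [IsProbabilityMeasure P] {X : ℕ → Ω → Plane}
    {lam : ℝ≥0} (h : IsHomogeneousPPP P X lam) (f : SimpleFunc Plane ℝ≥0∞) {B : Set Plane}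
    (hB : MeasurableSet B) (hb : Bornology.IsBounded B) :
    ∫⁻ ω, ex (∑' i, B.indicator f (X i ω)) ∂P =
      ex (∫⁻ z, (1 - ex (B.indicator f z)) ∂(lam • volume)) := by
  let n := f.range.card
  let v : Fin n → ℝ≥0∞ := fun j => (f.range.equivFin.symm j : ℝ≥0∞)
  let A : Fin n → Set Plane := fun j => f ⁻¹' {v j} ∩ B
  have hA : ∀ j, MeasurableSet (A j) := fun j => (f.measurableSet_preimage _).inter hB
  have hAb : ∀ j, Bornology.IsBounded (A j) := fun j => hb.subset Set.inter_subset_right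
  have hv : Function.Injective v := Subtype.val_injective.comp f.range.equivFin.symm.injective
  have hd : Pairwise (Function.onFun Disjoint A) := fun i j hij =>
    Set.disjoint_left.2 fun z hi hj => hij (hv (hi.1.symm.trans hj.1))
  have key : ∀ (c : ℝ≥0∞ → ℝ≥0∞) (z : Plane),
      ∑ j, c (v j) * (A j).indicator (fun _ => (1 : ℝ≥0∞)) z = B.indicator (fun z => c (f z)) z := by
    intro c z
    by_cases hz : z ∈ B
    · rw [Set.indicator_of_mem hz]
      let j₀ : Fin n := f.range.equivFin ⟨f z, SimpleFunc.mem_range_self f z⟩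
      have hj₀ : v j₀ = f z := by simp [v, j₀]
      rw [Finset.sum_eq_single j₀]
      · rw [Set.indicator_of_mem (show z ∈ A j₀ from ⟨hj₀.symm, hz⟩), hj₀, mul_one]
      · intro j _ hj
        rw [Set.indicator_of_notMem, mul_zero]
        exact fun hzj => hj (hv (hj₀ ▸ hzj.1.symm))
      · simp
    · rw [Set.indicator_of_notMem hz]
      refine Finset.sum_eq_zero fun j _ => ?_
      rw [Set.indicator_of_notMem fun hzj => hz hzj.2, mul_zero]
  have h1 : ∀ ω, ex (∑' i, B.indicator f (X i ω)) = ∏ j, ex (v j * (count X (A j) ω : ℕ∞)) := by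
    intro ω
    rw [← ex_sum]
    congr 1
    simp_rw [count_toENNReal, ← ENNReal.tsum_mul_left]
    rw [← Summable.tsum_finsetSum fun _ _ => ENNReal.summable]
    exact tsum_congr fun i => (key id (X i ω)).symm
  have h2 : ∀ z, 1 - ex (B.indicator f z) =
      ∑ j, (1 - ex (v j)) * (A j).indicator (fun _ => (1 : ℝ≥0∞)) z := by
    intro z
    rw [key (fun y => 1 - ex y) z]
    by_cases hz : z ∈ B <;> simp [hz]
  simp_rw [h1, h2]
  rw [lintegral_prod_eq_prod_lintegral_of_indepFun _ (fun j ω => ex (v j * (count X (A j) ω : ℕ∞)))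
    ((h.count_indep n A hA hAb hd).comp (fun j (k : ℕ∞) => ex (v j * k))
      fun j => measurable_of_countable _)
    fun j => (measurable_of_countable fun k : ℕ∞ => ex (v j * k)).comp
      (measurable_count h.measurable_point (hA j)), lintegral_finsetSum _ fun j _ =>
      (measurable_const.indicator (hA j)).const_mul _, ex_sum]
  refine Finset.prod_congr rfl fun j _ => ?_
  rw [h.lintegral_ex_count (hA j) (hAb j), lintegral_const_mul _
    (measurable_const.indicator (hA j)), lintegral_indicator_const (hA j), one_mul, mul_comm]

lemma IsHomogeneousPPP.isPoisson [IsProbabilityMeasure P] {X : ℕ → Ω → Plane}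
    {lam : ℝ≥0} (h : IsHomogeneousPPP P X lam) : IsPoisson P X (lam • volume) where
  measurable := h.measurable_point
  laplace f hf := by
    -- Counts are prescribed on bounded sets only, so the simple approximations of `f` are cut off
    -- to growing balls; monotone convergence then reaches `f`.
    let B : ℕ → Set Plane := fun n => Metric.closedBall 0 n
    let u : ℕ → Plane → ℝ≥0∞ := fun n => (B n).indicator (SimpleFunc.eapprox f n)
    have hBmono : Monotone B := fun m n hmn => Metric.closedBall_subset_closedBall (by exact_mod_cast hmn)
    have hum : ∀ n, Measurable (u n) := fun n =>
      (SimpleFunc.measurable _).indicator Metric.isClosed_closedBall.measurableSet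
    have hmono : Monotone u := fun m n hmn z => by
      refine (Set.indicator_le_indicator_of_subset (hBmono hmn) (fun _ => zero_le) z).trans ?_
      exact Set.indicator_le_indicator (SimpleFunc.monotone_eapprox f hmn z)
    have hlim : ∀ z, Tendsto (fun n => u n z) atTop (𝓝 (f z)) := fun z => by
      have h1 : Tendsto (fun n => SimpleFunc.eapprox f n z) atTop (𝓝 (f z)) := by
        rw [← SimpleFunc.iSup_eapprox_apply hf z]
        exact tendsto_atTop_iSup fun m n hmn => SimpleFunc.monotone_eapprox f hmn z
      refine h1.congr' ?_
      obtain ⟨N, hN⟩ := exists_nat_ge ‖z‖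
      filter_upwards [eventually_ge_atTop N] with n hn
      have : z ∈ B n := by
        simp only [B, mem_closedBall_zero_iff]
        exact hN.trans (by exact_mod_cast hn)
      exact (Set.indicator_of_mem this _).symm
    have h1 : Tendsto (fun n => ∫⁻ ω, ex (∑' i, u n (X i ω)) ∂P) atTop
        (𝓝 (∫⁻ ω, ex (∑' i, f (X i ω)) ∂P)) := by
      refine tendsto_lintegral_ex P
        (fun n => Measurable.tsum fun i => (hum n).comp (h.measurable_point i))
        (ae_of_all _ fun ω => tendsto_tsum_of_monotone (fun m n hmn i => hmono hmn _)
          fun i => hlim _)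
    have h2 := (continuous_ex.tendsto _).comp
      (tendsto_lintegral_one_sub_ex (lam • volume) hum hmono hlim)
    refine tendsto_nhds_unique h1 (h2.congr fun n => ?_)
    exact (h.laplace_simple _ Metric.isClosed_closedBall.measurableSet
      Metric.isBounded_closedBall).symm

/-- Integrating out the marks: the law of the marks is independent of the points. -/
lemma IsNetwork.lintegral_eq [IsProbabilityMeasure P] {X : ℕ → Ω → Plane} {g : ℕ → Ω → ℝ}
    {lam : ℝ≥0} {F : Measure ℝ} (h : IsNetwork P X g lam F)
    (Φ : (ℕ → Plane) → (ℕ → ℝ) → ℝ≥0∞) (hΦ : Measurable (Function.uncurry Φ)) :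
    ∫⁻ ω, Φ (fun i => X i ω) (fun i => g i ω) ∂P =
      ∫⁻ ω, ∫⁻ ω', Φ (fun i => X i ω) (fun i => g i ω') ∂P ∂P := by
  have hX : Measurable fun ω i => X i ω := measurable_pi_lambda _ h.isPPP.measurable_point
  have hg : Measurable fun ω i => g i ω := measurable_pi_lambda _ h.measurable_mark
  have h1 := (indepFun_iff_map_prod_eq_prod_map_map hX.aemeasurable hg.aemeasurable).1
    h.mark_indep_points
  have := Measure.isProbabilityMeasure_map (μ := P) hg.aemeasurable
  have := Measure.isProbabilityMeasure_map (μ := P) hX.aemeasurable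
  calc ∫⁻ ω, Φ (fun i => X i ω) (fun i => g i ω) ∂P
      = ∫⁻ q, Function.uncurry Φ q ∂(P.map fun ω => ((fun i => X i ω), fun i => g i ω)) := by
        rw [lintegral_map hΦ (hX.prodMk hg)]; rfl
    _ = ∫⁻ ω, ∫⁻ ω', Φ (fun i => X i ω) (fun i => g i ω') ∂P ∂P := by
        rw [h1, lintegral_prod _ hΦ.aemeasurable, lintegral_map hΦ.lintegral_prod_right' hX]
        refine lintegral_congr fun ω => ?_
        exact lintegral_map (hΦ.comp measurable_prodMk_left) hg

/-- The marked points of a network form a Poisson process on `Plane × ℝ`. -/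
lemma IsNetwork.isPoisson [IsProbabilityMeasure P] {X : ℕ → Ω → Plane} {g : ℕ → Ω → ℝ}
    {lam : ℝ≥0} {F : Measure ℝ} [IsProbabilityMeasure F] (h : IsNetwork P X g lam F) :
    IsPoisson P (fun i ω => (X i ω, g i ω)) ((lam • volume : Measure Plane).prod F) where
  measurable i := (h.isPPP.measurable_point i).prodMk (h.measurable_mark i)
  laplace f hf := by
    -- Given the points, each mark contributes an independent factor `H`. With `H = e^{-lg H}`, what
    -- remains is a Laplace functional of the points alone.
    let H : Plane → ℝ≥0∞ := fun x => ∫⁻ y, ex (f (x, y)) ∂F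
    have hef : Measurable fun q : Plane × ℝ => ex (f q) := measurable_ex.comp hf
    have hH : Measurable H := hef.lintegral_prod_right'
    have hH1 : ∀ x, H x ≤ 1 := fun x =>
      (lintegral_mono fun y => ex_le_one _).trans (by simp)
    have hΦ : Measurable (Function.uncurry fun (x : ℕ → Plane) (y : ℕ → ℝ) =>
        ex (∑' i, f (x i, y i))) :=
      measurable_ex.comp (Measurable.tsum fun i => hf.comp
        (((measurable_pi_apply i).comp measurable_fst).prodMk
          ((measurable_pi_apply i).comp measurable_snd)))
    rw [h.lintegral_eq _ hΦ]
    have h1 : ∀ x : ℕ → Plane, ∫⁻ ω, ex (∑' i, f (x i, g i ω)) ∂P = ex (∑' i, lg (H (x i))) := by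
      intro x
      have hfm : ∀ i, Measurable fun ω => f (x i, g i ω) := fun i =>
        hf.comp (measurable_const.prodMk (h.measurable_mark i))
      -- Independence of the marks factorizes finite products; both sides are limits over the first
      -- `n` points.
      refine tendsto_nhds_unique (tendsto_lintegral_ex P
        (fun n => Finset.measurable_sum (Finset.range n) fun i _ => hfm i)
        (ae_of_all _ fun ω => ENNReal.summable.hasSum.tendsto_sum_nat)) ?_
      refine (tendsto_ex_sum_range fun i => lg (H (x i))).congr fun n => ?_
      simp_rw [ex_sum]
      rw [lintegral_prod_eq_prod_lintegral_of_indepFun _ (fun i ω => ex (f (x i, g i ω)))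
        (h.mark_iIndep.comp (fun i y => ex (f (x i, y)))
          fun i => measurable_ex.comp (hf.comp measurable_prodMk_left))
        fun i => measurable_ex.comp (hfm i)]
      refine Finset.prod_congr rfl fun i _ => ?_
      rw [ex_lg (hH1 _), ← lintegral_map (f := fun y => ex (f (x i, y)))
        (hef.comp measurable_prodMk_left) (h.measurable_mark i), h.mark_law]
    simp_rw [h1]
    rw [h.isPPP.isPoisson.laplace (fun x => lg (H x)) (measurable_lg.comp hH), lintegral_prod
      (fun z => 1 - ex (f z)) (measurable_const.sub hef).aemeasurable]
    congr 1
    refine lintegral_congr fun x => ?_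
    rw [ex_lg (hH1 x), lintegral_sub (f := fun _ => 1) (g := fun y => ex (f (x, y)))
      (hef.comp measurable_prodMk_left) (lintegral_ex_ne_top F _) (ae_of_all _ fun y => ex_le_one _)]
    simp [H]

open scoped BoundedContinuousFunction

/-! ### Uniqueness of the Laplace transform on `[0, ∞]^ι`. -/

section LaplaceUniqueness

variable {ι : Type*}

/-- The linear form `∑ c_i y_i` on families of extended nonnegative numbers. -/
def linForm (c : ι →₀ ℕ) (y : ι → ℝ≥0∞) : ℝ≥0∞ := c.sum fun i n => n • y i

lemma linForm_add (c d : ι →₀ ℕ) (y : ι → ℝ≥0∞) :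
    linForm (c + d) y = linForm c y + linForm d y := by
  classical
  exact Finsupp.sum_add_index' (fun _ => zero_nsmul _) fun _ _ _ => add_nsmul _ _ _

lemma continuous_linForm (c : ι →₀ ℕ) : Continuous (linForm c) := by
  unfold linForm Finsupp.sum
  simp only [nsmul_eq_mul]
  exact continuous_finsetSum _ fun i _ =>
    (ENNReal.continuous_const_mul (ENNReal.natCast_ne_top _)).comp (continuous_apply i)

lemma measurable_ex_linForm [Countable ι] (c : ι →₀ ℕ) :
    Measurable fun y : ι → ℝ≥0∞ => ex (linForm c y) :=
  measurable_ex.comp (continuous_linForm c).measurable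

/-- The bounded continuous function `y ↦ e^{-∑ c_i y_i}`. -/
def expForm (c : ι →₀ ℕ) : (ι → ℝ≥0∞) →ᵇ ℝ :=
  BoundedContinuousFunction.ofNormedAddCommGroup (fun y => (ex (linForm c y)).toReal)
    (ENNReal.continuousOn_toReal.comp_continuous (continuous_ex.comp (continuous_linForm c))
      fun _ => ex_ne_top _) 1 fun y => by
    rw [Real.norm_of_nonneg ENNReal.toReal_nonneg]
    exact ENNReal.toReal_mono ENNReal.one_ne_top (ex_le_one _)

lemma expForm_apply (c : ι →₀ ℕ) (y : ι → ℝ≥0∞) : expForm c y = (ex (linForm c y)).toReal := rfl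

/-- The functions `e^{-∑ c_i y_i}` form a multiplicative monoid. -/
def expSubmonoid (ι : Type*) : Submonoid ((ι → ℝ≥0∞) →ᵇ ℝ) where
  carrier := Set.range expForm
  one_mem' := ⟨0, by ext y; simp [expForm_apply, linForm]⟩
  mul_mem' := by
    rintro _ _ ⟨c, rfl⟩ ⟨d, rfl⟩
    refine ⟨c + d, ?_⟩
    ext y
    simp [expForm_apply, linForm_add, ex_add]

/-- A finite measure on `[0, ∞]^ι` is determined by its Laplace transform. -/
theorem measure_eq_of_laplace [Countable ι] {μ ν : Measure (ι → ℝ≥0∞)} [IsFiniteMeasure μ]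
    [IsFiniteMeasure ν]
    (h : ∀ c : ι →₀ ℕ, ∫⁻ y, ex (linForm c y) ∂μ = ∫⁻ y, ex (linForm c y) ∂ν) : μ = ν := by
  let A : StarSubalgebra ℝ ((ι → ℝ≥0∞) →ᵇ ℝ) :=
    { Algebra.adjoin ℝ (expSubmonoid ι : Set ((ι → ℝ≥0∞) →ᵇ ℝ)) with
      star_mem' := fun {a} ha => by
        have : star a = a := by ext y; simp
        rw [this]; exact ha }
  have hint : ∀ (μ' : Measure (ι → ℝ≥0∞)) [IsFiniteMeasure μ'] (c : ι →₀ ℕ),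
      ∫ y, expForm c y ∂μ' = (∫⁻ y, ex (linForm c y) ∂μ').toReal := fun μ' _ c =>
    integral_toReal (measurable_ex_linForm c).aemeasurable
      (ae_of_all _ fun y => (ex_ne_top _).lt_top)
  refine ext_of_forall_mem_subalgebra_integral_eq_of_polish (𝕜 := ℝ) (A := A) ?_ ?_
  -- The exponential of a single coordinate is injective, also at `⊤`, so the algebra separates
  -- points.
  · intro y z hyz
    obtain ⟨i, hi⟩ := Function.ne_iff.1 hyz
    refine ⟨_, ⟨_, ⟨expForm (Finsupp.single i 1), Algebra.subset_adjoin ⟨_, rfl⟩, rfl⟩, rfl⟩, ?_⟩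
    change (ex (linForm _ y)).toReal ≠ (ex (linForm _ z)).toReal
    rw [Ne, ENNReal.toReal_eq_toReal_iff' (ex_ne_top _) (ex_ne_top _)]
    intro h
    apply hi
    simpa [linForm] using ex_injective h
  · intro f hf
    -- The exponentials are closed under products, so the algebra they generate is their linear
    -- span, and linearity of the integral suffices.
    have hf' : f ∈ Submodule.span ℝ (expSubmonoid ι : Set ((ι → ℝ≥0∞) →ᵇ ℝ)) := by
      have : f ∈ Subalgebra.toSubmodule (Algebra.adjoin ℝ (expSubmonoid ι : Set _)) := hf
      rwa [Algebra.adjoin_eq_span, Submonoid.closure_eq] at this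
    clear hf
    induction hf' using Submodule.span_induction with
    | mem x hx =>
      obtain ⟨c, rfl⟩ := hx
      rw [hint, hint, h]
    | zero => simp
    | add x y hx hy h1 h2 =>
      simp_rw [BoundedContinuousFunction.add_apply]
      rw [integral_add (x.integrable μ) (y.integrable μ),
        integral_add (x.integrable ν) (y.integrable ν), h1, h2]
    | smul a x hx h1 =>
      simp_rw [BoundedContinuousFunction.smul_apply]
      rw [integral_smul, integral_smul, h1]

end LaplaceUniqueness

/-! ### Joint laws, independence and almost sure properties of Poisson sums. -/

section Poisson

variable {Ω E : Type*} [MeasurableSpace Ω] [MeasurableSpace E] {P : Measure Ω}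
  {Z : ℕ → Ω → E} {Λ : Measure E}

lemma linForm_tsum {ι : Type*} (c : ι →₀ ℕ) (f : ι → ℕ → ℝ≥0∞) :
    linForm c (fun j => ∑' i, f j i) = ∑' i, linForm c fun j => f j i := by
  simp only [linForm, Finsupp.sum, nsmul_eq_mul]
  rw [Summable.tsum_finsetSum fun _ _ => ENNReal.summable]
  simp_rw [ENNReal.tsum_mul_left]

lemma IsPoisson.measurable_tsum (hZ : IsPoisson P Z Λ) {f : E → ℝ≥0∞} (hf : Measurable f) :
    Measurable fun ω => ∑' i, f (Z i ω) :=
  Measurable.tsum fun i => hf.comp (hZ.measurable i)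

lemma IsPoisson.laplace_linForm (hZ : IsPoisson P Z Λ) {ι : Type*} (c : ι →₀ ℕ)
    {f : ι → E → ℝ≥0∞} (hf : ∀ j, Measurable (f j)) :
    ∫⁻ ω, ex (linForm c fun j => ∑' i, f j (Z i ω)) ∂P =
      ex (∫⁻ z, (1 - ex (linForm c fun j => f j z)) ∂Λ) := by
  simp_rw [linForm_tsum]
  refine hZ.laplace (fun z => linForm c fun j => f j z) ?_
  simp only [linForm, Finsupp.sum, nsmul_eq_mul]
  exact Finset.measurable_sum _ fun i _ => (hf i).const_mul _

/-- The joint law of countably many linear functionals of a Poisson process is determined by its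
intensity. -/
theorem IsPoisson.map_eq [IsProbabilityMeasure P] (hZ : IsPoisson P Z Λ)
    {Ω' : Type*} [MeasurableSpace Ω'] {P' : Measure Ω'} [IsProbabilityMeasure P']
    {Z' : ℕ → Ω' → E} (hZ' : IsPoisson P' Z' Λ) {ι : Type*} [Countable ι]
    {f : ι → E → ℝ≥0∞} (hf : ∀ j, Measurable (f j)) :
    P.map (fun ω j => ∑' i, f j (Z i ω)) = P'.map (fun ω j => ∑' i, f j (Z' i ω)) := by
  refine measure_eq_of_laplace fun c => ?_
  rw [lintegral_map (measurable_ex_linForm c)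
      (measurable_pi_lambda _ fun j => hZ.measurable_tsum (hf j)),
    lintegral_map (measurable_ex_linForm c)
      (measurable_pi_lambda _ fun j => hZ'.measurable_tsum (hf j)),
    hZ.laplace_linForm c hf, hZ'.laplace_linForm c hf]

/-- Linear functionals carried by disjoint regions are independent. -/
theorem IsPoisson.iIndepFun_tsum [IsProbabilityMeasure P] (hZ : IsPoisson P Z Λ) {ι : Type*}
    [Fintype ι] {f : ι → E → ℝ≥0∞} (hf : ∀ j, Measurable (f j))
    (hd : ∀ i j z, i ≠ j → f i z = 0 ∨ f j z = 0) :
    iIndepFun (fun j ω => ∑' i, f j (Z i ω)) P := by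
  classical
  have hm : ∀ j, Measurable fun ω => ∑' i, f j (Z i ω) := fun j => hZ.measurable_tsum (hf j)
  rw [iIndepFun_iff_map_fun_eq_pi_map fun j => (hm j).aemeasurable]
  have : ∀ j, IsProbabilityMeasure (P.map fun ω => ∑' i, f j (Z i ω)) := fun j =>
    Measure.isProbabilityMeasure_map (hm j).aemeasurable
  refine measure_eq_of_laplace fun c => ?_
  rw [lintegral_map (measurable_ex_linForm c)
      (measurable_pi_lambda _ hm), hZ.laplace_linForm c hf]
  have h1 : ∀ y : ι → ℝ≥0∞, linForm c y = ∑ j, c j • y j := fun y =>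
    Finsupp.sum_fintype _ _ fun _ => zero_nsmul _
  -- At each `z` at most one term of the linear form is nonzero, so `1 - e^{-·}` is additive here.
  -- The Laplace exponent splits into a sum and the transform into a product.
  have h2 : ∀ z, 1 - ex (linForm c fun j => f j z) = ∑ j, (1 - ex (c j • f j z)) := by
    intro z
    rw [h1]
    by_cases hz : ∃ j, f j z ≠ 0
    · obtain ⟨j, hj⟩ := hz
      have h0 : ∀ i, i ≠ j → f i z = 0 := fun i hij => (hd i j z hij).resolve_right hj
      rw [Finset.sum_eq_single j (fun i _ hij => by simp [h0 i hij]) (by simp),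
        Finset.sum_eq_single j (fun i _ hij => by simp [h0 i hij]) (by simp)]
    · push Not at hz
      simp [hz]
  simp_rw [h2]
  have hsm : ∀ j, Measurable fun z => c j • f j z := fun j => by
    simp only [nsmul_eq_mul]
    exact (hf j).const_mul _
  rw [lintegral_finsetSum _ fun j _ => continuous_one_sub_ex.measurable.fun_comp (hsm j)]
  simp_rw [h1, ex_sum]
  have hcm : ∀ j, Measurable fun y : ℝ≥0∞ => ex (c j • y) := fun j => by
    simp only [nsmul_eq_mul]
    exact measurable_ex.comp (measurable_id.const_mul _)
  rw [lintegral_prod_eq_prod_lintegral_of_indepFun _ (fun j (y : ι → ℝ≥0∞) => ex (c j • y j))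
    (iIndepFun_pi (μ := fun j => P.map fun ω => ∑' i, f j (Z i ω)) fun j => (hcm j).aemeasurable)
    fun j => (hcm j).comp (measurable_pi_apply j)]
  refine Finset.prod_congr rfl fun j _ => ?_
  have h3 := (measurePreserving_eval (fun j => P.map fun ω => ∑' i, f j (Z i ω)) j).lintegral_comp
    (hcm j)
  simp only [Function.eval] at h3
  rw [h3, lintegral_map (hcm j) (hm j)]
  simp_rw [nsmul_eq_mul, ← ENNReal.tsum_mul_left]
  exact (hZ.laplace _ ((hf j).const_mul _)).symm

lemma ae_eq_zero_of_lintegral_ex [IsProbabilityMeasure P] {F : Ω → ℝ≥0∞} (hF : Measurable F)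
    (h : ∫⁻ ω, ex (F ω) ∂P = 1) : ∀ᵐ ω ∂P, F ω = 0 := by
  have h1 : ∫⁻ ω, (1 - ex (F ω)) ∂P = 0 := by
    rw [lintegral_sub (f := fun _ => 1) (g := fun ω => ex (F ω)) (measurable_ex.comp hF)
      (lintegral_ex_ne_top P _) (ae_of_all _ fun _ => ex_le_one _), h]
    simp
  rw [lintegral_eq_zero_iff (continuous_one_sub_ex.measurable.fun_comp hF)] at h1
  filter_upwards [h1] with ω hω
  apply ex_injective
  rw [ex_zero]
  exact le_antisymm (ex_le_one _) (tsub_eq_zero_iff_le.1 hω)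

lemma IsPoisson.ae_notMem [IsProbabilityMeasure P] (hZ : IsPoisson P Z Λ) {A : Set E}
    (hA : MeasurableSet A) (h0 : Λ A = 0) : ∀ᵐ ω ∂P, ∀ i, Z i ω ∉ A := by
  have hf : Measurable (A.indicator fun _ => (1 : ℝ≥0∞)) := measurable_const.indicator hA
  have h1 := hZ.laplace _ hf
  have h2 : ∫⁻ z, (1 - ex (A.indicator (fun _ => (1 : ℝ≥0∞)) z)) ∂Λ = 0 := by
    refine le_antisymm ((lintegral_mono fun z => one_sub_ex_le _).trans ?_) (zero_le)
    rw [lintegral_indicator_const hA, h0, mul_zero]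
  rw [h2, ex_zero] at h1
  filter_upwards [ae_eq_zero_of_lintegral_ex (hZ.measurable_tsum hf) h1] with ω hω i hi
  have := ENNReal.tsum_eq_zero.1 hω i
  simp [hi] at this

lemma IsPoisson.ae_forall [IsProbabilityMeasure P] (hZ : IsPoisson P Z Λ) {p : E → Prop}
    (h : ∀ᵐ z ∂Λ, p z) : ∀ᵐ ω ∂P, ∀ i, p (Z i ω) := by
  obtain ⟨A, hpA, hA, h0⟩ := exists_measurable_superset_of_null (ae_iff.1 h)
  filter_upwards [hZ.ae_notMem hA h0] with ω hω i
  by_contra hp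
  exact hω i (hpA hp)

/-- A sum over a Poisson process is finite as soon as its Laplace exponent is. -/
lemma IsPoisson.ae_tsum_ne_top [IsProbabilityMeasure P] (hZ : IsPoisson P Z Λ) {f : E → ℝ≥0∞}
    (hf : Measurable f) (hfin : ∀ z, f z ≠ ⊤) (hint : ∫⁻ z, (1 - ex (f z)) ∂Λ ≠ ⊤) :
    ∀ᵐ ω ∂P, ∑' i, f (Z i ω) ≠ ⊤ := by
  -- For every `n`, the Laplace transform of `a n` times the sum is at most the probability that the
  -- sum is finite. Its exponent tends to `0` by dominated convergence, so this probability is `1`.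
  let a : ℕ → ℝ≥0∞ := fun n => ((n : ℝ≥0∞) + 1)⁻¹
  have ha : Tendsto a atTop (𝓝 0) := by
    have := (ENNReal.tendsto_inv_nat_nhds_zero).comp (tendsto_add_atTop_nat 1)
    refine this.congr fun n => by simp [a]
  have ha0 : ∀ n, a n ≠ 0 := fun n => ENNReal.inv_ne_zero.2 (by finiteness)
  have ha1 : ∀ n, a n ≤ 1 := fun n => ENNReal.inv_le_one.2 le_add_self
  have hm : Measurable fun ω => ∑' i, f (Z i ω) := hZ.measurable_tsum hf
  have h1 : ∀ n, ∫⁻ ω, ex (a n * ∑' i, f (Z i ω)) ∂P = ex (∫⁻ z, (1 - ex (a n * f z)) ∂Λ) :=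
    fun n => by
      simp_rw [← ENNReal.tsum_mul_left]
      exact hZ.laplace _ (hf.const_mul _)
  have h2 : Tendsto (fun n => ∫⁻ z, (1 - ex (a n * f z)) ∂Λ) atTop (𝓝 0) := by
    have := tendsto_lintegral_of_dominated_convergence (μ := Λ)
      (F := fun n z => 1 - ex (a n * f z)) (f := fun _ => 0) (fun z => 1 - ex (f z))
      (fun n => continuous_one_sub_ex.measurable.comp (hf.const_mul _))
      (fun n => ae_of_all _ fun z => one_sub_ex_mono (mul_le_of_le_one_left' (ha1 n))) hint
      (ae_of_all _ fun z => by
        have h3 : Tendsto (fun n => a n * f z) atTop (𝓝 0) := by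
          have := ENNReal.Tendsto.mul_const (b := f z) ha (Or.inr (hfin z))
          simpa using this
        have := (continuous_one_sub_ex.tendsto 0).comp h3
        simpa [Function.comp_def] using this)
    simpa using this
  have h4 : ∀ n, ex (∫⁻ z, (1 - ex (a n * f z)) ∂Λ) ≤ P {ω | ∑' i, f (Z i ω) ≠ ⊤} := fun n => by
    rw [← h1, ← lintegral_indicator_one (s := {ω | ∑' i, f (Z i ω) ≠ ⊤})
      (hm (measurableSet_singleton ⊤).compl)]
    refine lintegral_mono fun ω => ?_
    by_cases hω : ∑' i, f (Z i ω) = ⊤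
    · simp [hω, ENNReal.mul_top (ha0 n)]
    · rw [Set.indicator_of_mem (by exact hω)]
      exact ex_le_one _
  have h5 : 1 ≤ P {ω | ∑' i, f (Z i ω) ≠ ⊤} := by
    have h6 := (continuous_ex.tendsto 0).comp h2
    rw [ex_zero] at h6
    exact le_of_tendsto' h6 h4
  exact (prob_compl_eq_zero_iff (hm (measurableSet_singleton ⊤).compl)).2
    (le_antisymm prob_le_one h5)

end Poisson

/-! ### Counts in a region, and absence of ties. -/

section Poisson

variable {Ω E : Type*} [MeasurableSpace Ω] [MeasurableSpace E] {P : Measure Ω}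
  {Z : ℕ → Ω → E} {Λ : Measure E}

/-- The number of points of the configuration `z` in `A`, as an extended nonnegative real. -/
def num (A : Set E) (z : ℕ → E) : ℝ≥0∞ := ∑' i, A.indicator (fun _ => 1) (z i)

lemma num_eq_encard {E : Type*} (A : Set E) (z : ℕ → E) :
    num A z = (({i | z i ∈ A}.encard : ℕ∞) : ℝ≥0∞) := by
  rw [← ENNReal.tsum_set_one, tsum_subtype {i | z i ∈ A} (fun _ => (1 : ℝ≥0∞))]
  rfl

lemma IsPoisson.measurable_num (hZ : IsPoisson P Z Λ) {A : Set E} (hA : MeasurableSet A) :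
    Measurable fun ω => num A fun i => Z i ω :=
  hZ.measurable_tsum (measurable_const.indicator hA)

lemma num_cases {E : Type*} (A : Set E) (z : ℕ → E) :
    num A z = 0 ∨ num A z = 1 ∨ 2 ≤ num A z := by
  rw [num_eq_encard]
  rcases eq_or_ne {i | z i ∈ A}.encard 0 with h | h
  · left; simp [h]
  right
  rcases eq_or_ne {i | z i ∈ A}.encard 1 with h1 | h1
  · left; simp [h1]
  right
  have h2 : (1 : ℕ∞) < {i | z i ∈ A}.encard := lt_of_le_of_ne (Order.one_le_iff_ne_zero.2 h) h1.symm
  have h3 : (2 : ℕ∞) ≤ {i | z i ∈ A}.encard := by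
    have := Order.add_one_le_of_lt h2
    rwa [one_add_one_eq_two] at this
  have h4 := ENat.toENNReal_le.2 h3
  simpa using h4

lemma two_le_num {E : Type*} {A : Set E} {z : ℕ → E} {i j : ℕ} (hij : i ≠ j) (hi : z i ∈ A)
    (hj : z j ∈ A) : 2 ≤ num A z := by
  have h := ENNReal.sum_le_tsum (f := fun i => A.indicator (fun _ => (1 : ℝ≥0∞)) (z i)) {i, j}
  rw [Finset.sum_pair hij, Set.indicator_of_mem hi, Set.indicator_of_mem hj,
    one_add_one_eq_two] at h
  exact h

lemma one_le_num {E : Type*} {A : Set E} {z : ℕ → E} : 1 ≤ num A z ↔ ∃ i, z i ∈ A := by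
  rw [num_eq_encard, ← ENat.toENNReal_one, ENat.toENNReal_le, Set.one_le_encard_iff_nonempty]
  rfl

lemma num_eq_zero {E : Type*} {A : Set E} {z : ℕ → E} : num A z = 0 ↔ ∀ i, z i ∉ A := by
  rw [num, ENNReal.tsum_eq_zero]
  refine forall_congr' fun i => ?_
  by_cases h : z i ∈ A <;> simp [h]

lemma num_ne_top {E : Type*} {A : Set E} {z : ℕ → E} : num A z ≠ ⊤ ↔ {i | z i ∈ A}.Finite := by
  rw [num_eq_encard, Ne, ENat.toENNReal_eq_top, ← Ne, Set.encard_ne_top_iff]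

lemma IsPoisson.laplace_num (hZ : IsPoisson P Z Λ) {A : Set E} (hA : MeasurableSet A)
    (c : ℝ≥0∞) :
    ∫⁻ ω, ex (c * num A fun i => Z i ω) ∂P = ex ((1 - ex c) * Λ A) := by
  simp_rw [num, ← ENNReal.tsum_mul_left]
  rw [hZ.laplace (fun z => c * A.indicator (fun _ => 1) z)
    ((measurable_const.indicator hA).const_mul _), ← lintegral_indicator_const hA]
  congr 1
  refine lintegral_congr fun z => ?_
  by_cases h : z ∈ A <;> simp [h]

lemma IsPoisson.ae_finite [IsProbabilityMeasure P] (hZ : IsPoisson P Z Λ) {A : Set E}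
    (hA : MeasurableSet A) (hfin : Λ A ≠ ⊤) : ∀ᵐ ω ∂P, {i | Z i ω ∈ A}.Finite := by
  have h := hZ.ae_tsum_ne_top (f := A.indicator fun _ => 1) (measurable_const.indicator hA)
    (fun z => by by_cases h : z ∈ A <;> simp [h])
    (ne_top_of_le_ne_top (b := Λ A) hfin ((lintegral_mono fun z => one_sub_ex_le _).trans
      (by rw [lintegral_indicator_const hA, one_mul])))
  filter_upwards [h] with ω hω
  exact num_ne_top.1 hω

/-- From `1 + s + s²/2 ≤ e^s` and `(1 - s + s²/2)(1 + s + s²/2) = 1 + s⁴/4 ≥ 1`. -/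
lemma exp_neg_le {s : ℝ} (hs : 0 ≤ s) : Real.exp (-s) ≤ 1 - s + s ^ 2 / 2 := by
  have h1 := Real.quadratic_le_exp_of_nonneg hs
  have h2 : Real.exp (-s) * Real.exp s = 1 := by rw [← Real.exp_add]; simp
  have h3 := mul_le_mul_of_nonneg_left h1 (Real.exp_pos (-s)).le
  have h4 : 0 < 1 + s + s ^ 2 / 2 := by positivity
  refine le_of_mul_le_mul_right ?_ h4
  nlinarith [sq_nonneg (s ^ 2)]

/-- The probability of at least two points in `A` is at most a constant times `(Λ A) ^ 2`. -/
lemma IsPoisson.measure_two_le_num (hZ : IsPoisson P Z Λ) [IsProbabilityMeasure P] :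
    ∃ C : ℝ, 0 ≤ C ∧ ∀ A, MeasurableSet A → ∀ t : ℝ, 0 ≤ t → Λ A = ENNReal.ofReal t →
      P {ω | 2 ≤ num A fun i => Z i ω} ≤ ENNReal.ofReal (C * t ^ 2) := by
  -- With `y = e^{-N}` for the count `N`, the polynomial `(1 - y)(x - y)` vanishes at `N = 0, 1` and
  -- is at least `K` for `N ≥ 2`. Its mean involves the Laplace transforms at `1` and `2`, whose
  -- terms of order `0` and `1` in `t` cancel.
  set x : ℝ := Real.exp (-1) with hx
  have hx0 : 0 < x := Real.exp_pos _
  have hx1 : x < 1 := by rw [hx, Real.exp_lt_one_iff]; norm_num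
  have hK : 0 < (1 - x ^ 2) * (x - x ^ 2) := mul_pos (by nlinarith) (by nlinarith)
  set K := (1 - x ^ 2) * (x - x ^ 2) with hKdef
  refine ⟨1 / (2 * K), by positivity, fun A hA t ht hΛ => ?_⟩
  have he1 : ex 1 = ENNReal.ofReal x := by
    rw [← ENNReal.ofReal_one, ex_ofReal zero_le_one]
  have he2 : ex 2 = ENNReal.ofReal (x ^ 2) := by
    rw [← one_add_one_eq_two, ex_add, he1, ← ENNReal.ofReal_mul hx0.le, sq]
  have hm := hZ.measurable_num hA
  have hset : MeasurableSet {ω | 2 ≤ num A fun i => Z i ω} := measurableSet_le measurable_const hm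
  have hL1 : ∫⁻ ω, ex (num A fun i => Z i ω) ∂P = ENNReal.ofReal (Real.exp (-((1 - x) * t))) := by
    have := hZ.laplace_num hA 1
    simp_rw [one_mul] at this
    rw [this, he1, hΛ, ← ENNReal.ofReal_one, ← ENNReal.ofReal_sub _ hx0.le,
      ← ENNReal.ofReal_mul (by linarith), ex_ofReal (mul_nonneg (by linarith) ht)]
  have hL2 : ∫⁻ ω, ex (2 * num A fun i => Z i ω) ∂P =
      ENNReal.ofReal (Real.exp (-((1 - x ^ 2) * t))) := by
    rw [hZ.laplace_num hA 2, he2, hΛ, ← ENNReal.ofReal_one, ← ENNReal.ofReal_sub _ (by positivity),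
      ← ENNReal.ofReal_mul (by nlinarith), ex_ofReal (mul_nonneg (by nlinarith) ht)]
  have hpt : ∀ ω, ENNReal.ofReal (1 + x) * ex (num A fun i => Z i ω) +
      ENNReal.ofReal K * {ω | 2 ≤ num A fun i => Z i ω}.indicator (fun _ => 1) ω ≤
      ENNReal.ofReal x + ex (2 * num A fun i => Z i ω) := by
    intro ω
    rcases num_cases A fun i => Z i ω with h | h | h
    · rw [Set.indicator_of_notMem (by simp [h]), h]
      simp only [ex_zero, mul_one, mul_zero, add_zero]
      rw [← ENNReal.ofReal_one, ← ENNReal.ofReal_add hx0.le zero_le_one, add_comm]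
    · rw [Set.indicator_of_notMem (by simp [h]), h]
      simp only [mul_one, mul_zero, add_zero, he1, he2]
      rw [← ENNReal.ofReal_mul (by positivity), ← ENNReal.ofReal_add (by positivity) (by positivity)]
      exact ENNReal.ofReal_le_ofReal (by nlinarith)
    · rw [Set.indicator_of_mem (by exact h), mul_one]
      obtain ⟨y, hy⟩ : ∃ y : ℝ≥0, ex (num A fun i => Z i ω) = y :=
        ⟨_, (ENNReal.coe_toNNReal (ex_ne_top _)).symm⟩
      have hy2 : ex (2 * num A fun i => Z i ω) = ENNReal.ofReal ((y : ℝ) ^ 2) := by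
        rw [two_mul, ex_add, hy, ← ENNReal.ofReal_coe_nnreal, ← ENNReal.ofReal_mul y.coe_nonneg, sq]
      have hyx : (y : ℝ) ≤ x ^ 2 := by
        have := ex_antitone h
        rw [hy, he2, ← ENNReal.ofReal_coe_nnreal] at this
        exact (ENNReal.ofReal_le_ofReal_iff (by positivity)).1 this
      have hy0 : (0 : ℝ) ≤ y := y.2
      rw [hy, hy2, ← ENNReal.ofReal_coe_nnreal, ← ENNReal.ofReal_mul (by positivity),
        ← ENNReal.ofReal_add (by positivity) hK.le, ← ENNReal.ofReal_add hx0.le (by positivity)]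
      refine ENNReal.ofReal_le_ofReal ?_
      have : K ≤ (1 - y) * (x - y) :=
        mul_le_mul (by linarith) (by linarith) (by nlinarith) (by nlinarith)
      nlinarith
  have hint := lintegral_mono (μ := P) hpt
  rw [lintegral_add_left ((measurable_ex.fun_comp hm).const_mul _),
    lintegral_const_mul _ (measurable_ex.fun_comp hm), lintegral_const_mul _
      (measurable_const.indicator hset), lintegral_indicator_const hset,
    lintegral_add_left measurable_const, hL1, hL2, lintegral_const, measure_univ, mul_one,
    one_mul] at hint
  set p := P {ω | 2 ≤ num A fun i => Z i ω}
  have hp : p ≠ ⊤ := measure_ne_top _ _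
  rw [← ENNReal.ofReal_toReal hp, ← ENNReal.ofReal_mul (by positivity),
    ← ENNReal.ofReal_mul hK.le, ← ENNReal.ofReal_add (by positivity)
      (mul_nonneg hK.le ENNReal.toReal_nonneg), ← ENNReal.ofReal_add hx0.le (by positivity),
    ENNReal.ofReal_le_ofReal_iff (by positivity)] at hint
  rw [← ENNReal.ofReal_toReal hp]
  refine ENNReal.ofReal_le_ofReal ?_
  have e1 := Real.add_one_le_exp (-((1 - x) * t))
  have e2 : Real.exp (-((1 - x ^ 2) * t)) ≤ 1 - (1 - x ^ 2) * t + ((1 - x ^ 2) * t) ^ 2 / 2 := by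
    have hs : 0 ≤ (1 - x ^ 2) * t := mul_nonneg (by nlinarith) ht
    exact exp_neg_le hs
  have e3 : ((1 - x ^ 2) * t) ^ 2 ≤ t ^ 2 :=
    pow_le_pow_left₀ (mul_nonneg (by nlinarith) ht) (by nlinarith [mul_nonneg (sq_nonneg x) ht]) 2
  have e4 : (1 + x) * (-((1 - x) * t) + 1) ≤ (1 + x) * Real.exp (-((1 - x) * t)) :=
    mul_le_mul_of_nonneg_left e1 (by positivity)
  have : K * p.toReal ≤ t ^ 2 / 2 := by nlinarith
  rw [div_mul_eq_mul_div, one_mul, le_div_iff₀ (by positivity)]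
  linarith

/-- A region of positive finite intensity contains exactly one point with positive probability. -/
lemma IsPoisson.measure_num_eq_one_pos (hZ : IsPoisson P Z Λ) [IsProbabilityMeasure P]
    {A : Set E} (hA : MeasurableSet A) (h0 : Λ A ≠ 0) (hfin : Λ A ≠ ⊤) :
    P {ω | num A (fun i => Z i ω) = 1} ≠ 0 := by
  intro hnull
  set t := (Λ A).toReal with htdef
  have ht : 0 < t := ENNReal.toReal_pos h0 hfin
  have hΛ : Λ A = ENNReal.ofReal t := (ENNReal.ofReal_toReal hfin).symm
  have hm := hZ.measurable_num hA
  -- If the count `N` is almost surely not `1`, then `E[x^N] ≤ P(N = 0) + x²`. The left side exceeds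
  -- `e^{-t}` by at least `x t e^{-t}`, which is impossible for small `x`.
  have key : ∀ x : ℝ, 0 < x → x ≤ 1 → Real.exp (-((1 - x) * t)) ≤ Real.exp (-t) + x ^ 2 := by
    intro x hx0 hx1
    set c := ENNReal.ofReal (-Real.log x)
    have hc : ex c = ENNReal.ofReal x := by
      rw [ex_ofReal (by simpa using Real.log_nonpos hx0.le hx1), neg_neg, Real.exp_log hx0]
    have hL : ∫⁻ ω, ex (c * num A fun i => Z i ω) ∂P =
        ENNReal.ofReal (Real.exp (-((1 - x) * t))) := by
      rw [hZ.laplace_num hA c, hc, hΛ, ← ENNReal.ofReal_one, ← ENNReal.ofReal_sub _ hx0.le,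
        ← ENNReal.ofReal_mul (by linarith), ex_ofReal (mul_nonneg (by linarith) ht.le)]
    have hL0 : ∫⁻ ω, ex (⊤ * num A fun i => Z i ω) ∂P = ENNReal.ofReal (Real.exp (-t)) := by
      rw [hZ.laplace_num hA ⊤, ex_top, tsub_zero, one_mul, hΛ, ex_ofReal ht.le]
    have hle : ∫⁻ ω, ex (c * num A fun i => Z i ω) ∂P ≤
        ∫⁻ ω, (ex (⊤ * num A fun i => Z i ω) + ENNReal.ofReal (x ^ 2)) ∂P := by
      refine lintegral_mono_ae ?_
      have : ∀ᵐ ω ∂P, num A (fun i => Z i ω) ≠ 1 := by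
        rw [ae_iff]; simpa using hnull
      filter_upwards [this] with ω hω
      rcases num_cases A fun i => Z i ω with h | h | h
      · simp [h]
      · exact absurd h hω
      · refine le_add_left ?_
        rw [sq, ENNReal.ofReal_mul hx0.le, ← hc, ← ex_add, ← mul_two]
        exact ex_antitone (mul_le_mul_right h c)
    rw [lintegral_add_right _ measurable_const, hL, hL0, lintegral_const, measure_univ, mul_one,
      ← ENNReal.ofReal_add (by positivity) (by positivity),
      ENNReal.ofReal_le_ofReal_iff (by positivity)] at hle
    exact hle
  have h2 : ∀ x : ℝ, 0 < x → x ≤ 1 → t * Real.exp (-t) ≤ x := by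
    intro x hx0 hx1
    have h3 := key x hx0 hx1
    have h4 : Real.exp (-((1 - x) * t)) = Real.exp (-t) * Real.exp (x * t) := by
      rw [← Real.exp_add]; congr 1; ring
    have h5 := Real.add_one_le_exp (x * t)
    have h6 := Real.exp_pos (-t)
    rw [h4] at h3
    have h7 : Real.exp (-t) * (x * t + 1) ≤ Real.exp (-t) * Real.exp (x * t) :=
      mul_le_mul_of_nonneg_left h5 h6.le
    have h8 : x * (t * Real.exp (-t)) ≤ x * x := by nlinarith
    exact le_of_mul_le_mul_left h8 hx0
  have h9 : 0 < t * Real.exp (-t) := by positivity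
  have h10 := h2 (min 1 (t * Real.exp (-t) / 2)) (by positivity) (min_le_left _ _)
  have := min_le_right 1 (t * Real.exp (-t) / 2)
  linarith

/-- If the real coordinate `r ≥ 0` of the points has Lebesgue intensity, then almost surely it
takes distinct values on distinct points. -/
lemma IsPoisson.ae_injective (hZ : IsPoisson P Z Λ) [IsProbabilityMeasure P] {r : E → ℝ}
    (hr : Measurable r) (hr0 : ∀ z, 0 ≤ r z)
    (hΛ : ∀ a b : ℝ, 0 ≤ a → a ≤ b → Λ (r ⁻¹' Set.Ico a b) = ENNReal.ofReal (b - a)) :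
    ∀ᵐ ω ∂P, ∀ i j, i ≠ j → r (Z i ω) ≠ r (Z j ω) := by
  obtain ⟨C, hC, hbound⟩ := hZ.measure_two_le_num
  let tie : ℕ → Set Ω := fun M => {ω | ∃ i j, i ≠ j ∧ r (Z i ω) = r (Z j ω) ∧ r (Z i ω) < M}
  have htie : ∀ M, P (tie M) = 0 := by
    intro M
    have hle : ∀ n : ℕ, P (tie M) ≤ ENNReal.ofReal (M * C * (1 / ((n : ℝ) + 1))) := by
      intro n
      -- A tie below `M` puts two points in one of `M (n + 1)` cells. Each cell has intensity `1 /
      -- (n + 1)`, so this has probability at most `C / (n + 1)²` per cell, and the sum tends to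
      -- `0`.
      let cell : ℕ → Set E := fun k => r ⁻¹' Set.Ico (k / ((n : ℝ) + 1)) ((k + 1) / ((n : ℝ) + 1))
      have hn : (0 : ℝ) < (n : ℝ) + 1 := by positivity
      have hsub : tie M ⊆ ⋃ k ∈ Finset.range (M * (n + 1)),
          {ω | 2 ≤ num (cell k) fun i => Z i ω} := by
        rintro ω ⟨i, j, hij, heq, hM⟩
        have h1 : ∀ l, r (Z l ω) = r (Z i ω) → Z l ω ∈ cell ⌊r (Z i ω) * ((n : ℝ) + 1)⌋₊ := by
          intro l hl
          refine ⟨?_, ?_⟩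
          · rw [hl, div_le_iff₀ hn]
            exact Nat.floor_le (mul_nonneg (hr0 _) hn.le)
          · rw [hl, lt_div_iff₀ hn]
            exact Nat.lt_floor_add_one _
        refine Set.mem_biUnion (x := ⌊r (Z i ω) * ((n : ℝ) + 1)⌋₊) ?_
          (two_le_num hij (h1 i rfl) (h1 j heq.symm))
        simp only [Finset.coe_range, Set.mem_Iio]
        rw [Nat.floor_lt (mul_nonneg (hr0 _) hn.le)]
        push_cast
        exact mul_lt_mul_of_pos_right hM hn
      refine (measure_mono hsub).trans ((measure_biUnion_finset_le _ _).trans ?_)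
      have hcell : ∀ k, P {ω | 2 ≤ num (cell k) fun i => Z i ω} ≤
          ENNReal.ofReal (C * (1 / ((n : ℝ) + 1)) ^ 2) := fun k =>
        hbound _ (hr measurableSet_Ico) _ (by positivity) (by
          rw [hΛ _ _ (by positivity) (by gcongr; linarith)]
          congr 1; ring)
      refine (Finset.sum_le_sum fun k _ => hcell k).trans ?_
      rw [Finset.sum_const, Finset.card_range, nsmul_eq_mul, ← ENNReal.ofReal_natCast,
        ← ENNReal.ofReal_mul (by positivity)]
      refine ENNReal.ofReal_le_ofReal (le_of_eq ?_)
      push_cast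
      field_simp
    refine le_antisymm (ge_of_tendsto' (x := atTop) (f := fun n : ℕ =>
      ENNReal.ofReal (M * C * (1 / ((n : ℝ) + 1)))) ?_ hle) zero_le
    have h1 : Tendsto (fun n : ℕ => (M * C * (1 / ((n : ℝ) + 1)))) atTop (𝓝 (M * C * 0)) :=
      tendsto_one_div_add_atTop_nhds_zero_nat.const_mul _
    have := ENNReal.tendsto_ofReal h1
    simpa using this
  have h : ∀ᵐ ω ∂P, ∀ M, ω ∉ tie M := ae_all_iff.2 fun M => by
    rw [ae_iff]; simpa using htie M
  filter_upwards [h] with ω hω i j hij heq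
  obtain ⟨M, hM⟩ := exists_nat_gt (r (Z i ω))
  exact hω M ⟨i, j, hij, heq, hM⟩

end Poisson

/-! ### Differentiating the Laplace functional. -/

/-- The difference quotient of `x ↦ 1 - e^{-x}` with step `2^{-k}`. -/
def quot (k : ℕ) (x : ℝ≥0∞) : ℝ≥0∞ := 2 ^ k * (1 - ex (x * (2 ^ k)⁻¹))

lemma two_pow_mul_inv (k : ℕ) : (2 : ℝ≥0∞) ^ k * (2 ^ k)⁻¹ = 1 :=
  ENNReal.mul_inv_cancel (by positivity) (by finiteness)

lemma continuous_quot (k : ℕ) : Continuous (quot k) :=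
  (ENNReal.continuous_const_mul (by finiteness)).comp
    (continuous_one_sub_ex.comp (ENNReal.continuous_mul_const (by finiteness)))

/-- Halving the step amounts to `1 - y² ≤ 2(1 - y)`. Monotonicity allows differentiation under the
integral by monotone convergence, without any integrability. -/
lemma quot_mono (x : ℝ≥0∞) : Monotone fun k => quot k x := by
  refine monotone_nat_of_le_succ fun k => ?_
  set y := ex (x * (2 ^ (k + 1))⁻¹) with hy
  have h1 : ex (x * (2 ^ k)⁻¹) = y * y := by
    rw [hy, ← ex_add, ← two_mul]
    congr 1
    rw [pow_succ, ENNReal.mul_inv (by simp) (by simp), mul_left_comm, mul_left_comm 2,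
      ENNReal.mul_inv_cancel (by simp) (by simp), mul_one]
  have h2 : 1 - y * y ≤ 2 * (1 - y) := by
    rw [tsub_le_iff_right]
    have h3 : y + (1 - y) = 1 := ex_add_one_sub _
    have hy1 : y ≤ 1 := ex_le_one _
    calc (1 : ℝ≥0∞) = y * (y + (1 - y)) + (1 - y) := by rw [h3, mul_one, h3]
      _ = y * y + y * (1 - y) + (1 - y) := by rw [mul_add]
      _ ≤ y * y + 1 * (1 - y) + (1 - y) := by gcongr
      _ = 2 * (1 - y) + y * y := by ring
  calc quot k x = 2 ^ k * (1 - y * y) := by rw [quot, h1]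
    _ ≤ 2 ^ k * (2 * (1 - y)) := by gcongr
    _ = quot (k + 1) x := by rw [quot, ← hy, pow_succ, mul_assoc]

lemma quot_le (k : ℕ) (x : ℝ≥0∞) : quot k x ≤ x := by
  calc quot k x ≤ 2 ^ k * (x * (2 ^ k)⁻¹) := by unfold quot; gcongr; exact one_sub_ex_le _
    _ = x := by rw [mul_left_comm, two_pow_mul_inv, mul_one]

lemma tendsto_quot (x : ℝ≥0∞) : Tendsto (fun k => quot k x) atTop (𝓝 x) := by
  induction x with
  | top =>
    have h : ∀ k, quot k ⊤ = 2 ^ k := fun k => by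
      rw [quot, ENNReal.top_mul (by simp), ex_top, tsub_zero, mul_one]
    simp_rw [h]
    exact ENNReal.tendsto_pow_atTop_nhds_top_iff.2 (by norm_num)
  | coe x =>
    refine tendsto_of_tendsto_of_tendsto_of_le_of_le (g := fun k : ℕ =>
      ENNReal.ofReal ((x : ℝ) - (x : ℝ) ^ 2 / 2 * (1 / 2) ^ k)) ?_ tendsto_const_nhds (fun k => ?_)
      fun k => quot_le k _
    · have h1 : Tendsto (fun k : ℕ => (x : ℝ) - x ^ 2 / 2 * (1 / 2) ^ k) atTop
          (𝓝 ((x : ℝ) - (x : ℝ) ^ 2 / 2 * 0)) :=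
        ((tendsto_pow_atTop_nhds_zero_of_lt_one (by norm_num) (by norm_num)).const_mul _).const_sub _
      have := ENNReal.tendsto_ofReal h1
      simpa using this
    · have h2 : (x : ℝ≥0∞) * (2 ^ k)⁻¹ = ENNReal.ofReal (x * (1 / 2) ^ k) := by
        rw [ENNReal.ofReal_mul x.coe_nonneg, ENNReal.ofReal_coe_nnreal, ENNReal.ofReal_pow (by norm_num),
          one_div, ENNReal.ofReal_inv_of_pos (by norm_num), ENNReal.ofReal_ofNat, ENNReal.inv_pow]
      have h3 : (2 : ℝ≥0∞) ^ k = ENNReal.ofReal (2 ^ k) := by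
        rw [ENNReal.ofReal_pow (by norm_num), ENNReal.ofReal_ofNat]
      have h4 : (2 : ℝ) ^ k * (1 / 2) ^ k = 1 := by rw [← mul_pow]; norm_num
      have h5 := exp_neg_le (s := x * (1 / 2) ^ k) (by positivity)
      simp only [quot]
      rw [h2, ex_ofReal (by positivity), h3, ← ENNReal.ofReal_one,
        ← ENNReal.ofReal_sub _ (Real.exp_pos _).le, ← ENNReal.ofReal_mul (by positivity)]
      refine ENNReal.ofReal_le_ofReal ?_
      have h6 : (2 : ℝ) ^ k * (x * (1 / 2) ^ k - (x * (1 / 2) ^ k) ^ 2 / 2) ≤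
          2 ^ k * (1 - Real.exp (-(x * (1 / 2) ^ k))) :=
        mul_le_mul_of_nonneg_left (by linarith) (by positivity)
      refine le_trans (le_of_eq ?_) h6
      linear_combination (-(x : ℝ) + x ^ 2 / 2 * (1 / 2) ^ k) * h4

/-- The step and the argument vary together: a fixed `quot j` bounds from below by monotonicity in
the index and continuity, and `quot k (b k) ≤ b k ≤ B` bounds from above. -/
lemma tendsto_quot_diag {b : ℕ → ℝ≥0∞} {B : ℝ≥0∞} (hb : Monotone b)
    (hB : Tendsto b atTop (𝓝 B)) : Tendsto (fun k => quot k (b k)) atTop (𝓝 B) := by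
  refine tendsto_order.2 ⟨fun a ha => ?_, fun a ha => ?_⟩
  · obtain ⟨j, hj⟩ := ((tendsto_order.1 (tendsto_quot B)).1 a ha).exists
    have h1 := ((continuous_quot j).tendsto B).comp hB
    filter_upwards [(tendsto_order.1 h1).1 a hj, eventually_ge_atTop j] with k hk hjk
    exact lt_of_lt_of_le hk (quot_mono _ hjk)
  · exact Eventually.of_forall fun k =>
      ((quot_le k _).trans (hb.ge_of_tendsto hB k)).trans_lt ha

variable {Ω E : Type*} [MeasurableSpace Ω] [MeasurableSpace E] {P : Measure Ω}
  {Z : ℕ → Ω → E} {Λ : Measure E}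

/-- The derivative of the Laplace functional. -/
theorem IsPoisson.lintegral_tsum_mul_ex [IsProbabilityMeasure P] (hZ : IsPoisson P Z Λ)
    {f v : E → ℝ≥0∞} (hf : Measurable f) (hv : Measurable v) :
    ∫⁻ ω, (∑' i, f (Z i ω)) * ex (∑' i, v (Z i ω)) ∂P =
      (∫⁻ z, f z * ex (v z) ∂Λ) * ex (∫⁻ z, (1 - ex (v z)) ∂Λ) := by
  set F : Ω → ℝ≥0∞ := fun ω => ∑' i, f (Z i ω)
  set V : Ω → ℝ≥0∞ := fun ω => ∑' i, v (Z i ω)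
  have hF : Measurable F := hZ.measurable_tsum hf
  have hV : Measurable V := hZ.measurable_tsum hv
  set J := ∫⁻ z, (1 - ex (v z)) ∂Λ
  have hq : ∀ k, Measurable (quot k) := fun k => (continuous_quot k).measurable
  have hlim1 : Tendsto (fun k => ∫⁻ ω, quot k (F ω) * ex (V ω) ∂P) atTop
      (𝓝 (∫⁻ ω, F ω * ex (V ω) ∂P)) :=
    lintegral_tendsto_of_tendsto_of_monotone
      (fun k => (((hq k).comp hF).mul (measurable_ex.comp hV)).aemeasurable)
      (ae_of_all _ fun ω j k hjk => mul_le_mul_left (quot_mono _ hjk) _)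
      (ae_of_all _ fun ω => ENNReal.Tendsto.mul_const (tendsto_quot _) (Or.inr (ex_ne_top _)))
  let b : ℕ → ℝ≥0∞ := fun k => ∫⁻ z, quot k (f z) * ex (v z) ∂Λ
  have hb : Monotone b := fun j k hjk =>
    lintegral_mono fun z => mul_le_mul_left (quot_mono _ hjk) _
  have hlimb : Tendsto b atTop (𝓝 (∫⁻ z, f z * ex (v z) ∂Λ)) :=
    lintegral_tendsto_of_tendsto_of_monotone
      (fun k => (((hq k).comp hf).mul (measurable_ex.comp hv)).aemeasurable)
      (ae_of_all _ fun ω j k hjk => mul_le_mul_left (quot_mono _ hjk) _)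
      (ae_of_all _ fun ω => ENNReal.Tendsto.mul_const (tendsto_quot _) (Or.inr (ex_ne_top _)))
  have hlim2 : Tendsto (fun k => quot k (b k) * ex J) atTop
      (𝓝 ((∫⁻ z, f z * ex (v z) ∂Λ) * ex J)) :=
    ENNReal.Tendsto.mul_const (tendsto_quot_diag hb hlimb) (Or.inr (ex_ne_top _))
  refine tendsto_nhds_unique hlim1 (hlim2.congr fun k => ?_)
  set a : ℝ≥0∞ := (2 ^ k)⁻¹ with ha
  -- At a fixed step the formula is exact: it is the difference of the Laplace functionals at `v`
  -- and `a f + v`, whose exponents are `J` and `J + a * b k`.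
  have hJk : ∫⁻ z, (1 - ex (f z * a + v z)) ∂Λ = J + b k * a := by
    have h1 : ∀ z, 1 - ex (f z * a + v z) = (1 - ex (v z)) + (1 - ex (f z * a)) * ex (v z) := by
      intro z
      rw [ex_add]
      refine (ENNReal.eq_sub_of_add_eq (ENNReal.mul_ne_top (ex_ne_top _) (ex_ne_top _)) ?_).symm
      rw [add_assoc, ← add_mul, add_comm (1 - ex (f z * a)), ex_add_one_sub, one_mul, add_comm,
        ex_add_one_sub]
    have h2 : ∀ z, (1 - ex (f z * a)) * ex (v z) = quot k (f z) * ex (v z) * a := by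
      intro z
      rw [quot, ← ha, mul_right_comm, mul_right_comm (2 ^ k), ha, two_pow_mul_inv, one_mul]
    simp_rw [h1]
    rw [lintegral_add_left (continuous_one_sub_ex.measurable.fun_comp hv)]
    simp_rw [h2]
    rw [lintegral_mul_const' _ _ (ENNReal.inv_ne_top.2 (by simp))]
  have h3 : ∫⁻ ω, ex (F ω * a + V ω) ∂P = ex J * ex (b k * a) := by
    rw [← ex_add, ← hJk, ← hZ.laplace (fun z => f z * a + v z) ((hf.mul_const _).add hv)]
    refine lintegral_congr fun ω => ?_
    rw [ENNReal.tsum_add, ENNReal.tsum_mul_right]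
  have h4 : ∫⁻ ω, ex (V ω) ∂P = ex J := hZ.laplace v hv
  have h5 : ∀ ω, quot k (F ω) * ex (V ω) = 2 ^ k * (ex (V ω) - ex (F ω * a + V ω)) := by
    intro ω
    rw [quot, mul_assoc, ENNReal.sub_mul fun _ _ => ex_ne_top _, one_mul, ex_add]
  simp_rw [h5]
  rw [lintegral_const_mul' _ _ (by finiteness), lintegral_sub
    (f := fun ω => ex (V ω)) (g := fun ω => ex (F ω * a + V ω))
    (measurable_ex.comp ((hF.mul_const _).add hV)) (lintegral_ex_ne_top P _)
    (ae_of_all _ fun ω => ex_antitone le_add_self), h3, h4, quot, mul_assoc,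
    ENNReal.sub_mul fun _ _ => ex_ne_top _, one_mul, mul_comm (ex J)]

/-! ### Quantile transport between laws on the positive half-line. -/

section Transport

/-- A probability law on `(0, ∞)` without atoms and with full support. -/
structure IsPosLaw (μ : Measure ℝ) : Prop where
  isProb : IsProbabilityMeasure μ
  noAtoms : NullSingletonClass μ
  nonpos : μ (Set.Iic 0) = 0
  pos : ∀ a b, 0 ≤ a → a < b → μ (Set.Ioc a b) ≠ 0

variable {μ ν : Measure ℝ}

lemma IsPosLaw.Iic_lt (h : IsPosLaw μ) {a b : ℝ} (ha : 0 ≤ a) (hab : a < b) :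
    μ (Set.Iic a) < μ (Set.Iic b) := by
  have := h.isProb
  rw [← Set.Iic_union_Ioc_eq_Iic hab.le, measure_union
    (Set.Iic_disjoint_Ioc le_rfl) measurableSet_Ioc]
  exact ENNReal.lt_add_right (measure_ne_top _ _) (h.pos a b ha hab)

lemma IsPosLaw.Iic_pos (h : IsPosLaw μ) {b : ℝ} (hb : 0 < b) : 0 < μ (Set.Iic b) :=
  h.nonpos ▸ h.Iic_lt le_rfl hb

lemma IsPosLaw.Iic_lt_one (h : IsPosLaw μ) {b : ℝ} (hb : 0 < b) : μ (Set.Iic b) < 1 :=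
  have := h.isProb
  (h.Iic_lt hb.le (lt_add_one b)).trans_le prob_le_one

lemma IsPosLaw.Iic_inj (h : IsPosLaw μ) {a b : ℝ} (ha : 0 < a) (hb : 0 < b)
    (hab : μ (Set.Iic a) = μ (Set.Iic b)) : a = b := by
  rcases lt_trichotomy a b with h1 | h1 | h1
  · exact absurd hab (h.Iic_lt ha.le h1).ne
  · exact h1
  · exact absurd hab (h.Iic_lt hb.le h1).ne'

lemma IsPosLaw.lt_of_Iic_lt {a b : ℝ} (hab : μ (Set.Iic a) < μ (Set.Iic b)) : a < b := by
  by_contra hc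
  exact absurd hab (not_lt.2 (measure_mono (Set.Iic_subset_Iic.2 (not_lt.1 hc))))

lemma IsPosLaw.continuous_cdf (h : IsPosLaw μ) : Continuous (cdf μ) := by
  have := h.isProb
  have := h.noAtoms
  refine continuous_iff_continuousAt.2 fun x => ?_
  rw [(monotone_cdf μ).continuousAt_iff_leftLim_eq_rightLim]
  have h1 := (cdf μ).measure_singleton x
  rw [measure_cdf, measure_singleton] at h1
  have h2 := ENNReal.ofReal_eq_zero.1 h1.symm
  have h3 := (monotone_cdf μ).leftLim_le (le_refl x)
  rw [(cdf μ).rightLim_eq]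
  linarith

lemma IsPosLaw.exists_Iic_eq (h : IsPosLaw μ) {p : ℝ≥0∞} (h0 : 0 < p) (h1 : p < 1) :
    ∃ x, 0 < x ∧ μ (Set.Iic x) = p := by
  have := h.isProb
  have hp : p ≠ ⊤ := (h1.trans ENNReal.one_lt_top).ne
  have hcdf : ∀ x, μ (Set.Iic x) = ENNReal.ofReal (cdf μ x) := fun x => (ofReal_cdf μ x).symm
  have hlim := (tendsto_order.1 (tendsto_cdf_atTop μ)).1 p.toReal
    (by rw [← ENNReal.toReal_one]; exact ENNReal.toReal_strict_mono ENNReal.one_ne_top h1)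
  obtain ⟨y, hy, hy0⟩ := (hlim.and (eventually_ge_atTop 0)).exists
  have hz : cdf μ 0 = 0 := by
    have := h.nonpos
    rw [hcdf, ENNReal.ofReal_eq_zero] at this
    exact le_antisymm this (cdf_nonneg μ 0)
  obtain ⟨x, hx, hxp⟩ := intermediate_value_Icc hy0 h.continuous_cdf.continuousOn
    (show p.toReal ∈ Set.Icc _ _ from ⟨by rw [hz]; positivity, hy.le⟩)
  refine ⟨x, lt_of_le_of_ne hx.1 ?_, by rw [hcdf, hxp, ENNReal.ofReal_toReal hp]⟩
  rintro rfl
  rw [hz] at hxp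
  exact (ENNReal.toReal_pos h0.ne' hp).ne hxp

open Classical in
/-- The monotone map `G⁻¹ ∘ F`, where `F` and `G` are the distribution functions of `μ` and
`ν`. -/
def transport (μ ν : Measure ℝ) (v : ℝ) : ℝ :=
  -- The value `0` at nonpositive arguments keeps the map monotone, hence measurable, on the whole
  -- line.
  if h : 0 < v ∧ ∃ x, 0 < x ∧ ν (Set.Iic x) = μ (Set.Iic v) then h.2.choose else 0

lemma transport_spec (hμ : IsPosLaw μ) (hν : IsPosLaw ν) {v : ℝ} (hv : 0 < v) :
    0 < transport μ ν v ∧ ν (Set.Iic (transport μ ν v)) = μ (Set.Iic v) := by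
  have h : 0 < v ∧ ∃ x, 0 < x ∧ ν (Set.Iic x) = μ (Set.Iic v) :=
    ⟨hv, hν.exists_Iic_eq (hμ.Iic_pos hv) (hμ.Iic_lt_one hv)⟩
  rw [transport, dif_pos h]
  exact h.2.choose_spec

lemma transport_pos (hμ : IsPosLaw μ) (hν : IsPosLaw ν) {v : ℝ} (hv : 0 < v) :
    0 < transport μ ν v := (transport_spec hμ hν hv).1

lemma transport_of_nonpos {v : ℝ} (hv : v ≤ 0) : transport μ ν v = 0 :=
  dif_neg fun h => absurd h.1 (not_lt.2 hv)

lemma transport_eq (hμ : IsPosLaw μ) (hν : IsPosLaw ν) {v x : ℝ} (hv : 0 < v) (hx : 0 < x)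
    (h : ν (Set.Iic x) = μ (Set.Iic v)) : transport μ ν v = x :=
  hν.Iic_inj (transport_pos hμ hν hv) hx ((transport_spec hμ hν hv).2.trans h.symm)

lemma transport_strictMonoOn (hμ : IsPosLaw μ) (hν : IsPosLaw ν) :
    StrictMonoOn (transport μ ν) (Set.Ioi 0) := fun a ha b hb hab => by
  apply IsPosLaw.lt_of_Iic_lt (μ := ν)
  rw [(transport_spec hμ hν ha).2, (transport_spec hμ hν hb).2]
  exact hμ.Iic_lt (le_of_lt ha) hab

lemma transport_surj (hμ : IsPosLaw μ) (hν : IsPosLaw ν) {x : ℝ} (hx : 0 < x) :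
    ∃ v, 0 < v ∧ transport μ ν v = x := by
  obtain ⟨v, hv, h⟩ := hμ.exists_Iic_eq (hν.Iic_pos hx) (hν.Iic_lt_one hx)
  exact ⟨v, hv, transport_eq hμ hν hv hx h.symm⟩

lemma transport_monotone (hμ : IsPosLaw μ) (hν : IsPosLaw ν) : Monotone (transport μ ν) := by
  intro a b hab
  rcases le_or_gt a 0 with ha | ha
  · rw [transport_of_nonpos ha]
    rcases le_or_gt b 0 with hb | hb
    · rw [transport_of_nonpos hb]
    · exact (transport_pos hμ hν hb).le
  · exact (transport_strictMonoOn hμ hν).monotoneOn ha (ha.trans_le hab) hab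

lemma transport_continuousAt (hμ : IsPosLaw μ) (hν : IsPosLaw ν) {v : ℝ} (hv : 0 < v) :
    ContinuousAt (transport μ ν) v := by
  refine continuousAt_of_monotoneOn_of_image_mem_nhds
    (transport_strictMonoOn hμ hν).monotoneOn (Ioi_mem_nhds hv) ?_
  refine mem_of_superset (Ioi_mem_nhds (transport_pos hμ hν hv)) fun x hx => ?_
  obtain ⟨w, hw, rfl⟩ := transport_surj hμ hν hx
  exact ⟨w, hw, rfl⟩

lemma map_transport (hμ : IsPosLaw μ) (hν : IsPosLaw ν) : μ.map (transport μ ν) = ν := by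
  have := hμ.isProb
  have := hν.isProb
  have hm := (transport_monotone hμ hν).measurable
  have := Measure.isProbabilityMeasure_map (μ := μ) hm.aemeasurable
  refine Measure.ext_of_Iic _ _ fun t => ?_
  rw [Measure.map_apply hm measurableSet_Iic]
  rcases le_or_gt t 0 with ht | ht
  · rw [measure_mono_null (Set.Iic_subset_Iic.2 ht) hν.nonpos]
    refine measure_mono_null (fun v hv => ?_) hμ.nonpos
    by_contra hc
    exact absurd ((transport_pos hμ hν (not_le.1 hc)).trans_le hv) (not_lt.2 ht)
  · obtain ⟨w, hw, rfl⟩ := transport_surj hμ hν ht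
    rw [(transport_spec hμ hν hw).2]
    congr 1
    ext v
    rcases le_or_gt v 0 with hv | hv
    · simp only [Set.mem_preimage, transport_of_nonpos hv, Set.mem_Iic]
      exact ⟨fun _ => hv.trans hw.le, fun _ => ht.le⟩
    · exact (transport_strictMonoOn hμ hν).le_iff_le hv hw

/-- If the laws `ν n` concentrate at `1`, then the transport maps converge to `1`. -/
lemma tendsto_transport {ν : ℕ → Measure ℝ} (hμ : IsPosLaw μ) (hν : ∀ᶠ n in atTop, IsPosLaw (ν n))
    (h1 : ∀ ε : ℝ, 0 < ε → Tendsto (fun n => ν n (Set.Iic (1 - ε))) atTop (𝓝 0))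
    (h2 : ∀ ε : ℝ, 0 < ε → Tendsto (fun n => ν n (Set.Ioi (1 + ε))) atTop (𝓝 0)) {v : ℝ}
    (hv : 0 < v) : Tendsto (fun n => transport μ (ν n) v) atTop (𝓝 1) := by
  refine tendsto_order.2 ⟨fun a ha => ?_, fun a ha => ?_⟩
  · filter_upwards [hν, (tendsto_order.1 (h1 (1 - a) (by linarith))).2 _ (hμ.Iic_pos hv)] with n hn h
    apply IsPosLaw.lt_of_Iic_lt (μ := ν n)
    rw [(transport_spec hμ hn hv).2]
    simpa using h
  · have hp : 0 < 1 - μ (Set.Iic v) := tsub_pos_of_lt (hμ.Iic_lt_one hv)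
    filter_upwards [hν, (tendsto_order.1 (h2 ((a - 1) / 2) (by linarith))).2 _ hp] with n hn h
    have := hn.isProb
    have h3 : transport μ (ν n) v < 1 + (a - 1) / 2 := by
      apply IsPosLaw.lt_of_Iic_lt (μ := ν n)
      rw [(transport_spec hμ hn hv).2]
      have h4 : ν n (Set.Iic (1 + (a - 1) / 2)) = 1 - ν n (Set.Ioi (1 + (a - 1) / 2)) := by
        rw [← Set.compl_Ioi, prob_compl_eq_one_sub measurableSet_Ioi]
      rw [h4]
      have h5 : ν n (Set.Ioi (1 + (a - 1) / 2)) ≤ 1 := prob_le_one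
      exact lt_tsub_iff_left.2 (by
        have := lt_tsub_iff_left.1 h
        rwa [add_comm] at this)
    linarith

end Transport

/-! ### Gamma laws: tilting, scaling and the star order. -/

section Gamma

variable {a r : ℝ}

lemma measurable_gammaPDF (a r : ℝ) : Measurable (gammaPDF a r) :=
  (measurable_gammaPDFReal a r).ennreal_ofReal

lemma gammaPDF_pos (ha : 0 < a) (hr : 0 < r) {x : ℝ} (hx : 0 < x) : 0 < gammaPDF a r x :=
  ENNReal.ofReal_pos.2 (gammaPDFReal_pos ha hr hx)

lemma isPosLaw_gammaMeasure (ha : 0 < a) (hr : 0 < r) : IsPosLaw (gammaMeasure a r) where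
  isProb := isProbabilityMeasure_gammaMeasure ha hr
  noAtoms := ⟨fun x => withDensity_absolutelyContinuous _ _ (measure_singleton x)⟩
  nonpos := by
    rw [gammaMeasure, withDensity_apply _ measurableSet_Iic, setLIntegral_congr Iio_ae_eq_Iic.symm]
    exact lintegral_gammaPDF_of_nonpos le_rfl
  pos x y hx hxy := by
    rw [gammaMeasure, withDensity_apply _ measurableSet_Ioc]
    refine ((setLIntegral_pos_iff (measurable_gammaPDF a r)).2 ?_).ne'
    refine lt_of_lt_of_le ?_ (measure_mono (s := Set.Ioc x y) fun z hz =>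
      ⟨(gammaPDF_pos ha hr (hx.trans_lt hz.1)).ne', hz⟩)
    simpa using hxy

/-- The moment of order `s` of the gamma law of shape `a` and rate `r`. -/
def gammaMoment (a r s : ℝ) : ℝ := Real.Gamma (a + s) / (Real.Gamma a * r ^ s)

lemma gammaMoment_pos (ha : 0 < a) (hr : 0 < r) {s : ℝ} (has : 0 < a + s) :
    0 < gammaMoment a r s := by
  have := Real.Gamma_pos_of_pos ha
  have := Real.Gamma_pos_of_pos has
  unfold gammaMoment
  positivity

/-- Tilting a gamma law by a power changes its shape. -/
lemma lintegral_rpow_mul_gammaMeasure (ha : 0 < a) (hr : 0 < r) {s : ℝ} (has : 0 < a + s)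
    {Φ : ℝ → ℝ≥0∞} (hΦ : Measurable Φ) :
    ∫⁻ x, ENNReal.ofReal (x ^ s) * Φ x ∂(gammaMeasure a r) =
      ENNReal.ofReal (gammaMoment a r s) * ∫⁻ x, Φ x ∂(gammaMeasure (a + s) r) := by
  have hp : Measurable fun x : ℝ => ENNReal.ofReal (x ^ s) :=
    (measurable_id.pow_const s).ennreal_ofReal
  rw [gammaMeasure, gammaMeasure, lintegral_withDensity_eq_lintegral_mul _
      (measurable_gammaPDF a r) (hp.fun_mul hΦ), lintegral_withDensity_eq_lintegral_mul _
      (measurable_gammaPDF (a + s) r) hΦ, ← lintegral_const_mul' _ _ ENNReal.ofReal_ne_top]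
  refine lintegral_congr_ae ?_
  have h0 : ∀ᵐ x : ℝ, x ≠ 0 := by simp [ae_iff]
  filter_upwards [h0] with x hx
  simp only [Pi.mul_apply]
  rw [← mul_assoc, ← mul_assoc]
  congr 1
  rcases lt_or_gt_of_ne hx with h | h
  · rw [gammaPDF_of_neg h, gammaPDF_of_neg h, zero_mul, mul_zero]
  · have h1 := Real.Gamma_pos_of_pos ha
    have h2 := Real.Gamma_pos_of_pos has
    rw [gammaPDF_of_nonneg h.le, gammaPDF_of_nonneg h.le, ← ENNReal.ofReal_mul (by positivity),
      ← ENNReal.ofReal_mul (gammaMoment_pos ha hr has).le]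
    congr 1
    rw [gammaMoment, Real.rpow_add hr, show a + s - 1 = (a - 1) + s by ring, Real.rpow_add h]
    have := (Real.rpow_pos_of_pos hr s).ne'
    field_simp

lemma lintegral_rpow_gammaMeasure (ha : 0 < a) (hr : 0 < r) {s : ℝ} (has : 0 < a + s) :
    ∫⁻ x, ENNReal.ofReal (x ^ s) ∂(gammaMeasure a r) = ENNReal.ofReal (gammaMoment a r s) := by
  have := lintegral_rpow_mul_gammaMeasure ha hr has (Φ := fun _ => 1) measurable_const
  have h1 := isProbabilityMeasure_gammaMeasure has hr
  simpa using this

lemma ae_pos_gammaMeasure (ha : 0 < a) (hr : 0 < r) : ∀ᵐ x ∂(gammaMeasure a r), 0 < x := by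
  rw [ae_iff]
  have := (isPosLaw_gammaMeasure ha hr).nonpos
  simpa [Set.Iic] using this

/-- Scaling a gamma law. -/
lemma gammaMeasure_Iic_mul (ha : 0 < a) (hr : 0 < r) {c : ℝ} (hc : 0 < c) (x : ℝ) :
    gammaMeasure a r (Set.Iic (c * x)) = gammaMeasure a (c * r) (Set.Iic x) := by
  rw [gammaMeasure, gammaMeasure, withDensity_apply _ measurableSet_Iic,
    withDensity_apply _ measurableSet_Iic]
  conv_lhs => rw [← Real.smul_map_volume_mul_left hc.ne']
  rw [Measure.restrict_smul, lintegral_smul_measure, Measure.restrict_map (measurable_const_mul c)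
    measurableSet_Iic, lintegral_map (measurable_gammaPDF a r) (measurable_const_mul c),
    smul_eq_mul, ← lintegral_const_mul' _ _ ENNReal.ofReal_ne_top]
  have h1 : (fun y => c * y) ⁻¹' Set.Iic (c * x) = Set.Iic x := by
    ext y
    exact mul_le_mul_iff_right₀ hc
  rw [h1]
  refine lintegral_congr fun y => ?_
  rcases lt_or_ge y 0 with hy | hy
  · rw [gammaPDF_of_neg hy, gammaPDF_of_neg (mul_neg_of_pos_of_neg hc hy), mul_zero]
  · rw [gammaPDF_of_nonneg hy, gammaPDF_of_nonneg (by positivity), abs_of_pos hc,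
      ← ENNReal.ofReal_mul hc.le]
    congr 1
    have h2 : c ^ a = c * c ^ (a - 1) := by
      rw [← Real.rpow_one_add' hc.le (by simpa using ha.ne')]; congr 1; ring
    rw [Real.mul_rpow hc.le hr.le, Real.mul_rpow hc.le hy, h2]
    ring_nf

variable {a' r' : ℝ}

/-- The right side is the logarithm of the ratio of the densities, which is strictly concave in `x`
when `a < a'`. -/
lemma gammaPDFReal_le_iff (ha : 0 < a) (hr : 0 < r) (ha' : 0 < a') (hr' : 0 < r') {x : ℝ}
    (hx : 0 < x) : gammaPDFReal a r x ≤ gammaPDFReal a' r' x ↔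
      0 ≤ (Real.log (r' ^ a' / Real.Gamma a') - Real.log (r ^ a / Real.Gamma a)) +
        (a' - a) * Real.log x - (r' - r) * x := by
  rw [← Real.log_le_log_iff (gammaPDFReal_pos ha hr hx) (gammaPDFReal_pos ha' hr' hx)]
  have h : ∀ b s : ℝ, 0 < b → 0 < s → Real.log (gammaPDFReal b s x) =
      Real.log (s ^ b / Real.Gamma b) + (b - 1) * Real.log x - s * x := by
    intro b s hb hs
    have := Real.Gamma_pos_of_pos hb
    rw [gammaPDFReal, if_pos hx.le, Real.log_mul (by positivity) (by positivity),
      Real.log_mul (by positivity) (by positivity), Real.log_exp, Real.log_rpow hx]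
    ring
  rw [h a r ha hr, h a' r' ha' hr']
  constructor <;> intro h <;> linarith

lemma gammaMeasure_lt_of_gammaPDF_lt (ha : 0 < a) (hr : 0 < r) {S : Set ℝ} (hS : MeasurableSet S) (h0 : volume S ≠ 0)
    (h : ∀ x ∈ S, gammaPDFReal a r x < gammaPDFReal a' r' x) :
    gammaMeasure a r S < gammaMeasure a' r' S := by
  have := isProbabilityMeasure_gammaMeasure ha hr
  have hne : gammaMeasure a r S ≠ ⊤ := measure_ne_top _ _
  rw [gammaMeasure, withDensity_apply _ hS] at hne ⊢
  rw [gammaMeasure, withDensity_apply _ hS]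
  refine lintegral_strict_mono (by simpa [Measure.restrict_eq_zero] using h0)
    (measurable_gammaPDF a' r').aemeasurable hne ?_
  refine (ae_restrict_iff' hS).2 (ae_of_all _ fun x hx => ?_)
  exact (ENNReal.ofReal_lt_ofReal_iff_of_nonneg (gammaPDFReal_nonneg ha hr x)).2 (h x hx)

/-- If two gamma distribution functions meet at `y > 0`, then on `(0, y)` the one of larger shape
is the smaller one. -/
lemma gammaMeasure_Iic_lt_of_eq (ha : 0 < a) (hr : 0 < r) (haa : a < a') (hr' : 0 < r') {x y : ℝ}
    (hx : 0 < x) (hxy : x < y) (h : gammaMeasure a' r' (Set.Iic y) = gammaMeasure a r (Set.Iic y)) :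
    gammaMeasure a' r' (Set.Iic x) < gammaMeasure a r (Set.Iic x) := by
  have ha' : 0 < a' := ha.trans haa
  have := isProbabilityMeasure_gammaMeasure ha hr
  have := isProbabilityMeasure_gammaMeasure ha' hr'
  by_contra hc
  rw [not_lt] at hc
  have split1 : ∀ b s : ℝ, 0 < b → 0 < s →
      gammaMeasure b s (Set.Iic x) = gammaMeasure b s (Set.Ioc 0 x) := fun b s hb hs => by
    rw [← Set.Iic_union_Ioc_eq_Iic hx.le, measure_union (Set.Iic_disjoint_Ioc le_rfl)
      measurableSet_Ioc, (isPosLaw_gammaMeasure hb hs).nonpos, zero_add]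
  have split2 : ∀ b s : ℝ, gammaMeasure b s (Set.Iic y) =
      gammaMeasure b s (Set.Iic x) + gammaMeasure b s (Set.Ioc x y) := fun b s => by
    rw [← Set.Iic_union_Ioc_eq_Iic hxy.le, measure_union (Set.Iic_disjoint_Ioc le_rfl)
      measurableSet_Ioc]
  -- If the claim fails, comparing masses on `(0, x]`, `(x, y]` and `(y, ∞)` gives points `z₁ < z₂ <
  -- z₃` at which the log ratio is `≥ 0`, `≤ 0`, `≥ 0`, against strict concavity.
  obtain ⟨z₁, hz₁, h1⟩ : ∃ z ∈ Set.Ioc 0 x, gammaPDFReal a r z ≤ gammaPDFReal a' r' z := by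
    by_contra! hcon
    rw [split1 a r ha hr, split1 a' r' ha' hr'] at hc
    exact absurd (gammaMeasure_lt_of_gammaPDF_lt ha' hr' measurableSet_Ioc
      (by simpa using hx) hcon) (not_lt.2 hc)
  obtain ⟨z₂, hz₂, h2⟩ : ∃ z ∈ Set.Ioc x y, gammaPDFReal a' r' z ≤ gammaPDFReal a r z := by
    by_contra! hcon
    have h3 := gammaMeasure_lt_of_gammaPDF_lt ha hr measurableSet_Ioc
      (by simpa using hxy) hcon
    rw [split2, split2] at h
    exact absurd h (ENNReal.add_lt_add_of_le_of_lt (measure_ne_top _ _) hc h3).ne'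
  obtain ⟨z₃, hz₃, h3⟩ : ∃ z ∈ Set.Ioi y, gammaPDFReal a r z ≤ gammaPDFReal a' r' z := by
    by_contra! hcon
    have h4 := gammaMeasure_lt_of_gammaPDF_lt ha' hr' measurableSet_Ioi
      (by simp) hcon
    rw [← Set.compl_Iic, prob_compl_eq_one_sub measurableSet_Iic,
      prob_compl_eq_one_sub measurableSet_Iic, h] at h4
    exact lt_irrefl _ h4
  have hz₂0 : 0 < z₂ := hx.trans hz₂.1
  have hz₃0 : 0 < z₃ := (hx.trans hxy).trans hz₃
  have h12 : z₁ < z₂ := hz₁.2.trans_lt hz₂.1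
  have h23 : z₂ < z₃ := lt_of_le_of_lt hz₂.2 hz₃
  rw [gammaPDFReal_le_iff ha hr ha' hr' hz₁.1] at h1
  rw [gammaPDFReal_le_iff ha' hr' ha hr hz₂0] at h2
  rw [gammaPDFReal_le_iff ha hr ha' hr' hz₃0] at h3
  set K := Real.log (r' ^ a' / Real.Gamma a') - Real.log (r ^ a / Real.Gamma a)
  have hd : 0 < z₃ - z₁ := by linarith
  obtain ⟨p, q, hp0, hq0, hpq, hcomb⟩ : ∃ p q : ℝ, 0 < p ∧ 0 < q ∧ p + q = 1 ∧
      p * z₁ + q * z₃ = z₂ :=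
    ⟨(z₃ - z₂) / (z₃ - z₁), (z₂ - z₁) / (z₃ - z₁), div_pos (by linarith) hd,
      div_pos (by linarith) hd, by field_simp; ring, by field_simp; ring⟩
  have hlog : p * Real.log z₁ + q * Real.log z₃ < Real.log z₂ := by
    have := strictConcaveOn_log_Ioi.2 hz₁.1 hz₃0 (h12.trans h23).ne hp0 hq0 hpq
    simp only [smul_eq_mul, hcomb] at this
    exact this
  have e1 := mul_nonneg hp0.le h1
  have e3 := mul_nonneg hq0.le h3
  have e2 := mul_lt_mul_of_pos_left hlog (sub_pos.2 haa)
  have e4 : p * (K + (a' - a) * Real.log z₁ - (r' - r) * z₁) +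
      q * (K + (a' - a) * Real.log z₃ - (r' - r) * z₃) =
      K + (a' - a) * (p * Real.log z₁ + q * Real.log z₃) - (r' - r) * z₂ := by
    rw [← hcomb]; linear_combination K * hpq
  linarith

/-- Gamma laws are star-ordered in their shape. -/
lemma transport_gammaMeasure_div_lt (ha : 0 < a) (hr : 0 < r) (haa : a < a') (hr' : 0 < r')
    {x y : ℝ} (hx : 0 < x) (hxy : x < y) :
    transport (gammaMeasure a r) (gammaMeasure a' r') y / y <
      transport (gammaMeasure a r) (gammaMeasure a' r') x / x := by
  have hμ := isPosLaw_gammaMeasure ha hr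
  have hν := isPosLaw_gammaMeasure (ha.trans haa) hr'
  have hy := hx.trans hxy
  obtain ⟨hy1, hy2⟩ := transport_spec hμ hν hy
  obtain ⟨hx1, hx2⟩ := transport_spec hμ hν hx
  set ψ := transport (gammaMeasure a r) (gammaMeasure a' r')
  -- Dividing the target law by `c = ψ y / y` makes the two distribution functions meet at `y`. The
  -- crossing lemma at `x < y` then says that `c x` lies below the quantile `ψ x`.
  have hc : 0 < ψ y / y := div_pos hy1 hy
  have h1 : ψ y = ψ y / y * y := by field_simp
  rw [h1, gammaMeasure_Iic_mul (ha.trans haa) hr' hc] at hy2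
  have h2 := gammaMeasure_Iic_lt_of_eq ha hr haa (mul_pos hc hr') hx hxy hy2
  rw [← gammaMeasure_Iic_mul (ha.trans haa) hr' hc, ← hx2] at h2
  rw [lt_div_iff₀ hx]
  exact IsPosLaw.lt_of_Iic_lt h2

end Gamma

/-! ### Concentration of the tilted Nakagami laws at `1`. -/

section Concentration

variable {a r : ℝ}

lemma lintegral_sub_one_sq_gammaMeasure (ha : 0 < a) (hr : 0 < r) :
    ∫⁻ x, ENNReal.ofReal ((x - 1) ^ 2) ∂(gammaMeasure a r) =
      ENNReal.ofReal (a * (a + 1) / r ^ 2 + 1 - 2 * (a / r)) := by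
  have := isProbabilityMeasure_gammaMeasure ha hr
  have hG := (Real.Gamma_pos_of_pos ha).ne'
  have h1 : ∫⁻ x, ENNReal.ofReal (2 * x) ∂(gammaMeasure a r) = ENNReal.ofReal (2 * (a / r)) := by
    have := lintegral_rpow_gammaMeasure ha hr (s := 1) (by positivity)
    simp_rw [Real.rpow_one] at this
    simp_rw [ENNReal.ofReal_mul (zero_le_two (α := ℝ))]
    rw [lintegral_const_mul' _ _ ENNReal.ofReal_ne_top, this, gammaMoment, Real.Gamma_add_one ha.ne',
      Real.rpow_one]
    congr 2
    field_simp
  have h2 : ∫⁻ x, ENNReal.ofReal (x ^ 2) ∂(gammaMeasure a r) =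
      ENNReal.ofReal (a * (a + 1) / r ^ 2) := by
    have := lintegral_rpow_gammaMeasure ha hr (s := 2) (by positivity)
    simp_rw [Real.rpow_two] at this
    rw [this, gammaMoment, show a + 2 = a + 1 + 1 by ring, Real.Gamma_add_one (by positivity),
      Real.Gamma_add_one ha.ne', Real.rpow_two]
    congr 1
    field_simp
  have hm1 : Measurable fun x : ℝ => ENNReal.ofReal (2 * x) := by fun_prop
  have hm2 : Measurable fun x : ℝ => ENNReal.ofReal ((x - 1) ^ 2) := by fun_prop
  -- The identity `(x - 1)² + 2x = x² + 1` avoids truncated subtraction under the integral.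
  have h3 : ∫⁻ x, (ENNReal.ofReal ((x - 1) ^ 2) + ENNReal.ofReal (2 * x)) ∂(gammaMeasure a r) =
      ∫⁻ x, (ENNReal.ofReal (x ^ 2) + 1) ∂(gammaMeasure a r) := by
    refine lintegral_congr_ae ?_
    filter_upwards [ae_pos_gammaMeasure ha hr] with x hx
    rw [← ENNReal.ofReal_one, ← ENNReal.ofReal_add (sq_nonneg _) (by positivity),
      ← ENNReal.ofReal_add (sq_nonneg _) zero_le_one]
    congr 1
    ring
  rw [lintegral_add_left hm2, lintegral_add_right _ measurable_const, h1, h2, lintegral_const,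
    measure_univ, one_mul, ← ENNReal.ofReal_one, ← ENNReal.ofReal_add (by positivity) zero_le_one] at h3
  rw [ENNReal.ofReal_sub _ (by positivity)]
  exact ENNReal.eq_sub_of_add_eq ENNReal.ofReal_ne_top h3

/-- For shape `n + δ` and rate `n` the integral equals `(δ² + δ) / n² + 1 / n`. -/
lemma tendsto_lintegral_sub_one_sq {δ : ℝ} (hδ : 0 < δ) :
    Tendsto (fun n : ℕ => ∫⁻ x, ENNReal.ofReal ((x - 1) ^ 2) ∂(gammaMeasure (n + δ) n)) atTop
      (𝓝 0) := by
  have h1 : Tendsto (fun n : ℕ => (δ ^ 2 + δ) * ((n : ℝ)⁻¹ * (n : ℝ)⁻¹) + (n : ℝ)⁻¹) atTop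
      (𝓝 ((δ ^ 2 + δ) * (0 * 0) + 0)) :=
    ((tendsto_inv_atTop_nhds_zero_nat.mul tendsto_inv_atTop_nhds_zero_nat).const_mul _).add
      tendsto_inv_atTop_nhds_zero_nat
  have h2 := ENNReal.tendsto_ofReal h1
  rw [show (δ ^ 2 + δ) * (0 * 0) + 0 = 0 by ring, ENNReal.ofReal_zero] at h2
  refine h2.congr' ?_
  filter_upwards [eventually_gt_atTop 0] with n hn
  have hn' : (0 : ℝ) < n := by exact_mod_cast hn
  rw [lintegral_sub_one_sq_gammaMeasure (by positivity) hn']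
  congr 1
  field_simp
  ring

/-- Chebyshev's inequality around `1`. -/
lemma tendsto_gammaMeasure_of_far {δ ε : ℝ} (hδ : 0 < δ) (hε : 0 < ε) {S : Set ℝ}
    (hS : ∀ x ∈ S, ε ^ 2 ≤ (x - 1) ^ 2) :
    Tendsto (fun n : ℕ => gammaMeasure (n + δ) n S) atTop (𝓝 0) := by
  have h1 := ENNReal.Tendsto.div_const (tendsto_lintegral_sub_one_sq hδ)
    (b := ENNReal.ofReal (ε ^ 2)) (Or.inr (ENNReal.ofReal_pos.2 (by positivity)).ne')
  rw [ENNReal.zero_div] at h1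
  refine tendsto_of_tendsto_of_tendsto_of_le_of_le tendsto_const_nhds h1 (fun n => zero_le)
    fun n => ?_
  refine (measure_mono fun x hx => ?_).trans (meas_ge_le_lintegral_div
    (f := fun x : ℝ => ENNReal.ofReal ((x - 1) ^ 2)) (by fun_prop)
    (ENNReal.ofReal_pos.2 (by positivity)).ne' ENNReal.ofReal_ne_top)
  exact ENNReal.ofReal_le_ofReal (hS x hx)

/-- The transport maps to the tilted Nakagami-`n` power laws converge to `1`. -/
lemma tendsto_transport_gammaMeasure {δ : ℝ} (hδ : 0 < δ) {v : ℝ} (hv : 0 < v) :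
    Tendsto (fun n : ℕ => transport (gammaMeasure (1 + δ) 1) (gammaMeasure (n + δ) n) v) atTop
      (𝓝 1) := by
  refine tendsto_transport (isPosLaw_gammaMeasure (by positivity) one_pos) ?_
    (fun ε hε => tendsto_gammaMeasure_of_far hδ hε fun x (hx : x ≤ _) => by nlinarith)
    (fun ε hε => tendsto_gammaMeasure_of_far hδ hε fun x (hx : _ < x) => by nlinarith) hv
  filter_upwards [eventually_gt_atTop 0] with n hn
  have hn' : (0 : ℝ) < n := by exact_mod_cast hn
  exact isPosLaw_gammaMeasure (by positivity) hn'

end Concentration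

/-! ### The path-loss integral over the plane. -/

section Power

/-- The received power as a function of a marked point. -/
def power (α : ℝ) (z : Plane × ℝ) : ℝ≥0∞ := ENNReal.ofReal z.2 * ENNReal.ofReal ‖z.1‖ ^ (-α)

lemma measurable_power (α : ℝ) : Measurable (power α) := by
  unfold power
  fun_prop

variable {α : ℝ}

lemma power_of_pos {x : Plane} (hx : 0 < ‖x‖) {y : ℝ} (hy : 0 < y) :
    power α (x, y) = ENNReal.ofReal (y * ‖x‖ ^ (-α)) := by
  rw [power, ENNReal.ofReal_rpow_of_pos hx, ENNReal.ofReal_mul hy.le]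

/-- Layer-cake formula with `1 - e^{-f} = ∫₀^f e^{-t} dt`: the set `{f > t}` is a punctured disc of
area `π (y / t)^(2/α)`. What remains is a Gamma integral, convergent because `2 / α < 1`. -/
lemma lintegral_one_sub_ex_pathloss (hα : 2 < α) {y : ℝ} (hy : 0 < y) :
    ∫⁻ x : Plane, (1 - ex (power α (x, y))) =
      ENNReal.ofReal (Real.pi * Real.Gamma (1 - 2 / α) * y ^ (2 / α)) := by
  have hα0 : 0 < α := by linarith
  have hδ : 2 / α < 1 := by rw [div_lt_one hα0]; exact hα
  have h0 : ∀ᵐ x : Plane, x ≠ 0 := by simp [ae_iff]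
  let f : Plane → ℝ := fun x => y * ‖x‖ ^ (-α)
  have hf0 : ∀ x, 0 ≤ f x := fun x => by positivity
  have hfm : Measurable f := by
    simp only [f]
    fun_prop
  have h1 : ∀ x : Plane, x ≠ 0 → 1 - ex (power α (x, y)) =
      ENNReal.ofReal (∫ t in (0)..(f x), Real.exp (-t)) := by
    intro x hx
    rw [power_of_pos (norm_pos_iff.2 hx) hy, ex_ofReal (hf0 x), ← ENNReal.ofReal_one,
      ← ENNReal.ofReal_sub _ (Real.exp_pos _).le]
    congr 1
    rw [intervalIntegral.integral_comp_neg (fun t => Real.exp t), integral_exp]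
    simp [f]
  have h2 : ∫⁻ x : Plane, (1 - ex (power α (x, y))) =
      ∫⁻ x : Plane, ENNReal.ofReal (∫ t in (0)..(f x), Real.exp (-t)) := by
    refine lintegral_congr_ae ?_
    filter_upwards [h0] with x hx
    exact h1 x hx
  rw [h2, lintegral_comp_eq_lintegral_meas_lt_mul volume (ae_of_all _ hf0) hfm.aemeasurable
    (fun t _ => (by fun_prop : Continuous fun t : ℝ => Real.exp (-t)).intervalIntegrable _ _)
    (ae_of_all _ fun t => (Real.exp_pos _).le)]
  have h3 : ∀ t ∈ Set.Ioi (0 : ℝ), volume {x : Plane | t < f x} * ENNReal.ofReal (Real.exp (-t)) =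
      ENNReal.ofReal (Real.pi * y ^ (2 / α)) *
        ENNReal.ofReal (Real.exp (-t) * t ^ ((1 - 2 / α) - 1)) := by
    intro t (ht : 0 < t)
    -- The origin is missing because the real power `0 ^ (-α)` is `0`, whereas `power` is infinite
    -- there.
    have h4 : {x : Plane | t < f x} = Metric.ball 0 ((y / t) ^ α⁻¹) \ {0} := by
      ext x
      simp only [Set.mem_ofPred_eq, Set.mem_sdiff, mem_ball_zero_iff, Set.mem_singleton_iff, f]
      rcases eq_or_ne x 0 with rfl | hx
      · simp [Real.zero_rpow (neg_ne_zero.2 hα0.ne'), ht.le]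
      · have hx' := norm_pos_iff.2 hx
        rw [Real.lt_rpow_inv_iff_of_pos hx'.le (by positivity) hα0, Real.rpow_neg hx'.le,
          ← div_eq_mul_inv, lt_div_iff₀ (by positivity), lt_div_iff₀ ht, mul_comm]
        simp [hx]
    rw [h4, measure_sdiff_null (measure_singleton _), EuclideanSpace.volume_ball_fin_two,
      ← ENNReal.ofReal_pow (by positivity), ← ENNReal.ofReal_mul (by positivity),
      ← ENNReal.ofReal_mul (by positivity), ← ENNReal.ofReal_mul (by positivity)]
    congr 1
    rw [← Real.rpow_natCast, ← Real.rpow_mul (by positivity), Nat.cast_ofNat,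
      show α⁻¹ * 2 = 2 / α by ring, Real.div_rpow hy.le ht.le,
      show (1 - 2 / α) - 1 = -(2 / α) by ring, Real.rpow_neg ht.le]
    ring
  rw [setLIntegral_congr_fun measurableSet_Ioi h3, lintegral_const_mul' _ _ ENNReal.ofReal_ne_top,
    ← ofReal_integral_eq_lintegral_ofReal (Real.GammaIntegral_convergent (by linarith)),
    ← Real.Gamma_eq_integral (by linarith), ← ENNReal.ofReal_mul (by positivity)]
  · congr 1
    ring
  · refine (ae_restrict_iff' measurableSet_Ioi).2 (ae_of_all _ fun t (ht : 0 < t) => ?_)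
    simp only [Pi.zero_apply]
    positivity

end Power

/-! ### The marked intensity and generic configurations. -/

/-- The intensity of the marked process of density `lam` with mark law `F`. -/
def intensity (lam : ℝ≥0) (F : Measure ℝ) : Measure (Plane × ℝ) :=
  (lam • volume : Measure Plane).prod F

/-- A law of positive power gains with finite moment of order `2 / α`. -/
structure IsFading (α : ℝ) (F : Measure ℝ) : Prop where
  isProb : IsProbabilityMeasure F
  pos : ∀ᵐ x ∂F, 0 < x
  moment : ∫⁻ x, ENNReal.ofReal (x ^ (2 / α)) ∂F ≠ ⊤

lemma isFading_gammaMeasure {α a r : ℝ} (hα : 2 < α) (ha : 0 < a) (hr : 0 < r) :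
    IsFading α (gammaMeasure a r) where
  isProb := isProbabilityMeasure_gammaMeasure ha hr
  pos := ae_pos_gammaMeasure ha hr
  moment := by
    rw [lintegral_rpow_gammaMeasure ha hr (by positivity)]
    exact ENNReal.ofReal_ne_top

lemma lintegral_intensity {lam : ℝ≥0} {F : Measure ℝ} [IsProbabilityMeasure F]
    {f : Plane × ℝ → ℝ≥0∞} (hf : Measurable f) :
    ∫⁻ z, f z ∂(intensity lam F) = ∫⁻ y, (lam * ∫⁻ x : Plane, f (x, y)) ∂F := by
  rw [intensity, lintegral_prod_symm' _ hf]
  refine lintegral_congr fun y => ?_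
  rw [lintegral_smul_measure]
  rfl

section

variable {α : ℝ} {lam : ℝ≥0} {F : Measure ℝ}

lemma ae_intensity_snd [IsProbabilityMeasure F] {p : ℝ → Prop} (h : ∀ᵐ y ∂F, p y) :
    ∀ᵐ z ∂(intensity lam F), p z.2 :=
  (Measure.quasiMeasurePreserving_snd (μ := (lam • volume : Measure Plane)) (ν := F)).ae h

lemma ae_intensity_fst [IsProbabilityMeasure F] {p : Plane → Prop} (h : ∀ᵐ x : Plane, p x) :
    ∀ᵐ z ∂(intensity lam F), p z.1 :=
  (Measure.quasiMeasurePreserving_fst (μ := (lam • volume : Measure Plane)) (ν := F)).ae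
    (Measure.ae_smul_measure h lam)

lemma intensity_fst_preimage [IsProbabilityMeasure F] (A : Set Plane) :
    intensity lam F (Prod.fst ⁻¹' A) = lam * volume A := by
  have : (Prod.fst ⁻¹' A : Set (Plane × ℝ)) = A ×ˢ Set.univ := by ext; simp
  rw [this, intensity, Measure.prod_prod, measure_univ, mul_one]
  rfl

/-- The Laplace exponent of the total received power. -/
lemma lintegral_one_sub_ex_power (hα : 2 < α) (hF : IsFading α F) {s : ℝ} (hs : 0 < s) :
    ∫⁻ z, (1 - ex (ENNReal.ofReal s * power α z)) ∂(intensity lam F) =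
      ENNReal.ofReal (lam * (Real.pi * Real.Gamma (1 - 2 / α)) * s ^ (2 / α)) *
        ∫⁻ y, ENNReal.ofReal (y ^ (2 / α)) ∂F := by
  have := hF.isProb
  have hα0 : 0 < α := by linarith
  have hδ : 2 / α < 1 := by rw [div_lt_one hα0]; exact hα
  have hG : 0 < Real.Gamma (1 - 2 / α) := Real.Gamma_pos_of_pos (by linarith)
  rw [lintegral_intensity (continuous_one_sub_ex.measurable.fun_comp
    ((measurable_power α).const_mul _)), ← lintegral_const_mul' _ _ ENNReal.ofReal_ne_top]
  refine lintegral_congr_ae ?_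
  filter_upwards [hF.pos] with y hy
  have h1 : ∀ x : Plane, ENNReal.ofReal s * power α (x, y) = power α (x, s * y) := fun x => by
    rw [power, power, ENNReal.ofReal_mul hs.le, mul_assoc]
  simp_rw [h1]
  rw [lintegral_one_sub_ex_pathloss hα (mul_pos hs hy), Real.mul_rpow hs.le hy.le,
    ← ENNReal.ofReal_coe_nnreal, ← ENNReal.ofReal_mul lam.coe_nonneg,
    ← ENNReal.ofReal_mul (by positivity)]
  congr 1
  ring

lemma volume_annulus {c : ℝ} (hc : 0 < c) {a b : ℝ} (ha : 0 ≤ a) (hab : a ≤ b) :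
    volume {x : Plane | c * ‖x‖ ^ 2 ∈ Set.Ico a b} = ENNReal.ofReal (Real.pi / c * (b - a)) := by
  have h1 : ∀ t : ℝ, 0 ≤ t → ∀ x : Plane, x ∈ Metric.ball (0 : Plane) (√(t / c)) ↔ c * ‖x‖ ^ 2 < t := by
    intro t ht x
    rw [mem_ball_zero_iff, Real.lt_sqrt (norm_nonneg x), lt_div_iff₀ hc, mul_comm]
  have h2 : {x : Plane | c * ‖x‖ ^ 2 ∈ Set.Ico a b} =
      Metric.ball 0 (√(b / c)) \ Metric.ball 0 (√(a / c)) := by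
    ext x
    rw [Set.mem_sdiff, h1 b (ha.trans hab), h1 a ha, not_lt]
    exact and_comm
  have h3 : ∀ t : ℝ, 0 ≤ t → volume (Metric.ball (0 : Plane) (√(t / c))) =
      ENNReal.ofReal (Real.pi / c * t) := fun t ht => by
    rw [EuclideanSpace.volume_ball_fin_two, ← ENNReal.ofReal_pow (by positivity),
      Real.sq_sqrt (by positivity), ← ENNReal.ofReal_mul (by positivity)]
    congr 1
    ring
  rw [h2, measure_sdiff (Metric.ball_subset_ball (Real.sqrt_le_sqrt (by gcongr)))
    Metric.isOpen_ball.measurableSet.nullMeasurableSet measure_ball_lt_top.ne, h3 b (ha.trans hab),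
    h3 a ha, ← ENNReal.ofReal_sub _ (by positivity)]
  congr 1
  ring

/-- The area coordinate `π lam ‖x‖²` of the points has Lebesgue intensity. -/
lemma intensity_area [IsProbabilityMeasure F] (hlam : 0 < lam) {a b : ℝ} (ha : 0 ≤ a)
    (hab : a ≤ b) :
    intensity lam F ((fun z => Real.pi * lam * ‖z.1‖ ^ 2) ⁻¹' Set.Ico a b) =
      ENNReal.ofReal (b - a) := by
  have hl : (0 : ℝ) < lam := hlam
  have h := intensity_fst_preimage (lam := lam) (F := F)
    {x : Plane | Real.pi * lam * ‖x‖ ^ 2 ∈ Set.Ico a b}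
  rw [volume_annulus (by positivity) ha hab, ← ENNReal.ofReal_coe_nnreal,
    ← ENNReal.ofReal_mul lam.coe_nonneg] at h
  refine h.trans ?_
  congr 1
  field_simp

/-- Marked configurations of generic type: positive distances and gains, finite total power,
finitely many points in every disc, no two points at the same distance. -/
structure IsGood (α : ℝ) (z : ℕ → Plane × ℝ) : Prop where
  norm_pos : ∀ i, 0 < ‖(z i).1‖
  gain_pos : ∀ i, 0 < (z i).2
  total_ne_top : ∑' i, power α (z i) ≠ ⊤
  finite : ∀ R : ℝ, {i | ‖(z i).1‖ ≤ R}.Finite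
  norm_ne : ∀ i j, i ≠ j → ‖(z i).1‖ ≠ ‖(z j).1‖

lemma power_ne_top {z : ℕ → Plane × ℝ} (h : ∀ i, 0 < ‖(z i).1‖) (i : ℕ) : power α (z i) ≠ ⊤ := by
  rw [power, ENNReal.ofReal_rpow_of_pos (h i)]
  exact ENNReal.mul_ne_top ENNReal.ofReal_ne_top ENNReal.ofReal_ne_top

lemma IsPoisson.ae_isGood {Ω : Type*} [MeasurableSpace Ω] {P : Measure Ω} [IsProbabilityMeasure P]
    {Z : ℕ → Ω → Plane × ℝ} (hα : 2 < α) (hlam : 0 < lam) (hF : IsFading α F)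
    (hZ : IsPoisson P Z (intensity lam F)) : ∀ᵐ ω ∂P, IsGood α fun i => Z i ω := by
  have := hF.isProb
  have hl : (0 : ℝ) < lam := hlam
  have h1 := hZ.ae_forall (p := fun z => 0 < ‖z.1‖)
    (ae_intensity_fst (p := fun x => 0 < ‖x‖) (by simp [ae_iff]))
  have h2 := hZ.ae_forall (p := fun z => 0 < z.2) (ae_intensity_snd hF.pos)
  -- The indicator removes the infinite value of `power` at the origin, since the finiteness
  -- criterion needs a function with finite values. Almost surely no point sits at the origin, so
  -- the sum is unchanged.
  have h3 : ∀ᵐ ω ∂P, ∑' i, ({0}ᶜ : Set Plane).indicator (fun _ => (1 : ℝ≥0∞)) (Z i ω).1 *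
      power α (Z i ω) ≠ ⊤ := by
    refine hZ.ae_tsum_ne_top (f := fun z => ({0}ᶜ : Set Plane).indicator (fun _ => (1 : ℝ≥0∞)) z.1 *
      power α z) (((measurable_const.indicator (measurableSet_singleton _).compl).comp
        measurable_fst).mul (measurable_power α)) (fun z => ?_) ?_
    · by_cases hz : z.1 = 0
      · simp [hz]
      · rw [power, ENNReal.ofReal_rpow_of_pos (norm_pos_iff.2 hz)]
        simp [hz, ENNReal.mul_eq_top]
    · have h4 := lintegral_one_sub_ex_power (lam := lam) hα hF one_pos
      refine ne_top_of_le_ne_top (b := ∫⁻ z, (1 - ex (ENNReal.ofReal 1 * power α z))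
        ∂(intensity lam F)) ?_ (lintegral_mono fun z => one_sub_ex_mono ?_)
      · rw [h4]
        exact ENNReal.mul_ne_top ENNReal.ofReal_ne_top hF.moment
      · rw [ENNReal.ofReal_one]
        gcongr
        by_cases hz : z.1 = 0 <;> simp [hz]
  have h4 : ∀ᵐ ω ∂P, ∀ n : ℕ, {i | Z i ω ∈ Prod.fst ⁻¹' Metric.closedBall (0 : Plane) n}.Finite :=
    ae_all_iff.2 fun n => hZ.ae_finite
      (measurable_fst Metric.isClosed_closedBall.measurableSet) (by
        rw [intensity_fst_preimage]
        exact ENNReal.mul_ne_top ENNReal.coe_ne_top measure_closedBall_lt_top.ne)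
  have h5 := hZ.ae_injective (r := fun z => Real.pi * lam * ‖z.1‖ ^ 2) (by fun_prop)
    (fun z => by positivity) fun a b ha hab => intensity_area hlam ha hab
  filter_upwards [h1, h2, h3, h4, h5] with ω h1 h2 h3 h4 h5
  refine ⟨h1, h2, ?_, fun R => ?_, fun i j hij h => h5 i j hij (by rw [h])⟩
  · refine ne_of_eq_of_ne (tsum_congr fun i => ?_) h3
    rw [Set.indicator_of_mem (by simpa using norm_pos_iff.1 (h1 i)), one_mul]
  · obtain ⟨n, hn⟩ := exists_nat_ge R
    refine (h4 n).subset fun i hi => ?_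
    simp only [Set.mem_preimage, mem_closedBall_zero_iff, Set.mem_ofPred_eq] at hi ⊢
    exact hi.trans hn

end

/-! ### Coverage as a property of a deterministic configuration. -/

section Configuration

/-- The total power received from a marked configuration. -/
def total (α : ℝ) (z : ℕ → Plane × ℝ) : ℝ≥0∞ := ∑' i, power α (z i)

/-- The `i`-th point carries a fraction larger than `θ / (1 + θ)` of the total power. -/
def IsCovering (α θ : ℝ) (z : ℕ → Plane × ℝ) (i : ℕ) : Prop :=
  ENNReal.ofReal θ * total α z < ENNReal.ofReal (1 + θ) * power α (z i)

/-- Some covering point is closer than all the points that are not covering. -/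
def ClosestCovers (α θ : ℝ) (z : ℕ → Plane × ℝ) : Prop :=
  ∃ i, IsCovering α θ z i ∧ ∀ j, ¬IsCovering α θ z j → ‖(z i).1‖ < ‖(z j).1‖

variable {α θ : ℝ} {z : ℕ → Plane × ℝ}

lemma IsGood.power_pos (h : IsGood α z) (i : ℕ) : 0 < power α (z i) := by
  rw [power, ENNReal.ofReal_rpow_of_pos (h.norm_pos i), ← ENNReal.ofReal_mul (h.gain_pos i).le]
  have := h.norm_pos i
  have := h.gain_pos i
  positivity

lemma IsGood.power_ne_top (h : IsGood α z) (i : ℕ) : power α (z i) ≠ ⊤ :=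
  CellularNetwork.power_ne_top h.norm_pos i

lemma power_add_rest (α : ℝ) (z : ℕ → Plane × ℝ) (i : ℕ) :
    power α (z i) + ∑' j : {j : ℕ // j ≠ i}, power α (z j) = total α z := by
  have h := ENNReal.summable.tsum_add_tsum_compl (f := fun j => power α (z j)) (s := {i})
    ENNReal.summable
  rw [tsum_singleton i (fun j => power α (z j))] at h
  exact h

variable {Ω : Type*} {X : ℕ → Ω → Plane} {g : ℕ → Ω → ℝ} {ω : Ω}

lemma interference_eq (i : ℕ) (h : IsGood α fun i => (X i ω, g i ω)) :
    interference α X g i ω = total α (fun i => (X i ω, g i ω)) - power α (X i ω, g i ω) :=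
  ENNReal.eq_sub_of_add_eq (h.power_ne_top i) (by
    rw [add_comm]; exact power_add_rest α (fun i => (X i ω, g i ω)) i)

lemma interference_pos (i : ℕ) (h : IsGood α fun i => (X i ω, g i ω)) :
    0 < interference α X g i ω := by
  have h1 : power α (X (i + 1) ω, g (i + 1) ω) ≤ interference α X g i ω :=
    ENNReal.le_tsum (f := fun j : {j : ℕ // j ≠ i} => rxPower α X g j ω)
      ⟨i + 1, Nat.succ_ne_self i⟩
  exact (h.power_pos (i + 1)).trans_le h1

lemma interference_ne_top (i : ℕ) (h : IsGood α fun i => (X i ω, g i ω)) :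
    interference α X g i ω ≠ ⊤ := by
  rw [interference_eq i h]
  exact ne_top_of_le_ne_top h.total_ne_top tsub_le_self

/-- Adding `θ` times the own power turns the interference into the total power. The condition
becomes a threshold on the power, common to all points. -/
lemma lt_sir_iff (hθ : 0 < θ) (i : ℕ) (h : IsGood α fun i => (X i ω, g i ω)) :
    ENNReal.ofReal θ < sir α X g i ω ↔ IsCovering α θ (fun i => (X i ω, g i ω)) i := by
  have hp : rxPower α X g i ω = power α (X i ω, g i ω) := rfl
  have hadd : power α (X i ω, g i ω) + interference α X g i ω = total α fun i => (X i ω, g i ω) :=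
    power_add_rest α (fun i => (X i ω, g i ω)) i
  rw [sir, ENNReal.lt_div_iff_mul_lt (Or.inl (interference_pos i h).ne')
    (Or.inl (interference_ne_top i h)), IsCovering, ← hadd, mul_add, ENNReal.ofReal_add zero_le_one hθ.le,
    ENNReal.ofReal_one, add_mul, one_mul, hp, add_comm (power α _),
    ENNReal.add_lt_add_iff_left (ENNReal.mul_ne_top ENNReal.ofReal_ne_top (h.power_ne_top i))]

lemma sir_le_sir (i j : ℕ) (h : IsGood α fun i => (X i ω, g i ω))
    (hij : power α (X i ω, g i ω) ≤ power α (X j ω, g j ω)) :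
    sir α X g i ω ≤ sir α X g j ω := by
  rw [sir, sir]
  refine ENNReal.div_le_div hij ?_
  rw [interference_eq i h, interference_eq j h]
  exact tsub_le_tsub_left hij _

lemma IsGood.finite_power (h : IsGood α z) {ε : ℝ≥0∞} (hε : ε ≠ 0) :
    {i | ε ≤ power α (z i)}.Finite :=
  ENNReal.finite_const_le_of_tsum_ne_top h.total_ne_top hε

/-- Local finiteness provides a closest point, and distinct distances give the strict inequality.
The form `ClosestCovers` only compares covering with noncovering points, which are the comparisons
that the star order preserves. -/
lemma exists_lt_sir_closest_iff (hθ : 0 < θ) (h : IsGood α fun i => (X i ω, g i ω)) :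
    (∃ i, (∀ j, ‖X i ω‖ ≤ ‖X j ω‖) ∧ ENNReal.ofReal θ < sir α X g i ω) ↔
      ClosestCovers α θ fun i => (X i ω, g i ω) := by
  constructor
  · rintro ⟨i, hi, hs⟩
    rw [lt_sir_iff hθ i h] at hs
    refine ⟨i, hs, fun j hj => lt_of_le_of_ne (hi j) (h.norm_ne i j ?_)⟩
    rintro rfl
    exact hj hs
  · rintro ⟨i, hi, hc⟩
    obtain ⟨k, hk, hmin⟩ := Set.exists_min_image _ (fun j => ‖X j ω‖) (h.finite ‖X i ω‖)
      ⟨i, show ‖X i ω‖ ≤ ‖X i ω‖ from le_rfl⟩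
    have hk' : ∀ j, ‖X k ω‖ ≤ ‖X j ω‖ := fun j => by
      by_cases hj : ‖X j ω‖ ≤ ‖X i ω‖
      · exact hmin j hj
      · exact le_trans hk (not_le.1 hj).le
    refine ⟨k, hk', (lt_sir_iff hθ k h).2 ?_⟩
    by_contra hcon
    exact absurd (hk' i) (not_le.2 (hc k hcon))

/-- The total power is finite, so only finitely many powers exceed a positive level and a strongest
point exists; it also has the highest SIR. -/
lemma exists_lt_sir_strongest_iff (hθ : 0 < θ) (h : IsGood α fun i => (X i ω, g i ω)) :
    (∃ i, (∀ j, sir α X g j ω ≤ sir α X g i ω) ∧ ENNReal.ofReal θ < sir α X g i ω) ↔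
      ∃ i, IsCovering α θ (fun i => (X i ω, g i ω)) i := by
  constructor
  · rintro ⟨i, -, hs⟩
    exact ⟨i, (lt_sir_iff hθ i h).1 hs⟩
  · rintro ⟨i, hi⟩
    obtain ⟨k, hk, hmax⟩ := Set.exists_max_image _ (fun j => power α (X j ω, g j ω))
      (h.finite_power (h.power_pos i).ne') ⟨i, le_refl (power α (X i ω, g i ω))⟩
    have hk' : ∀ j, power α (X j ω, g j ω) ≤ power α (X k ω, g k ω) := fun j => by
      by_cases hj : power α (X i ω, g i ω) ≤ power α (X j ω, g j ω)
      · exact hmax j hj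
      · exact (not_le.1 hj).le.trans hk
    refine ⟨k, fun j => sir_le_sir j k h (hk' j), (lt_sir_iff hθ k h).2 ?_⟩
    exact lt_of_lt_of_le hi (mul_le_mul_right (hk' i) _)

/-- The points nearer than `a` whose power exceeds the threshold for total power `r`. -/
def innerStrong (α θ a r : ℝ) : Set (Plane × ℝ) :=
  {p | ENNReal.ofReal θ * ENNReal.ofReal r < ENNReal.ofReal (1 + θ) * power α p ∧ ‖p.1‖ < a}

/-- The points up to distance `a` whose power does not exceed the threshold for total power
`r`. -/
def innerWeak (α θ a r : ℝ) : Set (Plane × ℝ) :=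
  {p | ENNReal.ofReal (1 + θ) * power α p ≤ ENNReal.ofReal θ * ENNReal.ofReal r ∧ ‖p.1‖ ≤ a}

lemma measurableSet_innerStrong (α θ a r : ℝ) : MeasurableSet (innerStrong α θ a r) :=
  (measurableSet_lt measurable_const ((measurable_power α).const_mul _)).inter
    (measurableSet_lt measurable_fst.norm measurable_const)

lemma measurableSet_innerWeak (α θ a r : ℝ) : MeasurableSet (innerWeak α θ a r) :=
  (measurableSet_le ((measurable_power α).const_mul _) measurable_const).inter
    (measurableSet_le measurable_fst.norm measurable_const)

/-- The closest point covers, in terms of the total power and of countably many counts. -/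
lemma closestCovers_iff_num (h : IsGood α z) :
    ClosestCovers α θ z ↔ ∃ a r : ℚ, total α z < ENNReal.ofReal r ∧
      1 ≤ num (innerStrong α θ a r) z ∧ num (innerWeak α θ a r) z = 0 := by
  simp_rw [one_le_num, num_eq_zero]
  constructor
  · rintro ⟨i, hi, hc⟩
    -- Only the finitely many points of `S` matter, so the strict inequalities leave room for a
    -- rational radius `a` just beyond the point `i` and a rational `r` just above the total power.
    set S := {j | ‖(z j).1‖ ≤ ‖(z i).1‖ + 1} with hS
    have hSf : S.Finite := h.finite _
    have ha : ∀ᶠ a in 𝓝[>] ‖(z i).1‖, a < ‖(z i).1‖ + 1 ∧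
        ∀ j ∈ S, ¬IsCovering α θ z j → a < ‖(z j).1‖ := by
      refine (eventually_nhdsWithin_of_eventually_nhds (eventually_lt_nhds (lt_add_one _))).and ?_
      refine (Set.Finite.eventually_all hSf).2 fun j _ => ?_
      by_cases hj : IsCovering α θ z j
      · exact Eventually.of_forall fun a hn => absurd hj hn
      · filter_upwards [eventually_nhdsWithin_of_eventually_nhds (eventually_lt_nhds (hc j hj))]
          with a ha _ using ha
    obtain ⟨b, hb, hab⟩ := (mem_nhdsGT_iff_exists_Ioo_subset).1 ha
    obtain ⟨a, ha1, ha2⟩ := exists_rat_btwn (show ‖(z i).1‖ < b from hb)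
    obtain ⟨haS, hac⟩ := hab ⟨ha1, ha2⟩
    have hT := h.total_ne_top
    obtain ⟨t, ht⟩ : ∃ t : ℝ≥0, total α z = t := ⟨_, (ENNReal.coe_toNNReal hT).symm⟩
    have hr : ∀ᶠ r in 𝓝[>] (t : ℝ), ∀ j ∈ S, IsCovering α θ z j →
        ENNReal.ofReal θ * ENNReal.ofReal r < ENNReal.ofReal (1 + θ) * power α (z j) := by
      refine (Set.Finite.eventually_all hSf).2 fun j _ => ?_
      by_cases hj : IsCovering α θ z j
      · have hj' := hj
        rw [IsCovering, ht, ← ENNReal.ofReal_coe_nnreal] at hj'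
        have hcont : Continuous fun r : ℝ => ENNReal.ofReal θ * ENNReal.ofReal r :=
          (ENNReal.continuous_const_mul ENNReal.ofReal_ne_top).comp ENNReal.continuous_ofReal
        filter_upwards [eventually_nhdsWithin_of_eventually_nhds
          ((hcont.tendsto (t : ℝ)).eventually (eventually_lt_nhds hj'))] with r hr _ using hr
      · exact Eventually.of_forall fun a hn => absurd hn hj
    obtain ⟨c, hc', hrc⟩ := (mem_nhdsGT_iff_exists_Ioo_subset).1 hr
    obtain ⟨r, hr1, hr2⟩ := exists_rat_btwn (show (t : ℝ) < c from hc')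
    have hrS := hrc ⟨hr1, hr2⟩
    refine ⟨a, r, ?_, ⟨i, hrS i (by simp [hS]) hi, ha1⟩, fun j hj => ?_⟩
    · rw [ht, ← ENNReal.ofReal_coe_nnreal]
      exact (ENNReal.ofReal_lt_ofReal_iff_of_nonneg t.coe_nonneg).2 hr1
    · have hjS : j ∈ S := hj.2.trans haS.le
      by_cases hcov : IsCovering α θ z j
      · exact absurd hj.1 (not_le.2 (hrS j hjS hcov))
      · exact absurd hj.2 (not_le.2 (hac j hjS hcov))
  · rintro ⟨a, r, hr, ⟨i, hi1, hi2⟩, hweak⟩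
    have hle : ENNReal.ofReal θ * total α z ≤ ENNReal.ofReal θ * ENNReal.ofReal r :=
      mul_le_mul_right hr.le _
    refine ⟨i, hle.trans_lt hi1, fun j hj => ?_⟩
    by_contra hcon
    exact hweak j ⟨(not_lt.1 hj).trans hle, (not_lt.1 hcon).trans hi2.le⟩

end Configuration

/-! ### The closest-coverage probability depends only on the intensity. -/

section Law

variable {α θ : ℝ} {lam : ℝ≥0} {F : Measure ℝ}

/-- The functionals that determine whether the closest point covers. -/
def covFunctional (α θ : ℝ) : Option (Bool × ℚ × ℚ) → Plane × ℝ → ℝ≥0∞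
  | none => power α
  | some (true, a, r) => (innerStrong α θ a r).indicator fun _ => 1
  | some (false, a, r) => (innerWeak α θ a r).indicator fun _ => 1

lemma measurable_covFunctional (α θ : ℝ) : ∀ j, Measurable (covFunctional α θ j)
  | none => measurable_power α
  | some (true, a, r) => measurable_const.indicator (measurableSet_innerStrong α θ a r)
  | some (false, a, r) => measurable_const.indicator (measurableSet_innerWeak α θ a r)

/-- The values of the functionals for which the closest point covers. -/
def covRegion : Set (Option (Bool × ℚ × ℚ) → ℝ≥0∞) := ⋃ a : ℚ, ⋃ r : ℚ,
  {y | y none < ENNReal.ofReal r ∧ 1 ≤ y (some (true, a, r)) ∧ y (some (false, a, r)) = 0}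

lemma measurableSet_covRegion : MeasurableSet covRegion :=
  MeasurableSet.iUnion fun _ => MeasurableSet.iUnion fun _ =>
    (measurableSet_lt (measurable_pi_apply _) measurable_const).inter
      ((measurableSet_le measurable_const (measurable_pi_apply _)).inter
        (measurableSet_eq_fun (measurable_pi_apply _) measurable_const))

lemma mem_covRegion {y : Option (Bool × ℚ × ℚ) → ℝ≥0∞} : y ∈ covRegion ↔ ∃ a r : ℚ,
    y none < ENNReal.ofReal r ∧ 1 ≤ y (some (true, a, r)) ∧ y (some (false, a, r)) = 0 := by
  simp [covRegion]

section

variable {Ω : Type*} [MeasurableSpace Ω] {P : Measure Ω} {Z : ℕ → Ω → Plane × ℝ}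

lemma IsPoisson.closestCovers_ae_eq [IsProbabilityMeasure P] (hα : 2 < α) (hlam : 0 < lam)
    (hF : IsFading α F) (hZ : IsPoisson P Z (intensity lam F)) :
    {ω | ClosestCovers α θ fun i => Z i ω} =ᵐ[P]
      (fun ω j => ∑' i, covFunctional α θ j (Z i ω)) ⁻¹' covRegion := by
  refine eventuallyEq_set.2 ?_
  filter_upwards [hZ.ae_isGood hα hlam hF] with ω hω
  rw [Set.mem_preimage, mem_covRegion]
  exact closestCovers_iff_num hω

lemma IsPoisson.measurable_covFunctional (hZ : IsPoisson P Z (intensity lam F)) (α θ : ℝ) :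
    Measurable fun ω j => ∑' i, covFunctional α θ j (Z i ω) :=
  measurable_pi_lambda _ fun j =>
    hZ.measurable_tsum (CellularNetwork.measurable_covFunctional α θ j)

lemma IsPoisson.nullMeasurableSet_closestCovers [IsProbabilityMeasure P] (hα : 2 < α) (hlam : 0 < lam)
    (hF : IsFading α F) (hZ : IsPoisson P Z (intensity lam F)) :
    NullMeasurableSet {ω | ClosestCovers α θ fun i => Z i ω} P :=
  ((hZ.measurable_covFunctional α θ) measurableSet_covRegion).nullMeasurableSet.congr
    (hZ.closestCovers_ae_eq hα hlam hF).symm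

/-- The probability that the closest point covers depends only on the intensity. -/
theorem IsPoisson.measure_closestCovers_eq [IsProbabilityMeasure P] {Ω' : Type*}
    [MeasurableSpace Ω'] {P' : Measure Ω'} [IsProbabilityMeasure P'] {Z' : ℕ → Ω' → Plane × ℝ}
    (hα : 2 < α) (hlam : 0 < lam) (hF : IsFading α F)
    (hZ : IsPoisson P Z (intensity lam F)) (hZ' : IsPoisson P' Z' (intensity lam F)) :
    P {ω | ClosestCovers α θ fun i => Z i ω} = P' {ω | ClosestCovers α θ fun i => Z' i ω} := by
  rw [measure_congr (hZ.closestCovers_ae_eq hα hlam hF),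
    measure_congr (hZ'.closestCovers_ae_eq hα hlam hF),
    ← Measure.map_apply (hZ.measurable_covFunctional α θ) measurableSet_covRegion,
    ← Measure.map_apply (hZ'.measurable_covFunctional α θ) measurableSet_covRegion,
    hZ.map_eq hZ' (CellularNetwork.measurable_covFunctional α θ)]

end

end Law

/-! ### Displacement of a marked Poisson process. -/

section Displacement

lemma lintegral_comp_smul_plane {f : Plane → ℝ≥0∞} (hf : Measurable f) {s : ℝ} (hs : 0 < s) :
    ∫⁻ x : Plane, f (s • x) = ENNReal.ofReal (s⁻¹ ^ 2) * ∫⁻ x : Plane, f x := by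
  have h := Measure.map_addHaar_smul (volume : Measure Plane) hs.ne'
  rw [← lintegral_map hf (measurable_const_smul s), h, lintegral_smul_measure,
    finrank_euclideanSpace_fin, abs_of_pos (by positivity), inv_pow]
  rfl

/-- Moving each point radially by a factor that depends on its mark, and changing the mark,
turns a marked Poisson process into another one. -/
theorem IsPoisson.displace {Ω : Type*} [MeasurableSpace Ω] {P : Measure Ω}
    {Z : ℕ → Ω → Plane × ℝ} {lam : ℝ≥0} {F F' : Measure ℝ} [IsProbabilityMeasure F]
    [IsProbabilityMeasure F'] (hZ : IsPoisson P Z (intensity lam F)) {s ψ : ℝ → ℝ}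
    (hs : Measurable s) (hψ : Measurable ψ) (hpos : ∀ᵐ y ∂F, 0 < s y)
    (hF : ∀ Φ : ℝ → ℝ≥0∞, Measurable Φ →
      ∫⁻ y, ENNReal.ofReal ((s y)⁻¹ ^ 2) * Φ (ψ y) ∂F = ∫⁻ y, Φ y ∂F') :
    IsPoisson P (fun i ω => (s (Z i ω).2 • (Z i ω).1, ψ (Z i ω).2)) (intensity lam F') := by
  have hD : Measurable fun z : Plane × ℝ => (s z.2 • z.1, ψ z.2) := by fun_prop
  refine ⟨fun i => hD.comp (hZ.measurable i), fun f hf => ?_⟩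
  rw [hZ.laplace (fun z => f (s z.2 • z.1, ψ z.2)) (hf.comp hD)]
  congr 1
  have hm : Measurable fun z => 1 - ex (f z) := continuous_one_sub_ex.measurable.comp hf
  rw [lintegral_intensity hm, lintegral_intensity (hm.fun_comp hD), ← hF _
    ((hm.lintegral_prod_left' (μ := (volume : Measure Plane))).const_mul _)]
  refine lintegral_congr_ae ?_
  filter_upwards [hpos] with y hy
  -- At a fixed mark, dilating the plane by `s y` multiplies area by `(s y)⁻²`; the hypothesis `hF`
  -- absorbs this weight into the new mark law.
  have h1 := lintegral_comp_smul_plane (f := fun x => 1 - ex (f (x, ψ y)))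
    (hm.comp measurable_prodMk_right) hy
  rw [h1, mul_left_comm]

end Displacement

/-! ### Coupling Rayleigh with Nakagami-`m` fading. -/

section Shift

/-- The map from tilted Rayleigh gains to tilted Nakagami-`m` gains. -/
def gainMap (α : ℝ) (m : ℕ) : ℝ → ℝ :=
  transport (gammaMeasure (1 + 2 / α) 1) (gammaMeasure (m + 2 / α) m)

/-- The radial factor by which the points are moved. -/
def radialFactor (α : ℝ) (m : ℕ) (y : ℝ) : ℝ :=
  -- The second factor compensates the change of gain in the received power. The constant equates
  -- the moments of order `2 / α`, so that the density of points stays `lam`.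
  √(gammaMoment 1 1 (2 / α) / gammaMoment m m (2 / α)) * (gainMap α m y / y) ^ α⁻¹

/-- The displacement turning Rayleigh fading into Nakagami-`m` fading while multiplying all
received powers by the same constant. -/
def shift (α : ℝ) (m : ℕ) (z : Plane × ℝ) : Plane × ℝ :=
  (radialFactor α m z.2 • z.1, gainMap α m z.2)

variable {α : ℝ} {m : ℕ}

lemma isPosLaw_tilted (hα : 2 < α) (hm : 1 ≤ m) : IsPosLaw (gammaMeasure (m + 2 / α) m) := by
  have : (0 : ℝ) < m := by exact_mod_cast hm
  exact isPosLaw_gammaMeasure (by positivity) this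

lemma isPosLaw_tilted_one (hα : 2 < α) : IsPosLaw (gammaMeasure (1 + 2 / α) 1) :=
  isPosLaw_gammaMeasure (by positivity) one_pos

lemma gainMap_pos (hα : 2 < α) (hm : 1 ≤ m) {y : ℝ} (hy : 0 < y) : 0 < gainMap α m y :=
  transport_pos (isPosLaw_tilted_one hα) (isPosLaw_tilted hα hm) hy

lemma measurable_gainMap (hα : 2 < α) (hm : 1 ≤ m) : Measurable (gainMap α m) :=
  (transport_monotone (isPosLaw_tilted_one hα) (isPosLaw_tilted hα hm)).measurable

lemma moments_pos (hα : 2 < α) (hm : 1 ≤ m) :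
    0 < gammaMoment 1 1 (2 / α) ∧ 0 < gammaMoment m m (2 / α) := by
  have : (0 : ℝ) < m := by exact_mod_cast hm
  exact ⟨gammaMoment_pos one_pos one_pos (by positivity),
    gammaMoment_pos this this (by positivity)⟩

lemma radialFactor_pos (hα : 2 < α) (hm : 1 ≤ m) {y : ℝ} (hy : 0 < y) :
    0 < radialFactor α m y := by
  obtain ⟨h1, h2⟩ := moments_pos hα hm
  have := gainMap_pos hα hm hy
  unfold radialFactor
  positivity

/-- With `ψ = gainMap α m`, the weight is a constant times `y^δ ψ(y)^(-δ)`, `δ = 2/α`. The factor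
`y^δ` tilts the exponential law to shape `1 + δ`, `ψ` carries it to shape `m + δ`, and `ψ^(-δ)`
undoes the tilt; the constants cancel. -/
lemma lintegral_radialFactor (hα : 2 < α) (hm : 1 ≤ m) {Φ : ℝ → ℝ≥0∞} (hΦ : Measurable Φ) :
    ∫⁻ y, ENNReal.ofReal ((radialFactor α m y)⁻¹ ^ 2) * Φ (gainMap α m y) ∂(gammaMeasure 1 1) =
      ∫⁻ y, Φ y ∂(gammaMeasure m m) := by
  obtain ⟨h1, h2⟩ := moments_pos hα hm
  have hm' : (0 : ℝ) < m := by exact_mod_cast hm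
  have hα0 : 0 < α := by linarith
  set M₁ := gammaMoment 1 1 (2 / α) with hM₁
  set M := gammaMoment m m (2 / α) with hM
  have hψ := measurable_gainMap hα hm
  have hΨ : Measurable fun u : ℝ => ENNReal.ofReal (u ^ (-(2 / α))) * Φ u :=
    (measurable_id.pow_const _).ennreal_ofReal.mul hΦ
  have hmap : (gammaMeasure (1 + 2 / α) 1).map (gainMap α m) = gammaMeasure (m + 2 / α) m :=
    map_transport (isPosLaw_tilted_one hα) (isPosLaw_tilted hα hm)
  calc ∫⁻ y, ENNReal.ofReal ((radialFactor α m y)⁻¹ ^ 2) * Φ (gainMap α m y) ∂(gammaMeasure 1 1)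
      = ∫⁻ y, ENNReal.ofReal (M / M₁) * (ENNReal.ofReal (y ^ (2 / α)) *
          (ENNReal.ofReal ((gainMap α m y) ^ (-(2 / α))) * Φ (gainMap α m y)))
          ∂(gammaMeasure 1 1) := by
        refine lintegral_congr_ae ?_
        filter_upwards [ae_pos_gammaMeasure one_pos one_pos] with y hy
        have hg := gainMap_pos hα hm hy
        rw [← mul_assoc, ← mul_assoc, ← ENNReal.ofReal_mul (by positivity),
          ← ENNReal.ofReal_mul (by positivity)]
        congr 2
        rw [radialFactor, mul_inv, mul_pow, inv_pow, Real.sq_sqrt (by positivity), inv_div, inv_pow,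
          ← Real.rpow_natCast, ← Real.rpow_mul (by positivity), Nat.cast_ofNat,
          show α⁻¹ * 2 = 2 / α by ring, Real.div_rpow hg.le hy.le, Real.rpow_neg hg.le, inv_div]
        ring
    _ = ENNReal.ofReal (M / M₁) * (ENNReal.ofReal M₁ *
          ∫⁻ u, ENNReal.ofReal (u ^ (-(2 / α))) * Φ u ∂(gammaMeasure (m + 2 / α) m)) := by
        rw [lintegral_const_mul' _ _ ENNReal.ofReal_ne_top,
          lintegral_rpow_mul_gammaMeasure one_pos one_pos (by positivity) (hΨ.fun_comp hψ),
          ← hmap, lintegral_map hΨ hψ]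
    _ = ∫⁻ y, Φ y ∂(gammaMeasure m m) := by
        rw [lintegral_rpow_mul_gammaMeasure (by positivity) hm' (by simpa using hm') hΦ,
          ← mul_assoc, ← mul_assoc, ← ENNReal.ofReal_mul (by positivity),
          ← ENNReal.ofReal_mul (by positivity)]
        have h3 : M / M₁ * M₁ * gammaMoment (m + 2 / α) m (-(2 / α)) = 1 := by
          have := Real.Gamma_pos_of_pos hm'
          have := Real.Gamma_pos_of_pos (show 0 < (m : ℝ) + 2 / α by positivity)
          have := Real.rpow_pos_of_pos hm' (2 / α)
          rw [hM, gammaMoment, gammaMoment, add_neg_cancel_right, Real.rpow_neg hm'.le]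
          field_simp
        rw [h3, ENNReal.ofReal_one, one_mul, add_neg_cancel_right]

/-- The shifted Rayleigh network is a Nakagami-`m` network. -/
lemma IsPoisson.isPoisson_shift {Ω : Type*} [MeasurableSpace Ω] {P : Measure Ω}
    {Z : ℕ → Ω → Plane × ℝ} {lam : ℝ≥0} (hα : 2 < α) (hm : 1 ≤ m)
    (hZ : IsPoisson P Z (intensity lam (gammaMeasure 1 1))) :
    IsPoisson P (fun i ω => shift α m (Z i ω)) (intensity lam (gammaMeasure m m)) := by
  have hm' : (0 : ℝ) < m := by exact_mod_cast hm
  have := isProbabilityMeasure_gammaMeasure one_pos one_pos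
  have := isProbabilityMeasure_gammaMeasure hm' hm'
  have hψ := measurable_gainMap hα hm
  refine hZ.displace (s := radialFactor α m) (ψ := gainMap α m) ?_ hψ ?_
    fun Φ hΦ => lintegral_radialFactor hα hm hΦ
  · unfold radialFactor
    fun_prop
  · filter_upwards [ae_pos_gammaMeasure one_pos one_pos] with y hy
    exact radialFactor_pos hα hm hy

end Shift

/-! ### Monotonicity in `m` and the limit, configuration by configuration. -/

section Ratio

variable {α θ : ℝ} {m : ℕ}

/-- The inverse of the received power. -/
def invPower (α : ℝ) (z : Plane × ℝ) : ℝ := ‖z.1‖ ^ α / z.2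

lemma invPower_pos {z : Plane × ℝ} (h1 : 0 < ‖z.1‖) (h2 : 0 < z.2) : 0 < invPower α z := by
  unfold invPower
  positivity

lemma power_eq_inv {z : Plane × ℝ} (h1 : 0 < ‖z.1‖) (h2 : 0 < z.2) :
    power α z = ENNReal.ofReal (invPower α z)⁻¹ := by
  rw [← Prod.mk.eta (p := z), power_of_pos h1 h2, invPower, inv_div, Real.rpow_neg h1.le]
  rfl

/-- The event that the closest point covers in the shifted network. -/
def ShiftCovers (α θ : ℝ) (m : ℕ) (z : ℕ → Plane × ℝ) : Prop :=
  ∃ i, IsCovering α θ z i ∧ ∀ j, ¬IsCovering α θ z j →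
    invPower α (z i) * gainMap α m (z i).2 < invPower α (z j) * gainMap α m (z j).2

/-- The factor by which the shift divides the received powers. -/
def shiftScale (α : ℝ) (m : ℕ) : ℝ :=
  √(gammaMoment 1 1 (2 / α) / gammaMoment m m (2 / α)) ^ α

lemma shiftScale_pos (hα : 2 < α) (hm : 1 ≤ m) : 0 < shiftScale α m := by
  obtain ⟨h1, h2⟩ := moments_pos hα hm
  unfold shiftScale
  positivity

/-- The constant does not depend on the point, so the shifted distances are ordered by the products
that appear in `ShiftCovers`. -/
lemma norm_shift_rpow (hα : 2 < α) (hm : 1 ≤ m) {z : Plane × ℝ} (h2 : 0 < z.2) :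
    ‖(shift α m z).1‖ ^ α = shiftScale α m * (invPower α z * gainMap α m z.2) := by
  have hr := radialFactor_pos hα hm h2
  have hg := gainMap_pos hα hm h2
  obtain ⟨h3, h4⟩ := moments_pos hα hm
  rw [shift, norm_smul, Real.norm_of_nonneg hr.le, Real.mul_rpow hr.le (norm_nonneg _),
    radialFactor, Real.mul_rpow (by positivity) (by positivity), Real.rpow_inv_rpow (by positivity)
      (by linarith), shiftScale, invPower]
  ring

/-- The new gain cancels against the gain in `norm_shift_rpow`. As all powers are divided by the
same constant, the covering points are the same before and after the shift. -/
lemma power_shift (hα : 2 < α) (hm : 1 ≤ m) {z : Plane × ℝ} (h1 : 0 < ‖z.1‖) (h2 : 0 < z.2) :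
    power α (shift α m z) = ENNReal.ofReal (shiftScale α m)⁻¹ * power α z := by
  have hg := gainMap_pos hα hm h2
  have hs := shiftScale_pos hα hm
  have hn : 0 < ‖(shift α m z).1‖ := by
    rw [shift, norm_smul, Real.norm_of_nonneg (radialFactor_pos hα hm h2).le]
    exact mul_pos (radialFactor_pos hα hm h2) h1
  rw [power_eq_inv hn hg, power_eq_inv h1 h2, ← ENNReal.ofReal_mul (by positivity)]
  congr 1
  rw [invPower, norm_shift_rpow hα hm h2]
  have := invPower_pos (α := α) h1 h2
  simp only [shift]
  field_simp

lemma isCovering_shift_iff (hα : 2 < α) (hm : 1 ≤ m) {z : ℕ → Plane × ℝ} (h : IsGood α z) (i : ℕ) :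
    IsCovering α θ (fun i => shift α m (z i)) i ↔ IsCovering α θ z i := by
  have hp : ∀ i, power α (shift α m (z i)) = ENNReal.ofReal (shiftScale α m)⁻¹ * power α (z i) :=
    fun i => power_shift hα hm (h.norm_pos i) (h.gain_pos i)
  have hs : ENNReal.ofReal (shiftScale α m)⁻¹ ≠ 0 :=
    (ENNReal.ofReal_pos.2 (inv_pos.2 (shiftScale_pos hα hm))).ne'
  rw [IsCovering, IsCovering, total, total, hp]
  simp_rw [hp]
  rw [ENNReal.tsum_mul_left, mul_left_comm, mul_left_comm (ENNReal.ofReal (1 + θ)),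
    ENNReal.mul_lt_mul_iff_right hs ENNReal.ofReal_ne_top]

lemma closestCovers_shift_iff (hα : 2 < α) (hm : 1 ≤ m) {z : ℕ → Plane × ℝ} (h : IsGood α z) :
    ClosestCovers α θ (fun i => shift α m (z i)) ↔ ShiftCovers α θ m z := by
  have hα0 : 0 < α := by linarith
  simp only [ClosestCovers, ShiftCovers, isCovering_shift_iff hα hm h]
  refine exists_congr fun i => and_congr_right fun _ => forall_congr' fun j => imp_congr_right
    fun _ => ?_
  rw [← Real.rpow_lt_rpow_iff (norm_nonneg _) (norm_nonneg _) hα0,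
    norm_shift_rpow hα hm (h.gain_pos i), norm_shift_rpow hα hm (h.gain_pos j),
    mul_lt_mul_iff_right₀ (shiftScale_pos hα hm)]

lemma invPower_lt_of_covering {z : ℕ → Plane × ℝ} (h : IsGood α z) {i j : ℕ}
    (hi : IsCovering α θ z i) (hj : ¬IsCovering α θ z j) :
    invPower α (z i) < invPower α (z j) := by
  have h1 : power α (z j) < power α (z i) := by
    by_contra hc
    exact hj (lt_of_lt_of_le hi (mul_le_mul_right (not_lt.1 hc) _))
  rw [power_eq_inv (h.norm_pos i) (h.gain_pos i), power_eq_inv (h.norm_pos j) (h.gain_pos j)] at h1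
  have h2 := (ENNReal.ofReal_lt_ofReal_iff_of_nonneg
    (inv_pos.2 (invPower_pos (h.norm_pos j) (h.gain_pos j))).le).1 h1
  exact (inv_lt_inv₀ (invPower_pos (h.norm_pos j) (h.gain_pos j))
    (invPower_pos (h.norm_pos i) (h.gain_pos i))).1 h2

/-- A star-shaped map preserves the order of products whose first factors are ordered. -/
lemma mul_lt_mul_of_star {χ : ℝ → ℝ} (hpos : ∀ u, 0 < u → 0 < χ u)
    (hmono : StrictMonoOn χ (Set.Ioi 0)) (hstar : ∀ u v, 0 < u → u < v → χ v / v < χ u / u)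
    {a b u v : ℝ} (ha : 0 < a) (hab : a < b) (hu : 0 < u) (hv : 0 < v) (h : a * u < b * v) :
    a * χ u < b * χ v := by
  rcases le_or_gt u v with huv | huv
  · have := hmono.monotoneOn hu hv huv
    have := hpos v hv
    nlinarith
  -- Here `χ u / χ v < u / v < b / a`.
  · have h1 := hstar v u hv huv
    rw [div_lt_div_iff₀ hu hv] at h1
    have h2 := hpos v hv
    have h3 : a * χ u * v < b * χ v * v := by
      calc a * χ u * v = a * (χ u * v) := by ring
        _ < a * (χ v * u) := mul_lt_mul_of_pos_left h1 ha
        _ = χ v * (a * u) := by ring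
        _ < χ v * (b * v) := mul_lt_mul_of_pos_left h h2
        _ = b * χ v * v := by ring
    exact lt_of_mul_lt_mul_right h3 hv.le

/-- The map from tilted Nakagami-`m` gains to tilted Nakagami-`(m + 1)` gains. -/
def stepMap (α : ℝ) (m : ℕ) : ℝ → ℝ :=
  transport (gammaMeasure (m + 2 / α) m) (gammaMeasure ((m + 1 : ℕ) + 2 / α) (m + 1 : ℕ))

/-- Quantile maps compose. -/
lemma gainMap_succ (hα : 2 < α) (hm : 1 ≤ m) {y : ℝ} (hy : 0 < y) :
    gainMap α (m + 1) y = stepMap α m (gainMap α m y) := by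
  have h1 := isPosLaw_tilted_one hα
  have h2 := isPosLaw_tilted hα hm
  have h3 := isPosLaw_tilted (m := m + 1) hα (by omega)
  have h4 := transport_spec h1 h2 hy
  have h5 := transport_spec h2 h3 h4.1
  exact transport_eq h1 h3 hy h5.1 (h5.2.trans h4.2)

lemma stepMap_pos (hα : 2 < α) (hm : 1 ≤ m) {u : ℝ} (hu : 0 < u) : 0 < stepMap α m u :=
  transport_pos (isPosLaw_tilted hα hm) (isPosLaw_tilted hα (by omega)) hu

lemma stepMap_strictMonoOn (hα : 2 < α) (hm : 1 ≤ m) :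
    StrictMonoOn (stepMap α m) (Set.Ioi 0) :=
  transport_strictMonoOn (isPosLaw_tilted hα hm) (isPosLaw_tilted hα (by omega))

lemma stepMap_star (hα : 2 < α) (hm : 1 ≤ m) {u v : ℝ} (hu : 0 < u) (huv : u < v) :
    stepMap α m v / v < stepMap α m u / u := by
  have hm' : (0 : ℝ) < m := by exact_mod_cast hm
  exact transport_gammaMeasure_div_lt (by positivity) hm' (by push_cast; linarith)
    (by positivity) hu huv

lemma gainMap_star (hα : 2 < α) (hm : 2 ≤ m) {u v : ℝ} (hu : 0 < u) (huv : u < v) :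
    gainMap α m v / v < gainMap α m u / u := by
  have hm' : (2 : ℝ) ≤ m := by exact_mod_cast hm
  exact transport_gammaMeasure_div_lt (by positivity) one_pos (by linarith)
    (by linarith) hu huv

lemma gainMap_strictMonoOn (hα : 2 < α) (hm : 1 ≤ m) :
    StrictMonoOn (gainMap α m) (Set.Ioi 0) :=
  transport_strictMonoOn (isPosLaw_tilted_one hα) (isPosLaw_tilted hα hm)

/-- The covering point that works for `m` still works: it has the smaller inverse power, so the
star-shaped step map keeps it closer than each noncovering point. -/
lemma ShiftCovers.succ (hα : 2 < α) (hm : 1 ≤ m) {z : ℕ → Plane × ℝ} (h : IsGood α z)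
    (hc : ShiftCovers α θ m z) : ShiftCovers α θ (m + 1) z := by
  obtain ⟨i, hi, hlt⟩ := hc
  refine ⟨i, hi, fun j hj => ?_⟩
  rw [gainMap_succ hα hm (h.gain_pos i), gainMap_succ hα hm (h.gain_pos j)]
  exact mul_lt_mul_of_star (fun u hu => stepMap_pos hα hm hu) (stepMap_strictMonoOn hα hm)
    (fun u v hu huv => stepMap_star hα hm hu huv)
    (invPower_pos (h.norm_pos i) (h.gain_pos i)) (invPower_lt_of_covering h hi hj)
    (gainMap_pos hα hm (h.gain_pos i)) (gainMap_pos hα hm (h.gain_pos j)) (hlt j hj)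

/-- If some point covers, then the closest point of the shifted network covers for large `m`. -/
lemma eventually_shiftCovers (hα : 2 < α) {z : ℕ → Plane × ℝ} (h : IsGood α z) {i : ℕ}
    (hi : IsCovering α θ z i) : ∀ᶠ m in atTop, ShiftCovers α θ m z := by
  have hα0 : 0 < α := by linarith
  have hlim : ∀ j, Tendsto (fun m : ℕ => invPower α (z j) * gainMap α m (z j).2) atTop
      (𝓝 (invPower α (z j))) := fun j => by
    have := (tendsto_transport_gammaMeasure (δ := 2 / α) (by positivity) (h.gain_pos j)).const_mul
      (invPower α (z j))
    rwa [mul_one] at this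
  -- Pointwise convergence of the gains to `1` handles only the finitely many points no farther than
  -- `i`. For the infinitely many others, the star order applied to the original distances gives the
  -- inequality for all `m ≥ 2`.
  have hfin : ∀ᶠ m : ℕ in atTop, ∀ j ∈ {j | ‖(z j).1‖ ≤ ‖(z i).1‖}, ¬IsCovering α θ z j →
      invPower α (z i) * gainMap α m (z i).2 < invPower α (z j) * gainMap α m (z j).2 := by
    refine (Set.Finite.eventually_all (h.finite _)).2 fun j _ => ?_
    by_cases hj : IsCovering α θ z j
    · exact Eventually.of_forall fun _ hn => absurd hj hn
    · filter_upwards [(hlim i).eventually_lt (hlim j) (invPower_lt_of_covering h hi hj)]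
        with m hm _ using hm
  filter_upwards [hfin, eventually_ge_atTop 2] with m hm hm2
  refine ⟨i, hi, fun j hj => ?_⟩
  by_cases hji : ‖(z j).1‖ ≤ ‖(z i).1‖
  · exact hm j hji hj
  · refine mul_lt_mul_of_star (fun u hu => gainMap_pos hα (by omega) hu)
      (gainMap_strictMonoOn hα (by omega)) (fun u v hu huv => gainMap_star hα hm2 hu huv)
      (invPower_pos (h.norm_pos i) (h.gain_pos i)) (invPower_lt_of_covering h hi hj)
      (h.gain_pos i) (h.gain_pos j) ?_
    rw [invPower, invPower, div_mul_cancel₀ _ (h.gain_pos i).ne',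
      div_mul_cancel₀ _ (h.gain_pos j).ne']
    exact Real.rpow_lt_rpow (norm_nonneg _) (not_le.1 hji) hα0

end Ratio

/-! ### Strictness: configurations dominated by two points. -/

section Dominant

variable {α θ : ℝ} {m : ℕ} {z : ℕ → Plane × ℝ}

lemma not_isCovering_of_le (hθ : 0 < θ) {i k : ℕ} (hik : i ≠ k)
    (hp : power α (z k) ≤ ENNReal.ofReal θ * power α (z i)) : ¬IsCovering α θ z k := by
  rw [IsCovering, not_lt]
  have h1 : power α (z i) + power α (z k) ≤ total α z := by
    rw [← Finset.sum_pair (f := fun k => power α (z k)) hik]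
    exact ENNReal.sum_le_tsum _
  calc ENNReal.ofReal (1 + θ) * power α (z k)
      = power α (z k) + ENNReal.ofReal θ * power α (z k) := by
        rw [ENNReal.ofReal_add zero_le_one hθ.le, ENNReal.ofReal_one, add_mul, one_mul]
    _ ≤ ENNReal.ofReal θ * power α (z i) + ENNReal.ofReal θ * power α (z k) := by gcongr
    _ = ENNReal.ofReal θ * (power α (z i) + power α (z k)) := by rw [mul_add]
    _ ≤ ENNReal.ofReal θ * total α z := by gcongr

/-- A configuration dominated by one strong and one weaker but suitably placed point, for which
the closest point covers after the shift of order `m + 1` but not after the shift of order `m`. -/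
lemma shiftCovers_of_dominant (hα : 2 < α) (hθ : 0 < θ) (hm : 1 ≤ m) (h : IsGood α z) {i j : ℕ}
    (hij : i ≠ j) {ε : ℝ} (hε : 0 ≤ ε) (hε1 : θ * ε ≤ 1 / 4) (hε2 : ε ≤ θ / 4)
    (hi : invPower α (z i) < 2)
    (hw : (2 * θ + 1 / θ) * invPower α (z i) < invPower α (z j))
    (hsucc : invPower α (z i) * gainMap α (m + 1) (z i).2 <
      invPower α (z j) * gainMap α (m + 1) (z j).2)
    (hnot : invPower α (z j) * gainMap α m (z j).2 < invPower α (z i) * gainMap α m (z i).2)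
    (hfar : ∀ k, k ≠ i → k ≠ j → ‖(z i).1‖ < ‖(z k).1‖)
    (htot : total α z ≤ power α (z i) + power α (z j) + ENNReal.ofReal ε) :
    ShiftCovers α θ (m + 1) z ∧ ¬ShiftCovers α θ m z := by
  have hwi := invPower_pos (α := α) (h.norm_pos i) (h.gain_pos i)
  have hwj := invPower_pos (α := α) (h.norm_pos j) (h.gain_pos j)
  have hpi := power_eq_inv (α := α) (h.norm_pos i) (h.gain_pos i)
  have hpj := power_eq_inv (α := α) (h.norm_pos j) (h.gain_pos j)
  set a := (invPower α (z i))⁻¹ with ha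
  set b := (invPower α (z j))⁻¹ with hb
  have ha0 : 0 < a := inv_pos.2 hwi
  have hb0 : 0 < b := inv_pos.2 hwj
  have ha2 : 1 / 2 < a := by
    rw [ha, one_div]
    exact inv_strictAnti₀ hwi hi
  have hab : (2 * θ + 1 / θ) * b < a := by
    rw [ha, hb, ← div_eq_mul_inv, div_lt_iff₀ hwj, ← div_eq_inv_mul, lt_div_iff₀ hwi]
    exact hw
  have hab1 : 2 * θ * b < a := by
    have : 0 < 1 / θ * b := by positivity
    linarith [add_mul (2 * θ) (1 / θ) b]
  have hab2 : b < θ * a := by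
    have h1 : 0 < 2 * θ * b := by positivity
    have h2 : 1 / θ * b < a := by linarith [add_mul (2 * θ) (1 / θ) b]
    have h3 := mul_lt_mul_of_pos_left h2 hθ
    field_simp at h3
    linarith
  -- The requirement is `θ (b + ε) < a`; here `θ b < a / 2` and `θ ε ≤ 1 / 4 < a / 2`.
  have hci : IsCovering α θ z i := by
    refine lt_of_le_of_lt (mul_le_mul_right htot _) ?_
    rw [hpi, hpj, ← ENNReal.ofReal_add ha0.le hb0.le, ← ENNReal.ofReal_add (by positivity) hε,
      ← ENNReal.ofReal_mul hθ.le, ← ENNReal.ofReal_mul (by positivity)]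
    refine (ENNReal.ofReal_lt_ofReal_iff (by positivity)).2 ?_
    nlinarith
  have hcj : ¬IsCovering α θ z j := by
    refine not_isCovering_of_le hθ hij ?_
    rw [hpi, hpj, ← ENNReal.ofReal_mul hθ.le]
    exact ENNReal.ofReal_le_ofReal hab2.le
  have hpk : ∀ k, k ≠ i → k ≠ j → power α (z k) ≤ ENNReal.ofReal ε := fun k hki hkj => by
    have h1 : power α (z i) + power α (z j) + power α (z k) ≤ total α z := by
      have := ENNReal.sum_le_tsum (f := fun k => power α (z k)) {i, j, k}
      rwa [Finset.sum_insert (by simp [hij, hki.symm]), Finset.sum_pair hkj.symm, ← add_assoc]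
        at this
    exact (ENNReal.add_le_add_iff_left (ENNReal.add_ne_top.2
      ⟨h.power_ne_top i, h.power_ne_top j⟩)).1 (h1.trans htot)
  -- A remaining point has power at most `ε ≤ θ / 4 < θ a`. So `i` is the only covering point, and
  -- coverage reduces to whether it stays ahead of `j`.
  have hck : ∀ k, k ≠ i → ¬IsCovering α θ z k := fun k hki => by
    rcases eq_or_ne k j with rfl | hkj
    · exact hcj
    · refine not_isCovering_of_le hθ hki.symm ((hpk k hki hkj).trans ?_)
      rw [hpi, ← ENNReal.ofReal_mul hθ.le]
      exact ENNReal.ofReal_le_ofReal (by nlinarith)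
  refine ⟨⟨i, hci, fun k hk => ?_⟩, ?_⟩
  · rcases eq_or_ne k j with rfl | hkj
    · exact hsucc
    · have hki : k ≠ i := by
        rintro rfl
        exact hk hci
      refine mul_lt_mul_of_star (fun u hu => gainMap_pos hα (by omega) hu)
        (gainMap_strictMonoOn hα (by omega))
        (fun u v hu huv => gainMap_star hα (by omega) hu huv) hwi
        (invPower_lt_of_covering h hci hk) (h.gain_pos i) (h.gain_pos k) ?_
      rw [invPower, invPower, div_mul_cancel₀ _ (h.gain_pos i).ne',
        div_mul_cancel₀ _ (h.gain_pos k).ne']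
      exact Real.rpow_lt_rpow (norm_nonneg _) (hfar k hki hkj) (by linarith)
  · rintro ⟨k, hk, hlt⟩
    have hki : k = i := by
      by_contra hne
      exact hck k hne hk
    subst hki
    exact lt_asymm hnot (hlt j hcj)

end Dominant

/-! ### Open sets of dominant pairs. -/

section Boxes

variable {α : ℝ} {m : ℕ}

lemma continuousAt_invPower (hα : 0 < α) {z : Plane × ℝ} (h : 0 < z.2) :
    ContinuousAt (invPower α) z := by
  unfold invPower
  exact (continuousAt_fst.norm.rpow_const (Or.inr hα.le)).div continuousAt_snd h.ne'

lemma continuousAt_gainMap (hα : 2 < α) (hm : 1 ≤ m) {v : ℝ} (hv : 0 < v) :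
    ContinuousAt (gainMap α m) v :=
  transport_continuousAt (isPosLaw_tilted_one hα) (isPosLaw_tilted hα hm) hv

/-- Any point `p` and any closer, weaker point `q` related in this way dominate a configuration in
which all other points are far away and weak. -/
def IsDominant (α : ℝ) (m : ℕ) (L R : ℝ) (p q : Plane × ℝ) : Prop :=
  ‖p.1‖ < R ∧ ‖q.1‖ < R ∧ q.2 < p.2 ∧ invPower α p < 2 ∧ L * invPower α p < invPower α q ∧
    invPower α p * gainMap α (m + 1) p.2 < invPower α q * gainMap α (m + 1) q.2 ∧
    invPower α q * gainMap α m q.2 < invPower α p * gainMap α m p.2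

/-- Take gains `1` and `v < 1`, and inverse powers `1` and `w`. The order must flip between `m` and
`m + 1`, so `w` must lie between the ratios of the transported gains of `1` and `v` for `m + 1` and
for `m`. The strict star order makes this interval nonempty. Choosing `v` with ratio `L + 1` for `m
+ 1` also gives `w > L`. -/
lemma exists_isDominant (hα : 2 < α) (hm : 1 ≤ m) {L : ℝ} (hL : 0 < L) :
    ∃ (R : ℝ) (p q : Plane × ℝ), 0 < p.2 ∧ 0 < q.2 ∧ IsDominant α m L R p q := by
  have hα0 : 0 < α := by linarith
  have hm1 : 1 ≤ m + 1 := by omega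
  have hone : (1 : ℝ) ∈ Set.Ioi 0 := Set.mem_Ioi.2 one_pos
  have h1 := gainMap_pos hα hm1 one_pos
  have h1' := gainMap_pos hα hm one_pos
  obtain ⟨v, hv, hvx⟩ : ∃ v, 0 < v ∧ gainMap α (m + 1) v = gainMap α (m + 1) 1 / (L + 1) :=
    transport_surj (isPosLaw_tilted_one hα) (isPosLaw_tilted hα hm1) (by positivity)
  have hv1 : v < 1 := by
    by_contra hcon
    have h2 := (gainMap_strictMonoOn hα hm1).monotoneOn hone hv (not_lt.1 hcon)
    rw [hvx, le_div_iff₀ (by positivity)] at h2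
    nlinarith
  have hvm := gainMap_pos hα hm hv
  have hρ : L + 1 < gainMap α m 1 / gainMap α m v := by
    have h2 := stepMap_star hα hm hvm (gainMap_strictMonoOn hα hm hv hone hv1)
    rw [← gainMap_succ hα hm one_pos, ← gainMap_succ hα hm hv, hvx, div_lt_div_iff₀ h1' hvm,
      div_mul_eq_mul_div, lt_div_iff₀ (by positivity)] at h2
    rw [lt_div_iff₀ hvm]
    nlinarith
  obtain ⟨w, hw1, hw2⟩ := exists_between hρ
  rw [lt_div_iff₀ hvm] at hw2
  have hw0 : 0 < w := by linarith
  obtain ⟨x₁, hx₁⟩ := exists_norm_eq Plane (zero_le_one' ℝ)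
  obtain ⟨x₂, hx₂⟩ := exists_norm_eq Plane (c := (w * v) ^ α⁻¹) (by positivity)
  have hi1 : invPower α (x₁, 1) = 1 := by simp [invPower, hx₁]
  have hi2 : invPower α (x₂, v) = w := by
    rw [invPower, hx₂, Real.rpow_inv_rpow (by positivity) hα0.ne', mul_div_cancel_right₀ _ hv.ne']
  refine ⟨max ‖x₁‖ ‖x₂‖ + 1, (x₁, 1), (x₂, v), one_pos, hv, ?_⟩
  rw [IsDominant, hi1, hi2]
  refine ⟨by linarith [le_max_left ‖x₁‖ ‖x₂‖], by linarith [le_max_right ‖x₁‖ ‖x₂‖], hv1,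
    one_lt_two, by linarith, ?_, by rwa [one_mul]⟩
  rw [one_mul, hvx, mul_div_assoc', lt_div_iff₀ (by positivity)]
  nlinarith

lemma IsDominant.eventually (hα : 2 < α) (hm : 1 ≤ m) {L R : ℝ} {p q : Plane × ℝ} (hp : 0 < p.2)
    (hq : 0 < q.2) (h : IsDominant α m L R p q) :
    ∀ᶠ y : (Plane × ℝ) × Plane × ℝ in 𝓝 (p, q), IsDominant α m L R y.1 y.2 := by
  have hα0 : 0 < α := by linarith
  have hc1 : Tendsto (fun y : (Plane × ℝ) × Plane × ℝ => invPower α y.1) (𝓝 (p, q))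
      (𝓝 (invPower α p)) :=
    (continuousAt_invPower hα0 hp).tendsto.comp (continuous_fst.tendsto (p, q))
  have hc2 : Tendsto (fun y : (Plane × ℝ) × Plane × ℝ => invPower α y.2) (𝓝 (p, q))
      (𝓝 (invPower α q)) :=
    (continuousAt_invPower hα0 hq).tendsto.comp (continuous_snd.tendsto (p, q))
  have hg1 : ∀ {n : ℕ}, 1 ≤ n → Tendsto (fun y : (Plane × ℝ) × Plane × ℝ => gainMap α n y.1.2)
      (𝓝 (p, q)) (𝓝 (gainMap α n p.2)) := fun hn =>
    (continuousAt_gainMap hα hn hp).tendsto.comp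
      ((continuous_snd.comp continuous_fst).tendsto (p, q))
  have hg2 : ∀ {n : ℕ}, 1 ≤ n → Tendsto (fun y : (Plane × ℝ) × Plane × ℝ => gainMap α n y.2.2)
      (𝓝 (p, q)) (𝓝 (gainMap α n q.2)) := fun hn =>
    (continuousAt_gainMap hα hn hq).tendsto.comp
      ((continuous_snd.comp continuous_snd).tendsto (p, q))
  have hn1 : Tendsto (fun y : (Plane × ℝ) × Plane × ℝ => ‖y.1.1‖) (𝓝 (p, q)) (𝓝 ‖p.1‖) :=
    Continuous.tendsto (by fun_prop) (p, q)
  have hn2 : Tendsto (fun y : (Plane × ℝ) × Plane × ℝ => ‖y.2.1‖) (𝓝 (p, q)) (𝓝 ‖q.1‖) :=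
    Continuous.tendsto (by fun_prop) (p, q)
  have hs1 : Tendsto (fun y : (Plane × ℝ) × Plane × ℝ => y.1.2) (𝓝 (p, q)) (𝓝 p.2) :=
    Continuous.tendsto (by fun_prop) (p, q)
  have hs2 : Tendsto (fun y : (Plane × ℝ) × Plane × ℝ => y.2.2) (𝓝 (p, q)) (𝓝 q.2) :=
    Continuous.tendsto (by fun_prop) (p, q)
  have hm1 : 1 ≤ m + 1 := by omega
  obtain ⟨a1, a2, a3, a4, a5, a6, a7⟩ := h
  filter_upwards [hn1.eventually_lt tendsto_const_nhds a1, hn2.eventually_lt tendsto_const_nhds a2,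
    hs2.eventually_lt hs1 a3, hc1.eventually_lt tendsto_const_nhds a4,
    (hc1.const_mul L).eventually_lt hc2 a5,
    (hc1.mul (hg1 hm1)).eventually_lt (hc2.mul (hg2 hm1)) a6,
    (hc2.mul (hg2 hm)).eventually_lt (hc1.mul (hg1 hm)) a7] with y b1 b2 b3 b4 b5 b6 b7
  exact ⟨b1, b2, b3, b4, b5, b6, b7⟩

/-- Open sets of which any two points form a dominant pair. -/
lemma exists_dominant_boxes (hα : 2 < α) (hm : 1 ≤ m) {L : ℝ} (hL : 0 < L) :
    ∃ (R : ℝ) (A B : Set (Plane × ℝ)), IsOpen A ∧ IsOpen B ∧ (∃ z ∈ A, 0 < z.2) ∧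
      (∃ z ∈ B, 0 < z.2) ∧ ∀ p ∈ A, ∀ q ∈ B, IsDominant α m L R p q := by
  obtain ⟨R, p, q, hp, hq, h⟩ := exists_isDominant hα hm hL
  obtain ⟨A, B, hA, hpA, hB, hqB, hAB⟩ :=
    mem_nhds_prod_iff'.1 (eventually_iff.1 (h.eventually hα hm hp hq))
  refine ⟨R, A, B, hA, hB, ⟨p, hpA, hp⟩, ⟨q, hqB, hq⟩, fun x hx y hy => ?_⟩
  have hxy := hAB (Set.mk_mem_prod hx hy)
  rwa [Set.mem_ofPred_eq] at hxy

lemma intensity_pos {lam : ℝ≥0} (hlam : 0 < lam) {F : Measure ℝ} (hF : IsPosLaw F)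
    {A : Set (Plane × ℝ)} (hA : IsOpen A) (h : ∃ z ∈ A, 0 < z.2) : intensity lam F A ≠ 0 := by
  have := hF.isProb
  obtain ⟨⟨x, y⟩, hz, hy⟩ := h
  obtain ⟨U, V, hU, hxU, hV, hyV, hUV⟩ := mem_nhds_prod_iff'.1 (hA.mem_nhds hz)
  obtain ⟨b, hb, hbV⟩ := exists_Ico_subset_of_mem_nhds (hV.mem_nhds hyV) ⟨y + 1, lt_add_one y⟩
  have hF0 : F V ≠ 0 := by
    refine ne_of_gt (lt_of_lt_of_le (pos_iff_ne_zero.2 (hF.pos y ((y + b) / 2) hy.le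
      (by linarith [hb]))) (measure_mono fun t ht => hbV ⟨ht.1.le, ?_⟩))
    have := ht.2
    linarith [hb]
  refine ne_of_gt (lt_of_lt_of_le (pos_iff_ne_zero.2 ?_) (measure_mono hUV))
  rw [intensity, Measure.prod_prod]
  refine mul_ne_zero ?_ hF0
  have h1 : volume U ≠ 0 := (hU.measure_pos volume ⟨x, hxU⟩).ne'
  have h2 : (lam : ℝ≥0∞) ≠ 0 := by exact_mod_cast hlam.ne'
  exact mul_ne_zero h2 h1

end Boxes

/-! ### Events of positive probability in disjoint regions. -/

section Void

variable {Ω : Type*} [MeasurableSpace Ω] {P : Measure Ω}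

/-- The Laplace functional of the function equal to `∞` on `A` and `0` elsewhere is `e^{-Λ(A)}`; it
would vanish if `A` were almost surely occupied. -/
lemma IsPoisson.measure_num_eq_zero_ne_zero {E : Type*} [MeasurableSpace E] {Z : ℕ → Ω → E}
    {Λ : Measure E} (hZ : IsPoisson P Z Λ) {A : Set E} (hA : MeasurableSet A) (hfin : Λ A ≠ ⊤) :
    P {ω | num A (fun i => Z i ω) = 0} ≠ 0 := by
  intro h0
  have h1 := hZ.laplace (A.indicator fun _ => ⊤) (measurable_const.indicator hA)
  have h2 : ∫⁻ z, (1 - ex (A.indicator (fun _ => ⊤) z)) ∂Λ = Λ A := by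
    rw [← lintegral_indicator_one hA]
    refine lintegral_congr fun z => ?_
    by_cases hz : z ∈ A <;> simp [hz]
  have h3 : ∫⁻ ω, ex (∑' i, A.indicator (fun _ => ⊤) (Z i ω)) ∂P = 0 := by
    rw [← lintegral_zero (μ := P)]
    refine lintegral_congr_ae ?_
    have h4 : ∀ᵐ ω ∂P, num A (fun i => Z i ω) ≠ 0 := by
      rw [ae_iff]
      simpa using h0
    filter_upwards [h4] with ω hω
    rw [Ne, num_eq_zero, not_forall] at hω
    obtain ⟨i, hi⟩ := hω
    have : ∑' i, A.indicator (fun _ => (⊤ : ℝ≥0∞)) (Z i ω) = ⊤ :=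
      ENNReal.tsum_eq_top_of_eq_top ⟨i, by simpa using hi⟩
    rw [this, ex_top]
  rw [h2, h3] at h1
  exact (ex_pos hfin).ne h1

/-- Events of positive probability that depend on disjoint regions occur together with positive
probability. -/
lemma IsPoisson.measure_forall_tsum_ne_zero [IsProbabilityMeasure P] {E : Type*}
    [MeasurableSpace E] {Z : ℕ → Ω → E} {Λ : Measure E} (hZ : IsPoisson P Z Λ) {ι : Type*}
    [Fintype ι] {A : ι → Set E} {h : ι → E → ℝ≥0∞} {S : ι → Set ℝ≥0∞}
    (hA : ∀ j, MeasurableSet (A j)) (hd : Pairwise (Function.onFun Disjoint A))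
    (hh : ∀ j, Measurable (h j)) (hS : ∀ j, MeasurableSet (S j))
    (h0 : ∀ j, P {ω | ∑' i, (A j).indicator (h j) (Z i ω) ∈ S j} ≠ 0) :
    P {ω | ∀ j, ∑' i, (A j).indicator (h j) (Z i ω) ∈ S j} ≠ 0 := by
  have hind := hZ.iIndepFun_tsum (f := fun j => (A j).indicator (h j))
    (fun j => (hh j).indicator (hA j)) fun i j z hij => by
      by_cases hz : z ∈ A i
      · exact Or.inr (Set.indicator_of_notMem (Set.disjoint_left.1 (hd hij) hz) _)
      · exact Or.inl (Set.indicator_of_notMem hz _)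
  have hprod := hind.measure_inter_preimage_eq_mul Finset.univ (sets := S) fun j _ => hS j
  have hset : {ω | ∀ j, ∑' i, (A j).indicator (h j) (Z i ω) ∈ S j} =
      ⋂ j ∈ Finset.univ, (fun ω => ∑' i, (A j).indicator (h j) (Z i ω)) ⁻¹' S j := by
    ext ω
    simp
  rw [hset, hprod]
  exact Finset.prod_ne_zero_iff.2 fun j _ => h0 j

variable [IsProbabilityMeasure P] {α : ℝ} {lam : ℝ≥0} {F : Measure ℝ}

lemma lintegral_one_sub_ex_power_ne_top (hα : 2 < α) (hF : IsFading α F) :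
    ∫⁻ z, (1 - ex (power α z)) ∂(intensity lam F) ≠ ⊤ := by
  have h := lintegral_one_sub_ex_power (lam := lam) hα hF one_pos
  simp only [ENNReal.ofReal_one, one_mul] at h
  rw [h]
  exact ENNReal.mul_ne_top ENNReal.ofReal_ne_top hF.moment

/-- Markov's inequality for `1 - e^{-power}`, which is integrable even though `power` need not be.
-/
lemma intensity_power_gt_ne_top (hα : 2 < α) (hF : IsFading α F) {η : ℝ≥0∞} (hη : 0 < η) :
    intensity lam F {z | η < power α z} ≠ ⊤ := by
  have h1 : 1 - ex η ≠ 0 := (tsub_pos_of_lt (by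
    rw [← ex_zero]
    exact ex_strictAnti hη)).ne'
  have h2 := mul_meas_ge_le_lintegral (μ := intensity lam F)
    (continuous_one_sub_ex.measurable.comp (measurable_power α)) (1 - ex η)
  intro htop
  have h3 : intensity lam F {z | 1 - ex η ≤ ((fun x => 1 - ex x) ∘ power α) z} = ⊤ :=
    top_unique (htop ▸ measure_mono fun z hz => one_sub_ex_mono (le_of_lt hz))
  rw [h3, ENNReal.mul_top h1] at h2
  exact lintegral_one_sub_ex_power_ne_top hα hF (top_unique h2)

/-- As `η → 0` the Laplace transform of the sum of the weak powers tends to `1`, whereas it would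
stay at most `e^{-ε}` if the sum exceeded `ε` almost surely. -/
lemma IsPoisson.exists_weak_tsum_le {Z : ℕ → Ω → Plane × ℝ} (hα : 2 < α) (hF : IsFading α F)
    (hZ : IsPoisson P Z (intensity lam F)) {ε : ℝ≥0∞} (hε : 0 < ε) :
    ∃ η : ℝ≥0∞, 0 < η ∧ P {ω | ∑' i, {z | power α z ≤ η}.indicator (power α) (Z i ω) ≤ ε} ≠ 0 := by
  set f : ℕ → Plane × ℝ → ℝ≥0∞ := fun n => {z | power α z ≤ (n + 1 : ℝ≥0∞)⁻¹}.indicator (power α)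
  have hinv : Tendsto (fun n : ℕ => (n + 1 : ℝ≥0∞)⁻¹) atTop (𝓝 0) := by
    have := ENNReal.tendsto_inv_nat_nhds_zero.comp (tendsto_add_atTop_nat 1)
    refine this.congr fun n => ?_
    simp
  have hf : ∀ n, Measurable (f n) := fun n =>
    (measurable_power α).indicator (measurableSet_le (measurable_power α) measurable_const)
  have hle : ∀ n z, f n z ≤ (n + 1 : ℝ≥0∞)⁻¹ := fun n z => by
    by_cases hz : power α z ≤ (n + 1 : ℝ≥0∞)⁻¹
    · exact (Set.indicator_le_self' (fun _ _ => zero_le) z).trans hz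
    · have hz0 : f n z = 0 :=
        Set.indicator_of_notMem (s := {z | power α z ≤ (n + 1 : ℝ≥0∞)⁻¹}) hz _
      rw [hz0]
      exact zero_le
  have hlim : Tendsto (fun n => ∫⁻ z, (1 - ex (f n z)) ∂(intensity lam F)) atTop (𝓝 0) := by
    rw [← lintegral_zero (μ := intensity lam F)]
    refine tendsto_lintegral_of_dominated_convergence (fun z => 1 - ex (power α z))
      (fun n => continuous_one_sub_ex.measurable.comp (hf n)) (fun n => Eventually.of_forall
        fun z => one_sub_ex_mono (Set.indicator_le_self' (fun _ _ => zero_le) z))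
      (lintegral_one_sub_ex_power_ne_top hα hF) (Eventually.of_forall fun z => ?_)
    have h1 : Tendsto (fun n => f n z) atTop (𝓝 0) :=
      tendsto_of_tendsto_of_tendsto_of_le_of_le tendsto_const_nhds hinv (fun n => zero_le)
        fun n => hle n z
    have h2 := (continuous_one_sub_ex.tendsto 0).comp h1
    rwa [ex_zero, tsub_self] at h2
  have hlim' := (continuous_ex.tendsto 0).comp hlim
  have hlt : ex ε < ex 0 := ex_strictAnti hε
  obtain ⟨n, hn⟩ := (hlim'.eventually (eventually_gt_nhds hlt)).exists
  refine ⟨(n + 1 : ℝ≥0∞)⁻¹, by simp, fun h0 => ?_⟩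
  have h1 : ∀ᵐ ω ∂P, ε < ∑' i, f n (Z i ω) := by
    rw [ae_iff]
    simp_rw [not_lt]
    exact h0
  rw [Function.comp, ← hZ.laplace (f n) (hf n)] at hn
  refine absurd hn (not_lt.2 ?_)
  calc ∫⁻ ω, ex (∑' i, f n (Z i ω)) ∂P ≤ ∫⁻ _, ex ε ∂P :=
        lintegral_mono_ae (h1.mono fun ω hω => ex_antitone hω.le)
    _ = ex ε := by simp

end Void

/-! ### Strict growth of the coverage event. -/

section Strict

variable {α θ : ℝ} {m : ℕ}

lemma total_le_of_indicator {z : ℕ → Plane × ℝ} {D : Set (Plane × ℝ)} {i j : ℕ}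
    (h : ∀ k, k ≠ i → k ≠ j → z k ∈ D) :
    total α z ≤ power α (z i) + power α (z j) + ∑' k, D.indicator (power α) (z k) := by
  have h1 : ∀ k, power α (z k) ≤ ((if k = i then power α (z i) else 0) +
      if k = j then power α (z j) else 0) + D.indicator (power α) (z k) := fun k => by
    by_cases hki : k = i
    · subst hki
      simp [add_assoc]
    · by_cases hkj : k = j
      · subst hkj
        simp [hki]
      · simp [hki, hkj, h k hki hkj]
  refine (ENNReal.tsum_le_tsum h1).trans_eq ?_
  rw [ENNReal.tsum_add, ENNReal.tsum_add, tsum_ite_eq, tsum_ite_eq]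

/-- The event that the closest point covers grows strictly with the order of the shift. -/
theorem IsPoisson.measure_shiftCovers_sdiff_ne_zero {Ω : Type*} [MeasurableSpace Ω] {P : Measure Ω}
    [IsProbabilityMeasure P] {Z : ℕ → Ω → Plane × ℝ} {lam : ℝ≥0} (hα : 2 < α) (hθ : 0 < θ)
    (hlam : 0 < lam) (hm : 1 ≤ m) (hZ : IsPoisson P Z (intensity lam (gammaMeasure 1 1))) :
    P {ω | ShiftCovers α θ (m + 1) (fun i => Z i ω) ∧ ¬ShiftCovers α θ m fun i => Z i ω} ≠ 0 := by
  have hpl := isPosLaw_gammaMeasure one_pos one_pos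
  have hF : IsFading α (gammaMeasure 1 1) := isFading_gammaMeasure hα one_pos one_pos
  have := hF.isProb
  set Λ := intensity lam (gammaMeasure 1 1) with hΛ
  obtain ⟨R, A, B, hA, hB, hA0, hB0, hAB⟩ := exists_dominant_boxes hα hm
    (L := 2 * θ + 1 / θ) (by positivity)
  set ε := min (1 / (4 * θ)) (θ / 4) with hε
  have hε0 : 0 < ε := lt_min (by positivity) (by positivity)
  have hε1 : θ * ε ≤ 1 / 4 := by
    calc θ * ε ≤ θ * (1 / (4 * θ)) := by gcongr; exact min_le_left _ _
      _ = 1 / 4 := by field_simp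
  obtain ⟨η, hη, hweak⟩ := hZ.exists_weak_tsum_le hα hF (ENNReal.ofReal_pos.2 hε0)
  have hball : MeasurableSet {z : Plane × ℝ | ‖z.1‖ < R} :=
    measurableSet_lt measurable_fst.norm measurable_const
  have hballfin : Λ {z | ‖z.1‖ < R} ≠ ⊤ := by
    have h1 : {z : Plane × ℝ | ‖z.1‖ < R} = Prod.fst ⁻¹' Metric.ball (0 : Plane) R := by
      ext z
      simp
    rw [h1, hΛ, intensity_fst_preimage]
    exact ENNReal.mul_ne_top ENNReal.coe_ne_top measure_ball_lt_top.ne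
  obtain ⟨p₀, hp₀, hp₀'⟩ := hA0
  obtain ⟨q₀, hq₀, hq₀'⟩ := hB0
  have hAfin : Λ A ≠ ⊤ := ne_top_of_le_ne_top hballfin
    (measure_mono fun p hp => (hAB p hp q₀ hq₀).1)
  have hBfin : Λ B ≠ ⊤ := ne_top_of_le_ne_top hballfin
    (measure_mono fun q hq => (hAB p₀ hp₀ q hq).2.1)
  have hdisj : ∀ z ∈ A, z ∉ B := fun z hzA hzB => lt_irrefl _ (hAB z hzA z hzB).2.2.1
  -- `V` collects the strong and the near points. Its intensity is finite, so apart from `A` and `B`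
  -- it can be empty with positive probability; only weak and far points then remain.
  set V : Set (Plane × ℝ) := {z | η < power α z} ∪ {z | ‖z.1‖ < R} with hV
  have hVm : MeasurableSet V :=
    (measurableSet_lt measurable_const (measurable_power α)).union hball
  have hVfin : Λ V ≠ ⊤ := ((measure_union_le _ _).trans_lt (ENNReal.add_lt_top.2
    ⟨(intensity_power_gt_ne_top hα hF hη).lt_top, hballfin.lt_top⟩)).ne
  set N : Set (Plane × ℝ) := (A ∪ B)ᶜ with hN
  have hNm : MeasurableSet N := (hA.measurableSet.union hB.measurableSet).compl
  set C := N ∩ V with hC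
  set D := N ∩ Vᶜ with hD
  have hCm : MeasurableSet C := hNm.inter hVm
  have hDm : MeasurableSet D := hNm.inter hVm.compl
  have hd01 : Disjoint A B := Set.disjoint_left.2 hdisj
  have hd02 : Disjoint A C := Set.disjoint_left.2 fun z hz hzC => hzC.1 (Or.inl hz)
  have hd03 : Disjoint A D := Set.disjoint_left.2 fun z hz hzD => hzD.1 (Or.inl hz)
  have hd12 : Disjoint B C := Set.disjoint_left.2 fun z hz hzC => hzC.1 (Or.inr hz)
  have hd13 : Disjoint B D := Set.disjoint_left.2 fun z hz hzD => hzD.1 (Or.inr hz)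
  have hd23 : Disjoint C D := Set.disjoint_left.2 fun z hz hzD => hzD.2 hz.2
  -- The four conditions concern disjoint regions and each has positive probability. Together they
  -- force a dominated configuration.
  have hne : P {ω | num A (fun i => Z i ω) = 1 ∧ num B (fun i => Z i ω) = 1 ∧
      num C (fun i => Z i ω) = 0 ∧
      ∑' i, D.indicator (power α) (Z i ω) ≤ ENNReal.ofReal ε} ≠ 0 := by
    have h4 := hZ.measure_forall_tsum_ne_zero (A := ![A, B, C, D])
      (h := ![fun _ => 1, fun _ => 1, fun _ => 1, power α])
      (S := ![{1}, {1}, {0}, Set.Iic (ENNReal.ofReal ε)]) ?_ ?_ ?_ ?_ ?_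
    · refine fun h0 => h4 (measure_mono_null (fun ω hω => ?_) h0)
      exact ⟨hω 0, hω 1, hω 2, hω 3⟩
    · intro j
      fin_cases j
      exacts [hA.measurableSet, hB.measurableSet, hCm, hDm]
    · intro i j hij
      fin_cases i <;> fin_cases j <;>
        first
        | exact absurd rfl hij
        | exact hd01
        | exact hd02
        | exact hd03
        | exact hd12
        | exact hd13
        | exact hd23
        | exact hd01.symm
        | exact hd02.symm
        | exact hd03.symm
        | exact hd12.symm
        | exact hd13.symm
        | exact hd23.symm
    · intro j
      fin_cases j
      exacts [measurable_const, measurable_const, measurable_const, measurable_power α]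
    · intro j
      fin_cases j
      exacts [measurableSet_singleton _, measurableSet_singleton _, measurableSet_singleton _,
        measurableSet_Iic]
    · intro j
      fin_cases j
      · exact hZ.measure_num_eq_one_pos hA.measurableSet
          (intensity_pos hlam hpl hA ⟨p₀, hp₀, hp₀'⟩) hAfin
      · exact hZ.measure_num_eq_one_pos hB.measurableSet
          (intensity_pos hlam hpl hB ⟨q₀, hq₀, hq₀'⟩) hBfin
      · exact hZ.measure_num_eq_zero_ne_zero hCm
          (ne_top_of_le_ne_top hVfin (measure_mono Set.inter_subset_right))
      · refine fun h0 => hweak (measure_mono_null (fun ω hω => ?_) h0)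
        refine le_trans (ENNReal.tsum_le_tsum fun i => ?_) hω
        refine Set.indicator_le_indicator_of_subset (fun z hz => ?_) (fun _ => zero_le) _
        exact (not_lt (a := η)).1 fun h => hz.2 (Or.inl h)
  refine fun h0 => hne (measure_mono_null (fun ω hω => ?_)
    (measure_union_null h0 (ae_iff.1 (hZ.ae_isGood hα hlam hF))))
  refine or_iff_not_imp_right.2 fun hg' => ?_
  have hg : IsGood α fun i => Z i ω := not_not.1 hg'
  obtain ⟨e1, e2, e3, e4⟩ := hω
  obtain ⟨i, hi⟩ := one_le_num.1 e1.ge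
  obtain ⟨j, hj⟩ := one_le_num.1 e2.ge
  have hij : i ≠ j := by
    rintro rfl
    exact hdisj _ hi hj
  have hrest : ∀ k, k ≠ i → k ≠ j → Z k ω ∈ D := fun k hki hkj => by
    have hkA : Z k ω ∉ A := fun hk => by
      have h2 := two_le_num (z := fun i => Z i ω) hki hk hi
      rw [e1] at h2
      exact absurd h2 (by norm_num)
    have hkB : Z k ω ∉ B := fun hk => by
      have h2 := two_le_num (z := fun i => Z i ω) hkj hk hj
      rw [e2] at h2
      exact absurd h2 (by norm_num)
    have hkN : Z k ω ∈ N := fun h => h.elim hkA hkB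
    exact ⟨hkN, fun hkV => num_eq_zero.1 e3 k ⟨hkN, hkV⟩⟩
  obtain ⟨d1, -, -, d4, d5, d6, d7⟩ := hAB _ hi _ hj
  refine shiftCovers_of_dominant hα hθ hm hg hij hε0.le hε1 (min_le_right _ _) d4 d5 d6 d7
    (fun k hki hkj => ?_) ((total_le_of_indicator hrest).trans (by gcongr))
  refine d1.trans_le (not_lt.1 fun hk => (hrest k hki hkj).2 (Or.inr hk))

end Strict

/-! ### The Mecke formula. -/

section Mecke

variable {Ω E : Type*} [MeasurableSpace Ω] [MeasurableSpace E] {P : Measure Ω}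
  [IsProbabilityMeasure P] {Z : ℕ → Ω → E} {Λ : Measure E}

lemma linForm_fin_two (c : Fin 2 →₀ ℕ) (x y : ℝ≥0∞) : linForm c ![x, y] = c 0 * x + c 1 * y := by
  rw [linForm, Finsupp.sum_fintype _ _ (by simp)]
  simp

lemma measurable_vec_two {X : Type*} [MeasurableSpace X] {a b : X → ℝ≥0∞} (ha : Measurable a)
    (hb : Measurable b) : Measurable fun x => ![a x, b x] :=
  measurable_pi_iff.2 fun i => by
    fin_cases i
    exacts [ha, hb]

/-- As functionals of `Φ` both sides are measures on `[0, ∞]²`, finite since `∫ f` is. The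
derivative of the Laplace functional shows that their Laplace transforms agree, so the measures do.
-/
lemma IsPoisson.mecke_of_lintegral_ne_top [SFinite Λ] (hZ : IsPoisson P Z Λ) {f u v : E → ℝ≥0∞}
    (hf : Measurable f) (hu : Measurable u) (hv : Measurable v) (hfin : ∫⁻ z, f z ∂Λ ≠ ⊤)
    {Φ : (Fin 2 → ℝ≥0∞) → ℝ≥0∞} (hΦ : Measurable Φ) :
    ∫⁻ ω, ∑' i, f (Z i ω) * Φ ![u (Z i ω), ∑' j, v (Z j ω)] ∂P =
      ∫⁻ z, f z * ∫⁻ ω, Φ ![u z, v z + ∑' j, v (Z j ω)] ∂P ∂Λ := by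
  set T : Ω → ℝ≥0∞ := fun ω => ∑' j, v (Z j ω) with hT
  have hTm : Measurable T := hZ.measurable_tsum hv
  have hfZ : ∀ i, Measurable fun ω => f (Z i ω) := fun i => hf.comp (hZ.measurable i)
  have hL : ∀ i, Measurable fun ω => ![u (Z i ω), T ω] := fun i =>
    measurable_vec_two (hu.comp (hZ.measurable i)) hTm
  have hR : Measurable fun q : E × Ω => ![u q.1, v q.1 + T q.2] :=
    measurable_vec_two (hu.comp measurable_fst) ((hv.comp measurable_fst).add (hTm.comp measurable_snd))
  set μ : Measure (Fin 2 → ℝ≥0∞) := Measure.sum fun i =>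
    (P.withDensity fun ω => f (Z i ω)).map fun ω => ![u (Z i ω), T ω] with hμ
  set ν : Measure (Fin 2 → ℝ≥0∞) :=
    ((Λ.withDensity f).prod P).map fun q => ![u q.1, v q.1 + T q.2] with hν
  have hμΦ : ∀ {Φ : (Fin 2 → ℝ≥0∞) → ℝ≥0∞}, Measurable Φ →
      ∫⁻ y, Φ y ∂μ = ∫⁻ ω, ∑' i, f (Z i ω) * Φ ![u (Z i ω), T ω] ∂P := fun {Φ} hΦ => by
    rw [hμ, lintegral_sum_measure, lintegral_tsum fun i =>
      ((hfZ i).fun_mul (hΦ.fun_comp (hL i))).aemeasurable]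
    refine tsum_congr fun i => ?_
    rw [lintegral_map hΦ (hL i)]
    exact lintegral_withDensity_eq_lintegral_mul _ (hfZ i) (hΦ.comp (hL i))
  have hνΦ : ∀ {Φ : (Fin 2 → ℝ≥0∞) → ℝ≥0∞}, Measurable Φ →
      ∫⁻ y, Φ y ∂ν = ∫⁻ z, f z * ∫⁻ ω, Φ ![u z, v z + T ω] ∂P ∂Λ := fun {Φ} hΦ => by
    rw [hν, lintegral_map hΦ hR, lintegral_prod _ (hΦ.fun_comp hR).aemeasurable]
    exact lintegral_withDensity_eq_lintegral_mul _ hf (hΦ.comp hR).lintegral_prod_right'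
  have hlap : ∀ c, ∫⁻ y, ex (linForm c y) ∂μ = ∫⁻ y, ex (linForm c y) ∂ν := fun c => by
    have h1 := hZ.lintegral_tsum_mul_ex (f := fun z => f z * ex (c 0 * u z))
      (v := fun z => c 1 * v z) (hf.mul (measurable_ex.comp (hu.const_mul _))) (hv.const_mul _)
    rw [hμΦ (measurable_ex_linForm c), hνΦ (measurable_ex_linForm c)]
    simp_rw [linForm_fin_two, ex_add]
    refine Eq.trans (lintegral_congr fun ω => ?_) (h1.trans ?_)
    · rw [ENNReal.tsum_mul_left, ← ENNReal.tsum_mul_right]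
      refine tsum_congr fun i => ?_
      rw [mul_assoc]
    · rw [← hZ.laplace (fun z => c 1 * v z) (hv.const_mul _), ← lintegral_mul_const _
        ((hf.fun_mul (measurable_ex.fun_comp (hu.const_mul _))).fun_mul
          (measurable_ex.fun_comp (hv.const_mul _)))]
      refine lintegral_congr fun z => ?_
      rw [mul_assoc, mul_assoc]
      congr 1
      rw [← mul_assoc, ← lintegral_const_mul _ (measurable_ex.fun_comp
        ((hZ.measurable_tsum (hv.const_mul _))))]
      refine lintegral_congr fun ω => ?_
      rw [mul_add, ex_add, ENNReal.tsum_mul_left, mul_assoc]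
  have huniv : ∀ {ρ : Measure (Fin 2 → ℝ≥0∞)}, ∫⁻ y, ex (linForm 0 y) ∂ρ = ρ Set.univ := by
    intro ρ
    simp [linForm]
  have hνfin : IsFiniteMeasure ν := ⟨by
    rw [← huniv, hνΦ (measurable_ex_linForm 0)]
    refine lt_of_le_of_lt (lintegral_mono fun z => ?_) hfin.lt_top
    refine (mul_le_mul_right ((lintegral_mono fun ω => ex_le_one _).trans_eq ?_) _).trans_eq
      (mul_one _)
    simp⟩
  have hμfin : IsFiniteMeasure μ := ⟨by
    rw [← huniv, hlap, huniv]
    exact measure_lt_top _ _⟩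
  rw [← hμΦ hΦ, ← hνΦ hΦ, measure_eq_of_laplace hlap]

/-- The Mecke formula for functions of a point and of a sum over the process. -/
theorem IsPoisson.mecke [SigmaFinite Λ] (hZ : IsPoisson P Z Λ) {u v : E → ℝ≥0∞}
    (hu : Measurable u) (hv : Measurable v)
    {Φ : (Fin 2 → ℝ≥0∞) → ℝ≥0∞} (hΦ : Measurable Φ) :
    ∫⁻ ω, ∑' i, Φ ![u (Z i ω), ∑' j, v (Z j ω)] ∂P =
      ∫⁻ z, ∫⁻ ω, Φ ![u z, v z + ∑' j, v (Z j ω)] ∂P ∂Λ := by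
  have hTm : Measurable fun ω => ∑' j, v (Z j ω) := hZ.measurable_tsum hv
  -- The finite-mass case is applied with `f` the indicator of each piece of a countable partition
  -- into sets of finite intensity.
  set A : ℕ → Set E := disjointed (spanningSets Λ) with hA
  have hAm : ∀ n, MeasurableSet (A n) := MeasurableSet.disjointed (measurableSet_spanningSets Λ)
  have hsum : ∀ z, ∑' n, (A n).indicator (1 : E → ℝ≥0∞) z = 1 := fun z => by
    have hz : z ∈ ⋃ n, A n := by
      rw [hA, iUnion_disjointed, iUnion_spanningSets]
      exact Set.mem_univ z
    obtain ⟨n, hn⟩ := Set.mem_iUnion.1 hz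
    rw [tsum_eq_single n fun k hk => Set.indicator_of_notMem
      (Set.disjoint_left.1 (disjoint_disjointed _ hk.symm) hn) _]
    exact Set.indicator_of_mem hn _
  have hfin : ∀ n, ∫⁻ z, (A n).indicator (1 : E → ℝ≥0∞) z ∂Λ ≠ ⊤ := fun n => by
    rw [lintegral_indicator_one (hAm n)]
    exact ((measure_mono (disjointed_subset _ n)).trans_lt
      (measure_spanningSets_lt_top Λ n)).ne
  have hind : ∀ n, Measurable ((A n).indicator (1 : E → ℝ≥0∞)) := fun n =>
    measurable_one.indicator (hAm n)
  have hR : Measurable fun q : E × Ω => Φ ![u q.1, v q.1 + ∑' j, v (Z j q.2)] :=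
    hΦ.comp (measurable_vec_two (hu.comp measurable_fst)
      ((hv.comp measurable_fst).add (hTm.comp measurable_snd)))
  calc ∫⁻ ω, ∑' i, Φ ![u (Z i ω), ∑' j, v (Z j ω)] ∂P
      = ∫⁻ ω, ∑' n, ∑' i, (A n).indicator (1 : E → ℝ≥0∞) (Z i ω) *
          Φ ![u (Z i ω), ∑' j, v (Z j ω)] ∂P := by
        refine lintegral_congr fun ω => ?_
        rw [ENNReal.tsum_comm]
        refine tsum_congr fun i => ?_
        rw [ENNReal.tsum_mul_right, hsum, one_mul]
    _ = ∑' n, ∫⁻ ω, ∑' i, (A n).indicator (1 : E → ℝ≥0∞) (Z i ω) *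
          Φ ![u (Z i ω), ∑' j, v (Z j ω)] ∂P :=
        lintegral_tsum fun n => (Measurable.tsum fun i => ((hind n).comp (hZ.measurable i)).mul
          (hΦ.comp (measurable_vec_two (hu.comp (hZ.measurable i)) hTm))).aemeasurable
    _ = ∑' n, ∫⁻ z, (A n).indicator (1 : E → ℝ≥0∞) z *
          ∫⁻ ω, Φ ![u z, v z + ∑' j, v (Z j ω)] ∂P ∂Λ :=
        tsum_congr fun n => hZ.mecke_of_lintegral_ne_top (hind n) hu hv (hfin n) hΦ
    _ = ∫⁻ z, ∑' n, (A n).indicator (1 : E → ℝ≥0∞) z *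
          ∫⁻ ω, Φ ![u z, v z + ∑' j, v (Z j ω)] ∂P ∂Λ :=
        (lintegral_tsum fun n => ((hind n).mul hR.lintegral_prod_right').aemeasurable).symm
    _ = ∫⁻ z, ∫⁻ ω, Φ ![u z, v z + ∑' j, v (Z j ω)] ∂P ∂Λ := by
        refine lintegral_congr fun z => ?_
        rw [ENNReal.tsum_mul_right, hsum, one_mul]

end Mecke

/-! ### The closed form for `θ ≥ 1`. -/

section ClosedForm

variable {α θ : ℝ} {lam : ℝ≥0}

/-- If `1 ≤ θ`, at most one point is covering. -/
lemma IsCovering.unique (hθ : 1 ≤ θ) {z : ℕ → Plane × ℝ} {i k : ℕ}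
    (hi : IsCovering α θ z i) (hk : IsCovering α θ z k) : i = k := by
  by_contra hik
  have h1 : power α (z i) + power α (z k) ≤ total α z := by
    rw [← Finset.sum_pair (f := fun k => power α (z k)) hik]
    exact ENNReal.sum_le_tsum _
  -- Two covering points would give `2 θ T < (1 + θ) T` for the total power `T`, but `1 + θ ≤ 2 θ`.
  have h2 : ENNReal.ofReal θ * total α z + ENNReal.ofReal θ * total α z <
      ENNReal.ofReal (1 + θ) * power α (z i) + ENNReal.ofReal (1 + θ) * power α (z k) :=
    ENNReal.add_lt_add hi hk
  rw [← mul_add, ← mul_add, ← two_mul, mul_left_comm, ← mul_assoc] at h2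
  refine absurd (h2.trans_le (mul_le_mul_right h1 _)) (not_lt.2 (mul_le_mul_left ?_ _))
  rw [show (2 : ℝ≥0∞) = ENNReal.ofReal 2 by simp, ← ENNReal.ofReal_mul zero_le_two]
  exact ENNReal.ofReal_le_ofReal (by linarith)

/-- The points and total powers for which the point is covering. -/
def covSet (θ : ℝ) : Set (Fin 2 → ℝ≥0∞) :=
  {y | ENNReal.ofReal θ * y 1 < ENNReal.ofReal (1 + θ) * y 0}

lemma measurableSet_covSet (θ : ℝ) : MeasurableSet (covSet θ) :=
  measurableSet_lt ((measurable_pi_apply 1).const_mul _) ((measurable_pi_apply 0).const_mul _)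

lemma gammaMeasure_one_Ioi {t : ℝ} (ht : 0 ≤ t) :
    gammaMeasure 1 1 (Set.Ioi t) = ENNReal.ofReal (Real.exp (-t)) := by
  have := isProbabilityMeasure_gammaMeasure one_pos one_pos
  have h1 : cdf (gammaMeasure 1 1) t = 1 - Real.exp (-t) := by
    have h := cdf_expMeasure_eq one_pos t
    rwa [if_pos ht, one_mul] at h
  rw [← Set.compl_Iic, prob_compl_eq_one_sub measurableSet_Iic, ← ofReal_cdf, h1,
    ← ENNReal.ofReal_one, ← ENNReal.ofReal_sub _ (by simpa using ht)]
  congr 1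
  ring

/-- The exponential tail turns the probability of exceeding a threshold into `e^{-·}` of that
threshold, so that averaging over the interference yields a Laplace functional. -/
lemma gammaMeasure_one_lt_power {x : Plane} (hx : 0 < ‖x‖) (c : ℝ≥0∞) :
    gammaMeasure 1 1 {y | c < power α (x, y)} = ex (ENNReal.ofReal (‖x‖ ^ α) * c) := by
  have hxα : 0 < ‖x‖ ^ α := by positivity
  rcases eq_or_ne c ⊤ with rfl | hc
  · rw [ENNReal.mul_top (ENNReal.ofReal_pos.2 hxα).ne', ex_top]
    simp
  · obtain ⟨t, ht, rfl⟩ : ∃ t : ℝ, 0 ≤ t ∧ ENNReal.ofReal t = c :=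
      ⟨c.toReal, ENNReal.toReal_nonneg, ENNReal.ofReal_toReal hc⟩
    rw [← ENNReal.ofReal_mul hxα.le, ex_ofReal (by positivity),
      ← gammaMeasure_one_Ioi (by positivity)]
    refine measure_congr (eventuallyEq_set.2 ?_)
    filter_upwards [ae_pos_gammaMeasure one_pos one_pos] with y hy
    change ENNReal.ofReal t < power α (x, y) ↔ ‖x‖ ^ α * t < y
    rw [power_of_pos hx hy, ENNReal.ofReal_lt_ofReal_iff_of_nonneg ht,
      Real.rpow_neg hx.le, ← div_eq_mul_inv, lt_div_iff₀ hxα, mul_comm]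

lemma lintegral_gaussian_plane {b : ℝ} (hb : 0 < b) :
    ∫⁻ x : Plane, ENNReal.ofReal (Real.exp (-b * ‖x‖ ^ 2)) = ENNReal.ofReal (Real.pi / b) := by
  have h := GaussianFourier.integral_rexp_neg_mul_sq_norm (V := Plane) hb
  rw [finrank_euclideanSpace_fin, Nat.cast_ofNat, div_self two_ne_zero, Real.rpow_one] at h
  rw [← ofReal_integral_eq_lintegral_ofReal _ (ae_of_all _ fun x => (Real.exp_pos _).le), h]
  -- Without integrability the Bochner integral would be `0`, but it equals `π / b > 0`.
  by_contra hcon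
  rw [integral_undef hcon] at h
  exact (div_pos Real.pi_pos hb).ne h

section

variable {Ω : Type*} [MeasurableSpace Ω] {P : Measure Ω} [IsProbabilityMeasure P]
  {Z : ℕ → Ω → Plane × ℝ}

/-- The probability that an additional point at `x` is covering, averaged over its gain. -/
lemma IsPoisson.lintegral_measure_lt_power (hα : 2 < α) (hθ : 0 < θ)
    (hZ : IsPoisson P Z (intensity lam (gammaMeasure 1 1))) {x : Plane} (hx : 0 < ‖x‖) :
    ∫⁻ y, P {ω | ENNReal.ofReal θ * ∑' j, power α (Z j ω) < power α (x, y)} ∂(gammaMeasure 1 1) =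
      ENNReal.ofReal (Real.exp (-(lam * (Real.pi * Real.Gamma (1 - 2 / α)) *
        Real.Gamma (1 + 2 / α) * θ ^ (2 / α)) * ‖x‖ ^ 2)) := by
  have hF : IsFading α (gammaMeasure 1 1) := isFading_gammaMeasure hα one_pos one_pos
  have := hF.isProb
  have hα0 : 0 < α := by linarith
  have hδ : 2 / α < 1 := by rw [div_lt_one hα0]; exact hα
  have hG1 : 0 < Real.Gamma (1 - 2 / α) := Real.Gamma_pos_of_pos (by linarith)
  have hG2 : 0 < Real.Gamma (1 + 2 / α) := Real.Gamma_pos_of_pos (by positivity)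
  have hpm := measurable_power α
  set S : Set (ℝ × Ω) := {q | ENNReal.ofReal θ * ∑' j, power α (Z j q.2) < power α (x, q.1)} with hS
  have hSm : MeasurableSet S :=
    measurableSet_lt (((hZ.measurable_tsum hpm).comp measurable_snd).const_mul _)
      (hpm.comp (measurable_const.prodMk measurable_fst))
  have h1 : ∀ ω, gammaMeasure 1 1 ((fun y => (y, ω)) ⁻¹' S) =
      ex (∑' j, ENNReal.ofReal (‖x‖ ^ α * θ) * power α (Z j ω)) := fun ω => by
    rw [ENNReal.tsum_mul_left, ENNReal.ofReal_mul (by positivity), mul_assoc,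
      ← gammaMeasure_one_lt_power hx]
    rfl
  calc ∫⁻ y, P {ω | ENNReal.ofReal θ * ∑' j, power α (Z j ω) < power α (x, y)}
        ∂(gammaMeasure 1 1) = ((gammaMeasure 1 1).prod P) S := (Measure.prod_apply hSm).symm
    _ = ∫⁻ ω, ex (∑' j, ENNReal.ofReal (‖x‖ ^ α * θ) * power α (Z j ω)) ∂P := by
        rw [Measure.prod_apply_symm hSm, lintegral_congr h1]
    _ = _ := by
        rw [hZ.laplace (fun z => ENNReal.ofReal (‖x‖ ^ α * θ) * power α z) (hpm.const_mul _),
          lintegral_one_sub_ex_power hα hF (by positivity),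
          lintegral_rpow_gammaMeasure one_pos one_pos (by positivity),
          ← ENNReal.ofReal_mul (by positivity), gammaMoment, Real.Gamma_one,
          Real.one_rpow, mul_one, div_one, ex_ofReal (by positivity)]
        congr 2
        rw [Real.mul_rpow (by positivity) hθ.le, ← Real.rpow_mul hx.le,
          mul_div_cancel₀ _ hα0.ne', Real.rpow_two]
        ring

/-- The mean number of covering points under Rayleigh fading. -/
lemma IsPoisson.lintegral_tsum_covSet (hα : 2 < α) (hθ : 0 < θ) (hlam : 0 < lam)
    (hZ : IsPoisson P Z (intensity lam (gammaMeasure 1 1))) :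
    ∫⁻ ω, ∑' i, (covSet θ).indicator 1 ![power α (Z i ω), ∑' j, power α (Z j ω)] ∂P =
      ENNReal.ofReal (1 / (Real.Gamma (1 - 2 / α) * Real.Gamma (1 + 2 / α) * θ ^ (2 / α))) := by
  have := isProbabilityMeasure_gammaMeasure one_pos one_pos
  have hα0 : 0 < α := by linarith
  have hl : (0 : ℝ) < lam := hlam
  have hδ : 2 / α < 1 := by rw [div_lt_one hα0]; exact hα
  have hG1 : 0 < Real.Gamma (1 - 2 / α) := Real.Gamma_pos_of_pos (by linarith)
  have hG2 : 0 < Real.Gamma (1 + 2 / α) := Real.Gamma_pos_of_pos (by positivity)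
  have hpm := measurable_power α
  have hTm : Measurable fun ω => ∑' j, power α (Z j ω) := hZ.measurable_tsum hpm
  have : SigmaFinite (intensity lam (gammaMeasure 1 1)) := by
    unfold intensity
    infer_instance
  have h1 : ∀ᵐ z ∂(intensity lam (gammaMeasure 1 1)),
      ∫⁻ ω, (covSet θ).indicator (1 : (Fin 2 → ℝ≥0∞) → ℝ≥0∞)
        ![power α z, power α z + ∑' j, power α (Z j ω)] ∂P =
      P {ω | ENNReal.ofReal θ * ∑' j, power α (Z j ω) < power α z} := by
    -- The Mecke formula adds the point `z` to the total. Its own contribution cancels, and the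
    -- other points act as interference.
    filter_upwards [ae_intensity_fst (p := fun x => 0 < ‖x‖) (by simp [ae_iff])] with z hz
    have hzt : power α z ≠ ⊤ := power_ne_top (z := fun _ => z) (fun _ => hz) 0
    rw [← lintegral_indicator_one (measurableSet_lt (hTm.const_mul _) measurable_const)]
    refine lintegral_congr fun ω => ?_
    refine Set.indicator_eq_indicator ?_ rfl
    change ENNReal.ofReal θ * (power α z + ∑' j, power α (Z j ω)) <
      ENNReal.ofReal (1 + θ) * power α z ↔ ENNReal.ofReal θ * ∑' j, power α (Z j ω) < power α z
    rw [mul_add, ENNReal.ofReal_add zero_le_one hθ.le, ENNReal.ofReal_one, add_mul, one_mul,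
      add_comm (power α z), ENNReal.add_lt_add_iff_left
      (ENNReal.mul_ne_top ENNReal.ofReal_ne_top hzt)]
  have hm : Measurable fun z => P {ω | ENNReal.ofReal θ * ∑' j, power α (Z j ω) < power α z} :=
    measurable_measure_prodMk_left (measurableSet_lt ((hTm.comp measurable_snd).const_mul _)
      (hpm.comp measurable_fst))
  have h2 : ∀ᵐ x : Plane, ∫⁻ y, P {ω | ENNReal.ofReal θ * ∑' j, power α (Z j ω) < power α (x, y)}
      ∂(gammaMeasure 1 1) = ENNReal.ofReal (Real.exp (-(lam * (Real.pi * Real.Gamma (1 - 2 / α)) *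
        Real.Gamma (1 + 2 / α) * θ ^ (2 / α)) * ‖x‖ ^ 2)) := by
    have h0 : ∀ᵐ x : Plane, 0 < ‖x‖ := by simp [ae_iff]
    filter_upwards [h0] with x hx using hZ.lintegral_measure_lt_power hα hθ hx
  -- Integrating out the gain leaves a Gaussian in the location whose integral is inversely
  -- proportional to `lam`, so the density cancels.
  rw [hZ.mecke hpm hpm (measurable_one.indicator (measurableSet_covSet θ)),
    lintegral_congr_ae h1, intensity, lintegral_prod _ hm.aemeasurable,
    lintegral_smul_measure, lintegral_congr_ae h2, lintegral_gaussian_plane (by positivity),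
    ENNReal.smul_def, smul_eq_mul, ← ENNReal.ofReal_coe_nnreal,
    ← ENNReal.ofReal_mul lam.coe_nonneg]
  congr 1
  field_simp

end

/-- The probability that some point covers, for `1 ≤ θ`. -/
theorem IsPoisson.measure_exists_isCovering {Ω : Type*} [MeasurableSpace Ω] {P : Measure Ω}
    [IsProbabilityMeasure P] {Z : ℕ → Ω → Plane × ℝ} (hα : 2 < α) (hθ : 1 ≤ θ) (hlam : 0 < lam)
    (hZ : IsPoisson P Z (intensity lam (gammaMeasure 1 1))) :
    P {ω | ∃ i, IsCovering α θ (fun i => Z i ω) i} =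
      ENNReal.ofReal (1 / (Real.Gamma (1 - 2 / α) * Real.Gamma (1 + 2 / α) * θ ^ (2 / α))) := by
  have hm : ∀ i, MeasurableSet {ω | IsCovering α θ (fun i => Z i ω) i} := fun i =>
    measurableSet_lt ((hZ.measurable_tsum (measurable_power α)).const_mul _)
      (((measurable_power α).comp (hZ.measurable i)).const_mul _)
  have hset : {ω | ∃ i, IsCovering α θ (fun i => Z i ω) i} =
      ⋃ i, {ω | IsCovering α θ (fun i => Z i ω) i} := by
    ext ω
    simp
  have hdisj : Pairwise (Function.onFun Disjoint
      fun i => {ω | IsCovering α θ (fun i => Z i ω) i}) := fun i k hik =>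
    Set.disjoint_left.2 fun ω (hi : IsCovering α θ (fun i => Z i ω) i) hk =>
      hik (IsCovering.unique hθ hi hk)
  have hc : ∀ i, Measurable fun ω => (covSet θ).indicator (1 : (Fin 2 → ℝ≥0∞) → ℝ≥0∞)
      ![power α (Z i ω), ∑' j, power α (Z j ω)] := fun i =>
    (measurable_one.indicator (measurableSet_covSet θ)).comp (measurable_vec_two
      ((measurable_power α).comp (hZ.measurable i)) (hZ.measurable_tsum (measurable_power α)))
  rw [hset, measure_iUnion hdisj hm,
    ← hZ.lintegral_tsum_covSet hα (by linarith) hlam, lintegral_tsum fun i => (hc i).aemeasurable]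
  refine tsum_congr fun i => ?_
  rw [← lintegral_indicator_one (hm i)]
  rfl

/-- The functional equation `Γ(1 - δ) = -δ Γ(-δ)` at `δ = 2/α`. -/
lemma two_mul_zetaCoeff_one (hα : 2 < α) :
    2 * zetaCoeff α 1 = Real.Gamma (1 - 2 / α) * Real.Gamma (1 + 2 / α) := by
  have hα0 : α ≠ 0 := by linarith
  have h := Real.Gamma_add_one (s := -(2 / α)) (neg_ne_zero.2 (by positivity))
  rw [neg_add_eq_sub] at h
  rw [zetaCoeff, h, Real.Gamma_one]
  field_simp

end ClosedForm

/-! ### Coverage probabilities through the coupling. -/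

section Coverage

variable {α θ : ℝ} {lam : ℝ≥0} {F : Measure ℝ} {m : ℕ}

lemma isFading_losFading (hα : 2 < α) (hm : 1 ≤ m) : IsFading α (losFading m) := by
  have hm' : (0 : ℝ) < m := by exact_mod_cast hm
  exact isFading_gammaMeasure hα hm' hm'

lemma nlosFading_eq : nlosFading = gammaMeasure 1 1 := rfl

lemma losFading_one : losFading 1 = nlosFading := by
  rw [losFading, nlosFading_eq, Nat.cast_one]

lemma isFading_nlosFading (hα : 2 < α) : IsFading α nlosFading :=
  isFading_gammaMeasure hα one_pos one_pos

section

variable {Ω : Type*} [MeasurableSpace Ω] {P : Measure Ω} [IsProbabilityMeasure P]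
  {X : ℕ → Ω → Plane} {g : ℕ → Ω → ℝ}

lemma IsNetwork.isPoisson_intensity (hF : IsFading α F) (h : IsNetwork P X g lam F) :
    IsPoisson P (fun i ω => (X i ω, g i ω)) (intensity lam F) := by
  have := hF.isProb
  exact h.isPoisson

lemma IsNetwork.coverageClosest_eq (hα : 2 < α) (hθ : 0 < θ) (hlam : 0 < lam)
    (hF : IsFading α F) (h : IsNetwork P X g lam F) :
    coverageClosest P X g α θ = P.real {ω | ClosestCovers α θ fun i => (X i ω, g i ω)} := by
  refine measureReal_congr (eventuallyEq_set.2 ?_)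
  filter_upwards [(h.isPoisson_intensity hF).ae_isGood hα hlam hF] with ω hω
  exact exists_lt_sir_closest_iff hθ hω

lemma IsNetwork.coverageStrongest_eq (hα : 2 < α) (hθ : 0 < θ) (hlam : 0 < lam)
    (hF : IsFading α F) (h : IsNetwork P X g lam F) :
    coverageStrongest P X g α θ =
      P.real {ω | ∃ i, IsCovering α θ (fun i => (X i ω, g i ω)) i} := by
  refine measureReal_congr (eventuallyEq_set.2 ?_)
  filter_upwards [(h.isPoisson_intensity hF).ae_isGood hα hlam hF] with ω hω
  exact exists_lt_sir_strongest_iff hθ hω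

variable {Ω' : Type*} [MeasurableSpace Ω'] {P' : Measure Ω'} [IsProbabilityMeasure P']
  {X' : ℕ → Ω' → Plane} {g' : ℕ → Ω' → ℝ}

lemma IsNetwork.coverageClosest_congr (hα : 2 < α) (hθ : 0 < θ) (hlam : 0 < lam)
    (hF : IsFading α F) (h : IsNetwork P X g lam F) (h' : IsNetwork P' X' g' lam F) :
    coverageClosest P X g α θ = coverageClosest P' X' g' α θ := by
  rw [h.coverageClosest_eq hα hθ hlam hF, h'.coverageClosest_eq hα hθ hlam hF, measureReal_def,
    measureReal_def, (h.isPoisson_intensity hF).measure_closestCovers_eq hα hlam hF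
    (h'.isPoisson_intensity hF)]

end

section Coupling

variable {Ω : Type*} [MeasurableSpace Ω] {P : Measure Ω} [IsProbabilityMeasure P]
  {Z : ℕ → Ω → Plane × ℝ}

lemma IsPoisson.shiftCovers_ae_eq (hα : 2 < α) (hlam : 0 < lam) (hm : 1 ≤ m)
    (hZ : IsPoisson P Z (intensity lam (gammaMeasure 1 1))) :
    {ω | ClosestCovers α θ fun i => shift α m (Z i ω)} =ᵐ[P]
      {ω | ShiftCovers α θ m fun i => Z i ω} := by
  refine eventuallyEq_set.2 ?_
  filter_upwards [hZ.ae_isGood hα hlam (isFading_gammaMeasure hα one_pos one_pos)] with ω hω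
  exact closestCovers_shift_iff hα hm hω

lemma IsPoisson.nullMeasurableSet_shiftCovers (hα : 2 < α) (hlam : 0 < lam) (hm : 1 ≤ m)
    (hZ : IsPoisson P Z (intensity lam (gammaMeasure 1 1))) :
    NullMeasurableSet {ω | ShiftCovers α θ m fun i => Z i ω} P :=
  ((hZ.isPoisson_shift hα hm).nullMeasurableSet_closestCovers hα hlam (isFading_losFading hα hm)).congr
    (hZ.shiftCovers_ae_eq hα hlam hm)

lemma IsPoisson.measureReal_shiftCovers_lt (hα : 2 < α) (hθ : 0 < θ) (hlam : 0 < lam)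
    (hm : 1 ≤ m) (hZ : IsPoisson P Z (intensity lam (gammaMeasure 1 1))) :
    P.real {ω | ShiftCovers α θ m fun i => Z i ω} <
      P.real {ω | ShiftCovers α θ (m + 1) fun i => Z i ω} := by
  set A := {ω | ShiftCovers α θ m fun i => Z i ω}
  set B := {ω | ShiftCovers α θ (m + 1) fun i => Z i ω}
  -- Only up to a null set is `A` contained in `B`, since monotonicity holds for generic
  -- configurations.
  have h1 : P (B ∩ A) = P A := by
    refine measure_congr (eventuallyEq_set.2 ?_)
    filter_upwards [hZ.ae_isGood hα hlam (isFading_gammaMeasure hα one_pos one_pos)] with ω hω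
    exact ⟨fun h => h.2, fun h => ⟨ShiftCovers.succ hα hm hω h, h⟩⟩
  have h2 : P (B \ A) ≠ 0 := hZ.measure_shiftCovers_sdiff_ne_zero hα hθ hlam hm
  refine (ENNReal.toReal_lt_toReal (measure_ne_top _ _) (measure_ne_top _ _)).2 ?_
  rw [← measure_inter_add_sdiff₀ B (hZ.nullMeasurableSet_shiftCovers hα hlam hm), h1]
  exact ENNReal.lt_add_right (measure_ne_top _ _) h2

lemma ShiftCovers.exists_isCovering {z : ℕ → Plane × ℝ} (h : ShiftCovers α θ m z) :
    ∃ i, IsCovering α θ z i :=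
  h.imp fun _ hi => hi.1

lemma IsPoisson.tendsto_measureReal_shiftCovers (hα : 2 < α) (hlam : 0 < lam)
    (hZ : IsPoisson P Z (intensity lam (gammaMeasure 1 1))) :
    Tendsto (fun m : ℕ => P.real {ω | ShiftCovers α θ m fun i => Z i ω}) atTop
      (𝓝 (P.real {ω | ∃ i, IsCovering α θ (fun i => Z i ω) i})) := by
  -- The index is shifted because the coupling needs `m ≥ 1`. The events are null measurable, hence
  -- the passage to measurable supersets that agree almost everywhere; their indicators converge
  -- almost surely.
  rw [← tendsto_add_atTop_iff_nat 1]
  choose B hB hBm hBeq using fun m : ℕ =>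
    (hZ.nullMeasurableSet_shiftCovers (θ := θ) hα hlam
      (Nat.le_add_left 1 m)).exists_measurable_superset_ae_eq
  have hS : MeasurableSet {ω | ∃ i, IsCovering α θ (fun i => Z i ω) i} := by
    have : {ω | ∃ i, IsCovering α θ (fun i => Z i ω) i} =
        ⋃ i, {ω | IsCovering α θ (fun i => Z i ω) i} := by
      ext ω
      simp
    rw [this]
    exact MeasurableSet.iUnion fun i =>
      measurableSet_lt ((hZ.measurable_tsum (measurable_power α)).const_mul _)
        (((measurable_power α).comp (hZ.measurable i)).const_mul _)
  refine (ENNReal.tendsto_toReal (measure_ne_top _ _)).comp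
    (Tendsto.congr (fun m => measure_congr (hBeq m))
      (tendsto_measure_of_ae_tendsto_indicator_of_isFiniteMeasure atTop hS hBm ?_))
  have hall : ∀ᵐ ω ∂P, ∀ m, ω ∈ B m ↔ ShiftCovers α θ (m + 1) fun i => Z i ω :=
    ae_all_iff.2 fun m => eventuallyEq_set.1 (hBeq m)
  filter_upwards [hall, hZ.ae_isGood hα hlam (isFading_gammaMeasure hα one_pos one_pos)]
    with ω hω hg
  by_cases hc : ∃ i, IsCovering α θ (fun i => Z i ω) i
  · obtain ⟨i, hi⟩ := hc
    filter_upwards [(tendsto_add_atTop_nat 1).eventually (eventually_shiftCovers hα hg hi)]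
      with m hm
    exact ⟨fun _ => ⟨i, hi⟩, fun _ => (hω m).2 hm⟩
  · refine Eventually.of_forall fun m => ⟨fun h => ?_, fun h => absurd h hc⟩
    exact ((hω m).1 h).exists_isCovering

/-- The given network and the shifted Rayleigh network have the same intensity, hence the same
coverage probability, although they live on different spaces. This places all `m` on one probability
space. -/
lemma IsNetwork.coverageClosest_losFading {Ω' : Type*} [MeasurableSpace Ω'] {P' : Measure Ω'}
    [IsProbabilityMeasure P'] {X : ℕ → Ω' → Plane} {g : ℕ → Ω' → ℝ} (hα : 2 < α) (hθ : 0 < θ)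
    (hlam : 0 < lam) (hm : 1 ≤ m) (h : IsNetwork P' X g lam (losFading m))
    (hZ : IsPoisson P Z (intensity lam (gammaMeasure 1 1))) :
    coverageClosest P' X g α θ = P.real {ω | ShiftCovers α θ m fun i => Z i ω} := by
  have hF := isFading_losFading hα hm
  rw [h.coverageClosest_eq hα hθ hlam hF, measureReal_def, measureReal_def,
    (h.isPoisson_intensity hF).measure_closestCovers_eq hα hlam hF (hZ.isPoisson_shift hα hm),
    measure_congr (hZ.shiftCovers_ae_eq hα hlam hm)]

end Coupling

end Coverage

end CellularNetwork

end

/-! ### The main theorem. -/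

theorem mainTheorem3
    (α θ : ℝ) (hα : 2 < α) (hθ : 0 < θ) (lam : ℝ≥0) (hlam : 0 < lam)
    -- for every `m ≥ 1`, a network with LOS (Nakagami-`m`) fading
    {Ω : ℕ → Type*} [∀ m, MeasurableSpace (Ω m)]
    (P : ∀ m, Measure (Ω m)) [∀ m, IsProbabilityMeasure (P m)]
    (X : ∀ m, ℕ → Ω m → CellularNetwork.Plane) (g : ∀ m, ℕ → Ω m → ℝ)
    (hLOS : ∀ m : ℕ, 1 ≤ m →
      CellularNetwork.IsNetwork (P m) (X m) (g m) lam (CellularNetwork.losFading m))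
    -- a network with NLOS (Rayleigh) fading
    {Ω' : Type*} [MeasurableSpace Ω'] (P' : Measure Ω') [IsProbabilityMeasure P']
    (X' : ℕ → Ω' → CellularNetwork.Plane) (g' : ℕ → Ω' → ℝ)
    (hNLOS : CellularNetwork.IsNetwork P' X' g' lam CellularNetwork.nlosFading) :
    -- strict monotonicity in `m`
    (∀ m : ℕ, 1 ≤ m →
      CellularNetwork.coverageClosest (P m) (X m) (g m) α θ <
        CellularNetwork.coverageClosest (P (m + 1)) (X (m + 1)) (g (m + 1)) α θ) ∧
    -- comparison with the Rayleigh value: equality for `m = 1`, strictly larger for `m ≥ 2`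
    CellularNetwork.coverageClosest (P 1) (X 1) (g 1) α θ =
      CellularNetwork.coverageClosest P' X' g' α θ ∧
    (∀ m : ℕ, 2 ≤ m →
      CellularNetwork.coverageClosest P' X' g' α θ <
        CellularNetwork.coverageClosest (P m) (X m) (g m) α θ) ∧
    -- limit as `m → ∞`: the strongest-association value under Rayleigh fading
    Tendsto (fun m : ℕ => CellularNetwork.coverageClosest (P m) (X m) (g m) α θ) atTop
      (𝓝 (CellularNetwork.coverageStrongest P' X' g' α θ)) ∧
    -- which has its closed form when `θ ≥ 1`
    (1 ≤ θ → CellularNetwork.coverageStrongest P' X' g' α θ =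
      1 / (2 * CellularNetwork.zetaCoeff α 1 * θ ^ (2 / α))) := by
  have hZ := hNLOS.isPoisson_intensity (CellularNetwork.isFading_nlosFading hα)
  -- The given Rayleigh network serves as the common probability space for all `m`.
  have hcov : ∀ m : ℕ, 1 ≤ m → CellularNetwork.coverageClosest (P m) (X m) (g m) α θ =
      P'.real {ω | CellularNetwork.ShiftCovers α θ m fun i => (X' i ω, g' i ω)} := fun m hm =>
    (hLOS m hm).coverageClosest_losFading hα hθ hlam hm hZ
  have hstrict : ∀ m : ℕ, 1 ≤ m → CellularNetwork.coverageClosest (P m) (X m) (g m) α θ <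
      CellularNetwork.coverageClosest (P (m + 1)) (X (m + 1)) (g (m + 1)) α θ := fun m hm => by
    rw [hcov m hm, hcov (m + 1) (by omega)]
    exact hZ.measureReal_shiftCovers_lt hα hθ hlam hm
  have hone : CellularNetwork.coverageClosest (P 1) (X 1) (g 1) α θ =
      CellularNetwork.coverageClosest P' X' g' α θ :=
    (hLOS 1 le_rfl).coverageClosest_congr hα hθ hlam
      (CellularNetwork.isFading_losFading hα le_rfl) (CellularNetwork.losFading_one ▸ hNLOS)
  have hstrong := hNLOS.coverageStrongest_eq hα hθ hlam (CellularNetwork.isFading_nlosFading hα)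
  refine ⟨hstrict, hone, fun m hm => ?_, ?_, fun hθ1 => ?_⟩
  · rw [← hone]
    induction m, hm using Nat.le_induction with
    | base => exact hstrict 1 le_rfl
    | succ k hk ih => exact ih.trans (hstrict k (by omega))
  · rw [hstrong]
    refine (hZ.tendsto_measureReal_shiftCovers hα hlam).congr' ?_
    filter_upwards [eventually_ge_atTop 1] with m hm using (hcov m hm).symm
  · have hδ : 2 / α < 1 := by
      rw [div_lt_one (by linarith)]
      exact hα
    have hG1 := Real.Gamma_pos_of_pos (show 0 < 1 - 2 / α by linarith)
    have hG2 := Real.Gamma_pos_of_pos (show 0 < 1 + 2 / α by positivity)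
    rw [hstrong, measureReal_def, hZ.measure_exists_isCovering hα hθ1 hlam,
      ENNReal.toReal_ofReal (by positivity), CellularNetwork.two_mul_zetaCoeff_one hα]
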